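/- Let $\mathcal C$ be a small category with finite limits, and let $\mathrm{Pro}(\mathcal C)$ be its category of pro-objects (small cofiltered diagrams, with $\mathrm{Hom}(X,Y)=\lim_s\operatorname{colim}_t\mathrm{Hom}_{\mathcal C}(X_t,Y_s)$), which contains $\mathcal C$ as the full subcategory of simple (constant) pro-objects. A poset $T$ is regarded as a category with one arrow $t\to s$ whenever $t\ge s$; it is cofinite if every set $\{s\mid s\le t\}$ is finite. For a class $M$ of morphisms of $\mathcal C$: - $Sp^{\cong}(M)$ is the class of morphisms of $\mathrm{Pro}(\mathcal C)$ that are isomorphic (as arrows) to a morphism coming from a natural transformation $X\to Y$ of diagrams indexed by a cofinite directed poset $T$ such that $X_t\to Y_t\times_{\lim_{s<t}Y_s}\lim_{s<t}X_s$ is in $M$ for every $t\in T$; - $cocell(M)$ is the class of morphisms of $\mathrm{Pro}(\mathcal C)$ that are isomorphic to a transfinite composition $\lim_{t<\lambda}X_t\to X_0$ of a tower $(X_t)_{t<\lambda}$, for some ordinal $\lambda\geq 1$, in which $X_{t+1}\to X_t$ is a pullback of a morphism in $M$ whenever $t+1<\lambda$, and $X_t\to\lim_{s<t}X_s$ is an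 isomorphism for every limit ordinal $t<\lambda$; - $R(-)$ denotes the class of retracts (in the arrow category) of morphisms of a class. (1) If $M$ contains all isomorphisms of $\mathcal C$ and is closed under composition and under pullbacks, then $R(cocell(M))=R(Sp^{\cong}(M))$ in $\mathrm{Pro}(\mathcal C)$. In particular Isaksen's conjecture, that $R(cocell(M))\subseteq R(Sp^{\cong}(M))$, holds for such $M$. (2) The conjecture fails for general classes $M$: if $\mathcal C$ is the category consisting of one commutative square $a\to b\to d$, $a\to c\to d$, and $M$ consists only of the map $b\to d$, then the map $a\to c$, regarded as a map of simple pro-objects, is in $R(cocell(M))$ but not in $R(Sp^{\cong}(M))$. (3) Every trivial cofibration (monomorphism that is a weak homotopy equivalence) $A\to B$ between simplicial sets with finitely many non-degenerate simplices is a retract of a map $X\to Y$, between simplicial sets with finitely many non-degenerate simplices, that is a finite relative horn-cell complex, i.e. a composition of a finite sequence of pushouts of horn inclusions $\Lambda^n_i\to\Delta^n$ ($n\ge 1$, $0\le i\le n$), the empty composition being an isomorphism. -/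

import Mathlib

open CategoryTheory CategoryTheory.Limits Opposite

universe w v u

/-! ### Pro-categories -/

section ProCategory

/-- The category of pro-objects of a small category `C`, as the opposite of the category of
ind-objects of `Cᵒᵖ`: a pro-object is a formal limit of a small cofiltered diagram in `C`, and
the morphisms from `{X_t}` to `{Y_s}` are `lim_s colim_t Hom(X_t, Y_s)`. -/
abbrev ProCat (C : Type u) [SmallCategory C] : Type (u + 1) :=
  (Ind Cᵒᵖ)ᵒᵖ

/-- The fully faithful embedding of `C` in `ProCat C`, as the simple pro-objects. -/
noncomputable def ProCat.simple (C : Type u) [SmallCategory C] : C ⥤ ProCat C :=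
  (Ind.yoneda (C := Cᵒᵖ)).rightOp

/-- The pro-object given by a diagram `X` that is indexed by a directed poset `T`. A poset is
regarded as a category with a (unique) arrow `t ⟶ s` when `t ≥ s`, which is `Tᵒᵖ`. -/
noncomputable def ProCat.ofDiagram {C : Type u} [SmallCategory C] {T : Type u} [PartialOrder T]
    [Nonempty T] [IsDirectedOrder T] (X : Tᵒᵖ ⥤ C) : ProCat C :=
  op ((Ind.lim T).obj X.rightOp)

/-- The morphism of pro-objects that comes from a natural transformation. -/
noncomputable def ProCat.ofNatTrans {C : Type u} [SmallCategory C] {T : Type u} [PartialOrder T]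
    [Nonempty T] [IsDirectedOrder T] {X Y : Tᵒᵖ ⥤ C} (F : X ⟶ Y) :
    ProCat.ofDiagram X ⟶ ProCat.ofDiagram Y :=
  ((Ind.lim T).map (NatTrans.rightOp F)).op

end ProCategory

/-! ### Special maps -/

section Special

/-- A poset is cofinite if every element has only finitely many elements below it. -/
class CofinitePoset (T : Type w) [PartialOrder T] : Prop where
  finite_Iic (t : T) : (Set.Iic t).Finite

instance CofinitePoset.finite_Iio {T : Type w} [PartialOrder T] [CofinitePoset T] (t : T) :
    Finite (Set.Iio t) :=
  ((CofinitePoset.finite_Iic t).subset Set.Iio_subset_Iic_self).to_subtype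

instance CofinitePoset.hasLimitsOfShape {T : Type w} [PartialOrder T] [CofinitePoset T] (t : T)
    {C : Type u} [Category.{v} C] [HasFiniteLimits C] :
    HasLimitsOfShape (Set.Iio t)ᵒᵖ C :=
  haveI : Fintype (Set.Iio t) := Fintype.ofFinite _
  hasLimitsOfShape_of_hasFiniteLimits _ _

variable {T : Type w} [PartialOrder T] {C : Type u} [Category.{v} C]

/-- The inclusion of the elements `s < t`. -/
abbrev belowInclusion (t : T) : Set.Iio t ⥤ T :=
  Monotone.functor (f := fun s : Set.Iio t => (s : T)) (fun _ _ h => h)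

/-- The restriction of a diagram to the elements `s < t`. -/
abbrev belowDiagram (X : Tᵒᵖ ⥤ C) (t : T) : (Set.Iio t)ᵒᵖ ⥤ C :=
  (belowInclusion t).op ⋙ X

/-- The cone on the elements `s < t` with point `X_t`. -/
def belowCone (X : Tᵒᵖ ⥤ C) (t : T) : Cone (belowDiagram X t) where
  pt := X.obj (op t)
  π :=
    { app := fun s => X.map (homOfLE (le_of_lt s.unop.2)).op
      naturality := fun _ _ _ => (Category.id_comp _).trans
        ((congrArg X.map (Subsingleton.elim _ _)).trans (X.map_comp _ _)) }

variable [CofinitePoset T] [HasFiniteLimits C]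

/-- `lim_{s < t} X_s`. -/
noncomputable abbrev limBelow (X : Tᵒᵖ ⥤ C) (t : T) : C :=
  limit (belowDiagram X t)

/-- The natural map `X_t ⟶ lim_{s < t} X_s`. -/
noncomputable abbrev toLimBelow (X : Tᵒᵖ ⥤ C) (t : T) : X.obj (op t) ⟶ limBelow X t :=
  limit.lift (belowDiagram X t) (belowCone X t)

lemma toLimBelow_π (X : Tᵒᵖ ⥤ C) (t : T) (s : (Set.Iio t)ᵒᵖ) :
    toLimBelow X t ≫ limit.π (belowDiagram X t) s = (belowCone X t).π.app s :=
  limit.lift_π _ _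

/-- The map `lim_{s < t} X_s ⟶ lim_{s < t} Y_s` induced by a natural transformation. -/
noncomputable abbrev limBelowMap {X Y : Tᵒᵖ ⥤ C} (F : X ⟶ Y) (t : T) :
    limBelow X t ⟶ limBelow Y t :=
  limMap (Functor.whiskerLeft (belowInclusion t).op F)

lemma toLimBelow_naturality {X Y : Tᵒᵖ ⥤ C} (F : X ⟶ Y) (t : T) :
    F.app (op t) ≫ toLimBelow Y t = toLimBelow X t ≫ limBelowMap F t := by
  refine limit.hom_ext fun s => ?_
  rw [Category.assoc, Category.assoc, toLimBelow_π, limMap_π, ← Category.assoc, toLimBelow_π]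
  exact (F.naturality _).symm

/-- The natural map `X_t ⟶ Y_t ×_{lim_{s < t} Y_s} lim_{s < t} X_s`. -/
noncomputable def relativeMatchingMap {X Y : Tᵒᵖ ⥤ C} (F : X ⟶ Y) (t : T) :
    X.obj (op t) ⟶ pullback (toLimBelow Y t) (limBelowMap F t) :=
  pullback.lift (F.app (op t)) (toLimBelow X t) (toLimBelow_naturality F t)

/-- A natural transformation between diagrams indexed by a cofinite poset is a special `M`-map if
all its relative matching maps are in `M`. -/
def IsSpecialMap (M : MorphismProperty C) {X Y : Tᵒᵖ ⥤ C} (F : X ⟶ Y) : Prop :=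
  ∀ t : T, M (relativeMatchingMap F t)

end Special

/-- `Sp^≅(M)`: the morphisms of pro-objects that are isomorphic, as arrows, to a morphism that
comes from a natural transformation which is a special `M`-map. -/
def spIso {C : Type u} [SmallCategory C] [HasFiniteLimits C] (M : MorphismProperty C) :
    MorphismProperty (ProCat C) := fun _ _ f =>
  ∃ (T : Type u) (_ : PartialOrder T) (_ : CofinitePoset T) (_ : Nonempty T)
    (_ : IsDirectedOrder T) (X Y : Tᵒᵖ ⥤ C) (F : X ⟶ Y),
    IsSpecialMap M F ∧ Nonempty (Arrow.mk f ≅ Arrow.mk (ProCat.ofNatTrans F))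

/-! ### Cocell complexes -/

/-- The relative `M`-cocell complexes in a category `D`: the transfinite compositions of inverse
towers (indexed by well-ordered types of size `w`) of pullbacks of morphisms in `M`. Inverse
towers in `D` are expressed as direct towers in `Dᵒᵖ`: a functor `J ⥤ Dᵒᵖ` that is continuous at
limit elements and whose successor maps come from pullbacks of morphisms in `M`; the composition
is the map from the limit in `D` to the value at the bottom element. -/
def cocell {D : Type u} [Category.{v} D] (M : MorphismProperty D) : MorphismProperty D :=
  (MorphismProperty.transfiniteCompositions.{w} M.pullbacks.op).unop

/-! ### The commutative square category -/

/-- The category which is a commutative square `a ⟶ b ⟶ d`, `a ⟶ c ⟶ d`, as a poset. -/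
def SquareCat : Type u :=
  ULift.{u} (Bool × Bool)

namespace SquareCat

noncomputable instance : Lattice SquareCat.{u} :=
  inferInstanceAs (Lattice (ULift.{u} (Bool × Bool)))

instance : OrderTop SquareCat.{u} where
  top := ⟨(true, true)⟩
  le_top x := ⟨Bool.le_true x.down.1, Bool.le_true x.down.2⟩

/-- The initial corner. -/
def a : SquareCat.{u} := ⟨(false, false)⟩

/-- The first middle corner. -/
def b : SquareCat.{u} := ⟨(true, false)⟩

/-- The second middle corner. -/
def c : SquareCat.{u} := ⟨(false, true)⟩

/-- The terminal corner. -/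
def d : SquareCat.{u} := ⟨(true, true)⟩

/-- The unique map from `b` to `d`. -/
noncomputable def bd : b.{u} ⟶ d.{u} := homOfLE ⟨Bool.le_true _, Bool.false_le _⟩

/-- The unique map from `a` to `c`. -/
noncomputable def ac : a.{u} ⟶ c.{u} := homOfLE ⟨Bool.false_le _, Bool.false_le _⟩

/-- The class that consists only of the map from `b` to `d`. -/
def onlyBD : MorphismProperty SquareCat.{u} :=
  MorphismProperty.ofHoms (fun _ : Unit => bd.{u})

end SquareCat

/-! ### Simplicial sets -/

/-- A map `f : X ⟶ Y` of simplicial sets is a weak homotopy equivalence if for every Kan complex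
`K`, precomposition with `f` induces a bijection from the set of connected components of the
simplicial mapping space `Map(Y, K)` (the simplicial homotopy classes of maps from `Y` to `K`) to
that of `Map(X, K)`. -/
def IsWeakHomotopyEquiv {X Y : SSet.{u}} (f : X ⟶ Y) : Prop :=
  ∀ K : SSet.{u}, SSet.KanComplex K →
    Function.Bijective (SSet.mapπ₀ ((MonoidalClosed.pre f).app K))

/-- A trivial cofibration of simplicial sets: a monomorphism that is a weak homotopy
equivalence. -/
def IsTrivialCofibration {X Y : SSet.{u}} (f : X ⟶ Y) : Prop :=
  Mono f ∧ IsWeakHomotopyEquiv f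

/-- The finite relative horn-cell complexes: the compositions of finite sequences of pushouts of
horn inclusions `Λ[n, i] ⟶ Δ[n]`, with `0 ≤ i ≤ n` and `1 ≤ n`. The empty sequence gives
the isomorphisms. -/
def finiteHornCell : MorphismProperty SSet.{u} :=
  ⨆ n : ℕ, SSet.modelCategoryQuillen.J.{u}.pushouts.transfiniteCompositionsOfShape (Fin (n + 1))

/-! (1) Let `F : X ⟶ Y` be a special map over `T`. Starting from the limit of `Y`, adjoin the
objects `X_t` one at a time along a well-order that extends `T`. Each step is a base change of the
relative matching map at `t`, so `ofNatTrans F` is a cocell complex (`cocell_ofNatTrans`).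
Conversely, a dual small object argument factors every map of pro-objects as a map with the left
lifting property against `M` followed by a special map (`exists_llp_spIso_factorization`). Cocell
complexes lift against the first factor, and the retract argument concludes. Closure of `M` under
base change and composition permits finitely many pullbacks to be inserted at one index. Simple
pro-objects are cosmall, so ω steps suffice.

(2) The map a → c is a base change of b → d. In a special map every `X_t` is the source of a map in
`M`, hence equal to b, and a retraction would give a map b → a.

(3) Take an anodyne map B → B' with B' Kan, and factor A → B' as a relative horn-cell complex A → W
followed by a fibration. Weak equivalences are tested on maps into Kan complexes, so `f` lifts
against fibrations between Kan complexes (`IsTrivialCofibration.exists_lift`); this gives B → W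
under A and over B'. By finiteness, W and B' may be replaced by finite stages W' and D. Now factor
`f` as a relative horn-cell complex e : A → E followed by a fibration p : E → B. As B need not be
Kan, `f` cannot be lifted against p directly. However, fibrations extend along finite horn-cell
complexes (`finiteHornCell_le_extendsFibrations`), so p is the restriction of a fibration p' over D.
The map A → W' lifts against p', and composing with B → W' gives a section s of p with f ≫ s = e. A
finite stage of E that contains the image of s exhibits `f` as a retract.

To extend a fibration E → Λ over Δ, factor E → Δ as an anodyne map E → G and a fibration. Over the
horn, E is a vertical deformation retract of G, because this can be tested over the vertex k;
cutting G down to E over the horn leaves a retract of G, hence a fibration. -/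

section

open MonoidalCategory CartesianMonoidalCategory HomotopicalAlgebra Simplicial
open SSet.modelCategoryQuillen

namespace SSet

/-! ### Anodyne extensions, homotopy lifting and strong deformation retracts -/

section Anodyne

instance (Z : SSet.{u}) {X Y : SSet.{u}} (f : X ⟶ Y) [Mono f] : Mono (Z ◁ f) where
  right_cancellation g h w := by
    ext : 1
    · simpa using w =≫ fst _ _
    · rw [← cancel_mono f]
      simpa using w =≫ snd _ _

lemma fin_two_of_le_of_ne : ∀ {x y : Fin 2}, y ≤ x → x ≠ y → x = 1 ∧ y = 0 := by
  decide

variable {X Y P Q : SSet.{u}}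

lemma anodyneExtensions.exists_lift {i : X ⟶ Y} (hi : anodyneExtensions i) {p : P ⟶ Q}
    [Fibration p] (a : X ⟶ P) (b : Y ⟶ Q) (h : a ≫ p = i ≫ b) :
    ∃ l : Y ⟶ P, i ≫ l = a ∧ l ≫ p = b := by
  have := hi p ((HomotopicalAlgebra.fibration_iff p).1 inferInstance)
  have sq : CommSq a i p b := ⟨h⟩
  exact ⟨sq.lift, sq.fac_left, sq.fac_right⟩

lemma anodyneExtensions.of_exists_lift {i : X ⟶ Y}
    (h : ∀ {P Q : SSet.{u}} (p : P ⟶ Q) [Fibration p] (a : X ⟶ P) (b : Y ⟶ Q),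
      a ≫ p = i ≫ b → ∃ l : Y ⟶ P, i ≫ l = a ∧ l ≫ p = b) : anodyneExtensions i := by
  intro P Q p hp
  have : Fibration p := (HomotopicalAlgebra.fibration_iff p).2 hp
  refine ⟨fun {a b} sq => ?_⟩
  obtain ⟨l, h₁, h₂⟩ := h p a b sq.w
  exact ⟨⟨⟨l, h₁, h₂⟩⟩⟩

lemma anodyneExtensions.exists_extension {i : X ⟶ Y} (hi : anodyneExtensions i)
    [KanComplex P] (a : X ⟶ P) : ∃ l : Y ⟶ P, i ≫ l = a := by
  obtain ⟨l, hl, -⟩ := hi.exists_lift (p := terminal.from P) a (terminal.from Y) (by simp)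
  exact ⟨l, hl⟩

lemma anodyneExtensions.mono {i : X ⟶ Y} (hi : anodyneExtensions i) : Mono i := by
  have h : anodyneExtensions.{u} ≤ MorphismProperty.monomorphisms SSet.{u} := by
    rw [anodyneExtensions_eq_retracts_transfiniteCompositionsOfShape,
      MorphismProperty.retracts_le_iff]
    refine (MorphismProperty.transfiniteCompositionsOfShape_monotone ℕ ?_).trans
      (MorphismProperty.transfiniteCompositionsOfShape_le _ _)
    rw [MorphismProperty.pushouts_le_iff, MorphismProperty.coproducts_le_iff]
    exact J_le_monomorphisms
  exact h _ hi

/-- The inclusion of one end in the cylinder. -/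
noncomputable def inc (e : Fin 2) {X : SSet.{u}} : X ⟶ X ⊗ Δ[1] :=
  lift (𝟙 X) (const (stdSimplex.obj₀Equiv.{u}.symm e))

lemma inc_whiskerRight_assoc (e : Fin 2) (f : X ⟶ Y) {Z : SSet.{u}} (h : Y ⊗ Δ[1] ⟶ Z) :
    inc e ≫ f ▷ Δ[1] ≫ h = f ≫ inc e ≫ h := rfl

@[simp]
lemma inc_fst_assoc (e : Fin 2) {Z : SSet.{u}} (h : X ⟶ Z) : inc e ≫ fst X Δ[1] ≫ h = h := rfl

lemma const_obj₀Equiv_symm_eq_δ (e : Fin 2) :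
    (const (stdSimplex.obj₀Equiv.{u}.symm e) : Δ[0] ⟶ Δ[1]) = stdSimplex.δ (1 - e) := by
  apply yonedaEquiv.injective
  ext k
  fin_cases e <;> fin_cases k <;> rfl

/-- The vertex `e` is the only face of the horn `Λ[1, e]`, and compatibility of a single face is
automatic, so the lift is a horn filler. -/
lemma anodyneExtensions_const (e : Fin 2) :
    anodyneExtensions (const (stdSimplex.obj₀Equiv.{u}.symm e) : Δ[0] ⟶ Δ[1]) := by
  refine .of_exists_lift fun {P Q} p _ a b h => ?_
  rw [const_obj₀Equiv_symm_eq_δ] at h ⊢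
  obtain ⟨φ, h₁, h₂⟩ := horn.IsCompatible.exists_lift (i := e) (f := fun _ _ => a)
    ((horn.isCompatible_zero_iff_true _).2 trivial) p b (fun j hj => by
      obtain rfl : j = 1 - e := by fin_cases e <;> fin_cases j <;> simp_all
      exact h)
  exact ⟨φ, h₁ _ (by fin_cases e <;> simp), h₂⟩

/-- The pushout-product of a monomorphism with an endpoint `Δ[0] ⟶ Δ[1]` is anodyne. This is
homotopy lifting and homotopy extension at once. -/
theorem exists_homotopy_lift {i : X ⟶ Y} [Mono i] {p : P ⟶ Q} [Fibration p] (e : Fin 2)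
    (u : X ⊗ Δ[1] ⟶ P) (y : Y ⟶ P) (v : Y ⊗ Δ[1] ⟶ Q) (h₁ : i ≫ y = inc e ≫ u)
    (h₂ : u ≫ p = i ▷ _ ≫ v) (h₃ : y ≫ p = inc e ≫ v) :
    ∃ w : Y ⊗ Δ[1] ⟶ P, i ▷ _ ≫ w = u ∧ inc e ≫ w = y ∧ w ≫ p = v := by
  let j : Δ[0] ⟶ Δ[1] := const (stdSimplex.obj₀Equiv.{u}.symm e)
  let sq := Functor.PushoutObjObj.ofHasPushout (curriedTensor SSet.{u}) i j
  have hsq := anodyneExtensions_pushoutObjObjι sq (anodyneExtensions_const e)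
  have hinc : ∀ Z : SSet.{u}, Z ◁ j = fst Z Δ[0] ≫ inc e := fun _ => rfl
  obtain ⟨l, hl₁, hl₂⟩ := hsq.exists_lift (p := p)
    (sq.isPushout.desc (fst Y Δ[0] ≫ y) u (by
      change i ▷ Δ[0] ≫ fst Y Δ[0] ≫ y = X ◁ j ≫ u
      rw [whiskerRight_fst_assoc, h₁, hinc, Category.assoc])) v (by
    apply sq.isPushout.hom_ext
    · rw [IsPushout.inl_desc_assoc, Functor.PushoutObjObj.inl_ι_assoc, Category.assoc, h₃]
      rfl
    · rw [IsPushout.inr_desc_assoc, Functor.PushoutObjObj.inr_ι_assoc, h₂]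
      rfl)
  refine ⟨l, ?_, ?_, hl₂⟩
  · have := sq.inr ≫= hl₁
    rw [IsPushout.inr_desc, Functor.PushoutObjObj.inr_ι_assoc] at this
    exact this
  · have := sq.inl ≫= hl₁
    rw [IsPushout.inl_desc, Functor.PushoutObjObj.inl_ι_assoc] at this
    have h := lift (𝟙 Y) (const (stdSimplex.obj₀Equiv.{u}.symm 0)) ≫= this
    exact h

/-- The map from `Y ⊗ ∂Δ[1]` that is given by maps on both ends. -/
def boundaryDesc (y : Fin 2 → (Y ⟶ P)) : Y ⊗ (∂Δ[1] : SSet.{u}) ⟶ P where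
  app n := ↾fun s => (y (stdSimplex.asOrderHom s.2.1 0)).app n s.1
  naturality n m φ := by
    ext ⟨s, t, ht⟩
    -- A simplex of `∂Δ[1]` is not surjective, hence constant, so its value at `0` is not changed by
    -- `φ`.
    have key : stdSimplex.asOrderHom ((Δ[1] : SSet.{u}).map φ t) 0 = stdSimplex.asOrderHom t 0 := by
      change stdSimplex.asOrderHom t (φ.unop.toOrderHom 0) = stdSimplex.asOrderHom t 0
      by_contra hne
      refine ht fun k => ?_
      have h0 : (0 : Fin _) ≤ φ.unop.toOrderHom 0 := Fin.zero_le _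
      have := (stdSimplex.asOrderHom t).monotone h0
      have h1 := fin_two_of_le_of_ne this hne
      fin_cases k
      · exact ⟨_, h1.2⟩
      · exact ⟨_, h1.1⟩
    change (y (stdSimplex.asOrderHom ((Δ[1] : SSet.{u}).map φ t) 0)).app m (Y.map φ s) =
      P.map φ ((y (stdSimplex.asOrderHom t 0)).app n s)
    rw [key]
    exact ConcreteCategory.congr_hom ((y (stdSimplex.asOrderHom t 0)).naturality φ) s

/-- The inclusion of one end in the product with the boundary of the interval. -/
noncomputable def boundaryInc (e : Fin 2) : Y ⟶ Y ⊗ (∂Δ[1] : SSet.{u}) :=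
  lift (𝟙 Y) (const ⟨stdSimplex.obj₀Equiv.{u}.symm e, by
    rw [boundary_obj_eq_univ 0 1]; trivial⟩)

lemma boundary_hom_ext {f g : Y ⊗ (∂Δ[1] : SSet.{u}) ⟶ P}
    (h : ∀ e, boundaryInc e ≫ f = boundaryInc e ≫ g) : f = g := by
  ext n ⟨s, t, ht⟩
  have key : ∃ e, t = (const (X := Y) (stdSimplex.obj₀Equiv.{u}.symm e)).app n s := by
    refine ⟨stdSimplex.asOrderHom t 0, ?_⟩
    by_contra hne
    refine ht ?_
    have : ∃ k, stdSimplex.asOrderHom t k ≠ stdSimplex.asOrderHom t 0 := by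
      by_contra! hk
      apply hne
      apply stdSimplex.objEquiv.injective
      ext k : 3
      exact hk k
    obtain ⟨k, hk⟩ := this
    have := (stdSimplex.asOrderHom t).monotone (Fin.zero_le k)
    intro l
    have h1 := fin_two_of_le_of_ne this hk
    fin_cases l
    · exact ⟨_, h1.2⟩
    · exact ⟨_, h1.1⟩
  obtain ⟨e, rfl⟩ := key
  exact ConcreteCategory.congr_hom (congr_app (h e) n) s

/-- For anodyne `i` both ends can be prescribed, because the pushout-product with `∂Δ[1] ⟶ Δ[1]` is
still anodyne. In particular two lifts of one problem are homotopic over `Q` and relative to `X`. -/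
theorem anodyneExtensions.exists_homotopy_lift {i : X ⟶ Y} (hi : anodyneExtensions i)
    {p : P ⟶ Q} [Fibration p] (u : X ⊗ Δ[1] ⟶ P) (y : Fin 2 → (Y ⟶ P)) (v : Y ⊗ Δ[1] ⟶ Q)
    (h₁ : ∀ e, i ≫ y e = inc e ≫ u) (h₂ : u ≫ p = i ▷ _ ≫ v) (h₃ : ∀ e, y e ≫ p = inc e ≫ v) :
    ∃ w : Y ⊗ Δ[1] ⟶ P, i ▷ _ ≫ w = u ∧ (∀ e, inc e ≫ w = y e) ∧ w ≫ p = v := by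
  let sq := Functor.PushoutObjObj.ofHasPushout (curriedTensor SSet.{u}) i
    (∂Δ[1] : (Δ[1] : SSet.{u}).Subcomplex).ι
  have hsq := anodyneExtensions_pushoutObjObjι' sq hi
  obtain ⟨l, hl₁, hl₂⟩ := hsq.exists_lift (p := p)
    (sq.isPushout.desc (boundaryDesc y) u (by
      refine boundary_hom_ext fun e => ?_
      exact h₁ e)) v (by
    apply sq.isPushout.hom_ext
    · rw [IsPushout.inl_desc_assoc, Functor.PushoutObjObj.inl_ι_assoc]
      refine boundary_hom_ext fun e => ?_
      exact h₃ e
    · rw [IsPushout.inr_desc_assoc, Functor.PushoutObjObj.inr_ι_assoc, h₂]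
      rfl)
  refine ⟨l, ?_, fun e => ?_, hl₂⟩
  · have := sq.inr ≫= hl₁
    rw [IsPushout.inr_desc, Functor.PushoutObjObj.inr_ι_assoc] at this
    exact this
  · have := sq.inl ≫= hl₁
    rw [IsPushout.inl_desc, Functor.PushoutObjObj.inl_ι_assoc] at this
    exact boundaryInc e ≫= this

/-- Left cancellation. -/
theorem anodyneExtensions.of_precomp {Z : SSet.{u}} {f : X ⟶ Y} {g : Y ⟶ Z} [Mono g]
    (hf : anodyneExtensions f) (hfg : anodyneExtensions (f ≫ g)) : anodyneExtensions g := by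
  refine .of_exists_lift fun {P Q} p _ a b h => ?_
  -- On `Y` the lift `l` agrees with `a` only after restriction to `X`. As `f` is anodyne, there is
  -- a homotopy `w` from `g ≫ l` to `a` over `Q`. Extended along `g` starting from `l`, it ends at a
  -- lift that restricts to `a`.
  obtain ⟨l, hl₁, hl₂⟩ := hfg.exists_lift (p := p) (f ≫ a) b (by simp [h])
  obtain ⟨w, hw₁, hw₂, hw₃⟩ := hf.exists_homotopy_lift (p := p) (fst _ _ ≫ f ≫ a)
    ![g ≫ l, a] (fst _ _ ≫ a ≫ p) (by
      intro e
      fin_cases e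
      · simpa using hl₁
      · simp) (by simp) (by
      intro e
      fin_cases e
      · simp [hl₂, h]
      · simp)
  obtain ⟨w', hw₁', hw₂', hw₃'⟩ := SSet.exists_homotopy_lift (i := g) (p := p) 0 w l
    (fst _ _ ≫ b) (by simpa using (hw₂ 0).symm) (by simp [hw₃, h]) (by simp [hl₂])
  refine ⟨inc 1 ≫ w', ?_, ?_⟩
  · rw [← inc_whiskerRight_assoc, hw₁']
    simpa using hw₂ 1
  · simp [hw₃']

/-- A morphism `i : X ⟶ Y` is the inclusion of a strong deformation retract, with a homotopy in
one step from the identity (at the end `e`) to a retraction. -/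
structure IsStrongDeformationRetract (i : X ⟶ Y) : Prop where
  exists_homotopy : ∃ (e e' : Fin 2) (r : Y ⟶ X) (H : Y ⊗ Δ[1] ⟶ Y), i ≫ r = 𝟙 X ∧
    inc e ≫ H = 𝟙 Y ∧ inc e' ≫ H = r ≫ i ∧ i ▷ Δ[1] ≫ H = fst _ _ ≫ i

namespace IsStrongDeformationRetract

lemma mono {i : X ⟶ Y} (hi : IsStrongDeformationRetract i) : Mono i := by
  obtain ⟨e, e', r, H, h, -⟩ := hi
  have : IsSplitMono i := ⟨⟨⟨r, h⟩⟩⟩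
  infer_instance

/-- The homotopy `H ≫ b` is lifted from `r ≫ a` at the end `e'`, constantly on `X`; its end `e` is
the required lift. -/
lemma anodyneExtensions {i : X ⟶ Y} (hi : IsStrongDeformationRetract i) :
    anodyneExtensions i := by
  have := hi.mono
  obtain ⟨e, e', r, H, h₁, h₂, h₃, h₄⟩ := hi
  refine .of_exists_lift fun {P Q} p _ a b h => ?_
  obtain ⟨w, hw₁, hw₂, hw₃⟩ := exists_homotopy_lift (i := i) (p := p) e' (fst _ _ ≫ a) (r ≫ a)
    (H ≫ b) (by simp [reassoc_of% h₁]) (by simp [reassoc_of% h₄, h])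
    (by simp [reassoc_of% h₃, h])
  refine ⟨inc e ≫ w, ?_, ?_⟩
  · rw [← inc_whiskerRight_assoc, hw₁]
    simp
  · simp [hw₃, reassoc_of% h₂]

/-- Strong deformation retracts are stable under pullbacks along fibrations. -/
lemma of_isPullback {X' Y' : SSet.{u}} {i : X ⟶ Y} (hi : IsStrongDeformationRetract i)
    {i' : X' ⟶ Y'} {q : X' ⟶ X} {p : Y' ⟶ Y} [Fibration p] (sq : IsPullback i' q p i) :
    IsStrongDeformationRetract i' := by
  have := hi.mono
  obtain ⟨e, e', r, H, h₁, h₂, h₃, h₄⟩ := hi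
  have : Mono i' := MorphismProperty.of_isPullback (P := .monomorphisms _) sq.flip this
  -- The deformation of `Y` is lifted to `Y'`, starting at the identity and constant on `X'`. Its
  -- other end lies over `X`, which defines the retraction.
  obtain ⟨w, hw₁, hw₂, hw₃⟩ := exists_homotopy_lift (i := i') (p := p) e (fst _ _ ≫ i') (𝟙 Y')
    (p ▷ _ ≫ H) (by simp) (by
      rw [← comp_whiskerRight_assoc, sq.w, comp_whiskerRight_assoc, h₄]
      simp [sq.w]) (by rw [inc_whiskerRight_assoc, h₂]; simp)
  let r' : Y' ⟶ X' := sq.lift (inc e' ≫ w) (p ≫ r) (by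
    rw [Category.assoc, hw₃, inc_whiskerRight_assoc, h₃, Category.assoc])
  refine ⟨e, e', r', w, ?_, hw₂, (sq.lift_fst _ _ _).symm, hw₁⟩
  rw [← cancel_mono i', Category.assoc, sq.lift_fst, ← inc_whiskerRight_assoc, hw₁]
  simp

end IsStrongDeformationRetract

end Anodyne

end SSet

end

/-! ### Trivial cofibrations and fibrations between Kan complexes -/

section

open MonoidalCategory CartesianMonoidalCategory HomotopicalAlgebra Simplicial
open SSet.modelCategoryQuillen

namespace SSet

section

variable {A B Z P Q K : SSet.{u}}

/-- The swap of the last two factors. -/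
noncomputable def swapRight (X Y Z : SSet.{u}) : (X ⊗ Y) ⊗ Z ⟶ (X ⊗ Z) ⊗ Y :=
  lift (fst _ _ ▷ Z) (fst _ _ ≫ snd _ _)

lemma swapRight_swapRight (X Y Z : SSet.{u}) : swapRight X Y Z ≫ swapRight X Z Y = 𝟙 _ := rfl

/-- Two homotopies over the same homotopy that agree at one end can be composed to a vertical
homotopy between their other ends. -/
theorem exists_vertical_homotopy {p : P ⟶ Q} [Fibration p] (e e' : Fin 2)
    (h : Fin 2 → (Z ⊗ Δ[1] ⟶ P)) (v : Z ⊗ Δ[1] ⟶ Q) (z : Z ⟶ P) (hv : ∀ t, h t ≫ p = v)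
    (hz : ∀ t, inc e ≫ h t = z) :
    ∃ k : Z ⊗ Δ[1] ⟶ P, (∀ t, inc t ≫ k = inc e' ≫ h t) ∧ k ≫ p = fst _ _ ≫ inc e' ≫ v := by
  -- The homotopies `h 0`, `h 1` and the constant homotopy at `z` are three sides of a square; the
  -- fourth side of a filler is `k`.
  obtain ⟨w, hw₁, hw₂, hw₃⟩ := exists_homotopy_lift (p := p)
    (i := Z ◁ (∂Δ[1] : (Δ[1] : SSet.{u}).Subcomplex).ι) e
    (swapRight _ _ _ ≫ boundaryDesc h) (fst _ _ ≫ z) (fst _ _ ▷ _ ≫ v)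
    (boundary_hom_ext fun t => by exact (hz t).symm) (by
      have : IsSplitEpi (swapRight Z Δ[1] (∂Δ[1] : SSet.{u})) := ⟨⟨_, swapRight_swapRight _ _ _⟩⟩
      rw [← cancel_epi (swapRight Z Δ[1] (∂Δ[1] : SSet.{u}))]
      exact boundary_hom_ext fun t => hv t) (by
      rw [Category.assoc, ← hz 0, Category.assoc, hv 0]
      rfl)
  refine ⟨inc e' ≫ w, fun t => ?_, ?_⟩
  · have : inc t ≫ inc e' ≫ w = boundaryInc t ≫ inc e' ≫
        (Z ◁ (∂Δ[1] : (Δ[1] : SSet.{u}).Subcomplex).ι) ▷ Δ[1] ≫ w := rfl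
    rw [this, hw₁]
    rfl
  · rw [Category.assoc, hw₃]
    rfl

/-- The homotopy relation on maps of simplicial sets (in one step). -/
def Homotopic (f g : A ⟶ K) : Prop :=
  ∃ h : A ⊗ Δ[1] ⟶ K, inc 0 ≫ h = f ∧ inc 1 ≫ h = g

lemma Homotopic.refl (f : A ⟶ K) : Homotopic f f := ⟨fst _ _ ≫ f, rfl, rfl⟩

lemma Homotopic.trans' [KanComplex K] {f g g' : A ⟶ K} (h : Homotopic f g)
    (h' : Homotopic f g') : Homotopic g g' := by
  obtain ⟨h, h₀, h₁⟩ := h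
  obtain ⟨h', h₀', h₁'⟩ := h'
  obtain ⟨k, hk, -⟩ := exists_vertical_homotopy (p := terminal.from K) 0 1 ![h, h']
    (terminal.from _) f (fun t => by subsingleton) (fun t => by fin_cases t <;> simpa)
  exact ⟨k, (hk 0).trans h₁, (hk 1).trans h₁'⟩

lemma Homotopic.symm [KanComplex K] {f g : A ⟶ K} (h : Homotopic f g) : Homotopic g f :=
  h.trans' (.refl f)

lemma Homotopic.trans [KanComplex K] {f g g' : A ⟶ K} (h : Homotopic f g)
    (h' : Homotopic g g') : Homotopic f g' :=
  h.symm.trans' h'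

/-- Maps from `A` to `K`, as the vertices of the mapping space. -/
noncomputable def ihomVertex (A K : SSet.{u}) : (A ⟶ K) ≃ ((ihom A).obj K) _⦋0⦌ where
  toFun f := yonedaEquiv (MonoidalClosed.curry (fst A Δ[0] ≫ f))
  invFun x := lift (𝟙 A) (stdSimplex.isTerminalObj₀.from A) ≫
    MonoidalClosed.uncurry (yonedaEquiv.symm x)
  left_inv f := by
    dsimp only
    rw [Equiv.symm_apply_apply, MonoidalClosed.uncurry_curry]
    rfl
  right_inv x := by
    apply yonedaEquiv.symm.injective
    dsimp only
    rw [Equiv.symm_apply_apply]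
    apply MonoidalClosed.uncurry_injective
    rw [MonoidalClosed.uncurry_curry, ← Category.assoc]
    convert Category.id_comp _
    ext : 1
    · rfl
    · exact stdSimplex.isTerminalObj₀.hom_ext _ _

lemma pre_app_ihomVertex (f : A ⟶ B) (b : B ⟶ K) :
    ((MonoidalClosed.pre f).app K).app _ (ihomVertex B K b) = ihomVertex A K (f ≫ b) := by
  dsimp [ihomVertex]
  rw [← yonedaEquiv_comp, MonoidalClosed.curry_pre_app]
  rfl

lemma homotopic_of_edge {f g : A ⟶ K} (e : Edge (ihomVertex A K f) (ihomVertex A K g)) :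
    Homotopic f g := by
  have key : ∀ (t : Fin 2) (f : A ⟶ K), ((ihom A).obj K).δ (1 - t) e.edge = ihomVertex A K f →
      inc t ≫ MonoidalClosed.uncurry (yonedaEquiv.symm e.edge) = f := by
    intro t f h
    have h' : stdSimplex.δ (1 - t) ≫ yonedaEquiv.symm e.edge =
        MonoidalClosed.curry (fst A Δ[0] ≫ f) := by
      rw [stdSimplex.δ_comp_yonedaEquiv_symm, h]
      exact (Equiv.symm_apply_eq _).2 rfl
    rw [MonoidalClosed.eq_curry_iff, MonoidalClosed.uncurry_natural_left,
      ← const_obj₀Equiv_symm_eq_δ] at h'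
    exact lift (𝟙 A) (stdSimplex.isTerminalObj₀.from A) ≫= h'
  exact ⟨_, key 0 f e.src_eq, key 1 g e.tgt_eq⟩

/-- `π₀` is a quotient by a generated equivalence relation; for Kan `K` one-step homotopy already is
an equivalence relation. -/
lemma homotopic_of_mapπ₀_eq [KanComplex K] {f g : A ⟶ K}
    (h : π₀.mk (ihomVertex A K f) = π₀.mk (ihomVertex A K g)) : Homotopic f g := by
  rw [π₀.mk_eq_mk_iff] at h
  have key : ∀ x y, Relation.EqvGen (π₀Rel (X := (ihom A).obj K)) x y →
      Homotopic ((ihomVertex A K).symm x) ((ihomVertex A K).symm y) := by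
    intro x y hxy
    induction hxy with
    | rel x y hxy =>
      obtain ⟨e⟩ := hxy
      obtain ⟨x, rfl⟩ := (ihomVertex A K).surjective x
      obtain ⟨y, rfl⟩ := (ihomVertex A K).surjective y
      simpa using homotopic_of_edge e
    | refl x => exact .refl _
    | symm x y _ h => exact h.symm
    | trans x y z _ _ h h' => exact h.trans h'
  simpa using key _ _ h

section WeakEquivalence

variable {f : A ⟶ B} (hf : IsWeakHomotopyEquiv f)

include hf

lemma _root_.IsWeakHomotopyEquiv.homotopic [KanComplex K] {b b' : B ⟶ K}
    (h : f ≫ b = f ≫ b') : Homotopic b b' := by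
  refine homotopic_of_mapπ₀_eq ((hf K inferInstance).1 ?_)
  rw [mapπ₀_mk, mapπ₀_mk, pre_app_ihomVertex, pre_app_ihomVertex, h]

/-- Surjectivity on `π₀` extends `a` up to homotopy, and homotopy extension along `f` corrects the
result. -/
lemma _root_.IsWeakHomotopyEquiv.exists_extension [Mono f] [KanComplex K] (a : A ⟶ K) :
    ∃ b : B ⟶ K, f ≫ b = a := by
  obtain ⟨x, hx⟩ := (hf K inferInstance).2 (π₀.mk (ihomVertex A K a))
  obtain ⟨x, rfl⟩ := π₀.mk_surjective x
  obtain ⟨b, rfl⟩ := (ihomVertex B K).surjective x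
  rw [mapπ₀_mk, pre_app_ihomVertex] at hx
  obtain ⟨h, h₀, h₁⟩ := homotopic_of_mapπ₀_eq hx
  obtain ⟨w, hw₁, hw₂, -⟩ := exists_homotopy_lift (i := f) (p := terminal.from K) 0 h b
    (terminal.from _) h₀.symm (by subsingleton) (by subsingleton)
  exact ⟨inc 1 ≫ w, by rw [← inc_whiskerRight_assoc, hw₁, h₁]⟩

end WeakEquivalence

/-- The swap of the two variables of a map to a mapping space. -/
noncomputable def ihomSwap (A Z K : SSet.{u}) :
    (A ⟶ (ihom Z).obj K) ≃ (Z ⟶ (ihom A).obj K) where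
  toFun a := MonoidalClosed.curry ((β_ _ _).hom ≫ MonoidalClosed.uncurry a)
  invFun a := MonoidalClosed.curry ((β_ _ _).hom ≫ MonoidalClosed.uncurry a)
  left_inv a := by simp
  right_inv a := by simp

lemma ihomSwap_pre (f : A ⟶ B) (b : B ⟶ (ihom Z).obj K) :
    ihomSwap A Z K (f ≫ b) = ihomSwap B Z K b ≫ (MonoidalClosed.pre f).app K := by
  dsimp [ihomSwap]
  rw [MonoidalClosed.curry_pre_app, MonoidalClosed.uncurry_natural_left]
  simp

lemma exists_homotopy_of_homotopic_ihomSwap {b b' : B ⟶ (ihom Z).obj K} (h : Homotopic b b') :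
    Homotopic (ihomSwap B Z K b) (ihomSwap B Z K b') := by
  obtain ⟨h, rfl, rfl⟩ := h
  exact ⟨MonoidalClosed.curry (lift (snd _ _ ≫ fst _ _) (lift (fst _ _) (snd _ _ ≫ snd _ _)) ≫
    MonoidalClosed.uncurry h), by
      rw [← MonoidalClosed.curry_natural_left]
      dsimp [ihomSwap]
      rw [MonoidalClosed.uncurry_natural_left]
      rfl, by
      rw [← MonoidalClosed.curry_natural_left]
      dsimp [ihomSwap]
      rw [MonoidalClosed.uncurry_natural_left]
      rfl⟩

/-- Trivial cofibrations have the left lifting property with respect to the fibrations between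
Kan complexes. -/
theorem _root_.IsTrivialCofibration.exists_lift {f : A ⟶ B} (hf : IsTrivialCofibration f)
    {p : P ⟶ Q} [Fibration p] [KanComplex P] [KanComplex Q] (a : A ⟶ P) (b : B ⟶ Q)
    (h : a ≫ p = f ≫ b) : ∃ l : B ⟶ P, f ≫ l = a ∧ l ≫ p = b := by
  obtain ⟨_, hf⟩ := hf
  -- `Φ` is the restriction fibration Q^B → Q^A. Extending the transpose of the identity of Q^A
  -- along `f` gives a section `s` of `Φ`; uniqueness of extensions up to homotopy gives a homotopy
  -- `H` from the identity of Q^B to `Φ ≫ s`.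
  let Φ := (MonoidalClosed.pre f).app Q
  obtain ⟨s', hs'⟩ := hf.exists_extension ((ihomSwap _ _ _).symm (𝟙 ((ihom A).obj Q)))
  let s := ihomSwap _ _ _ s'
  have hs : s ≫ Φ = 𝟙 _ := by
    rw [← ihomSwap_pre, hs', Equiv.apply_symm_apply]
  obtain ⟨H, H₀, H₁⟩ : Homotopic (𝟙 ((ihom B).obj Q)) (Φ ≫ s) := by
    have := exists_homotopy_of_homotopic_ihomSwap (hf.homotopic
      (b := (ihomSwap _ _ _).symm (𝟙 ((ihom B).obj Q))) (b' := (ihomSwap _ _ _).symm (Φ ≫ s)) (by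
        apply (ihomSwap _ _ _).injective
        rw [ihomSwap_pre, ihomSwap_pre, Equiv.apply_symm_apply, Equiv.apply_symm_apply]
        change 𝟙 _ ≫ Φ = (Φ ≫ s) ≫ Φ
        rw [Category.assoc, hs, Category.comp_id, Category.id_comp]))
    rwa [Equiv.apply_symm_apply, Equiv.apply_symm_apply] at this
  -- `H` need not be vertical. But `H` and `H ≫ Φ ≫ s` lie over the same homotopy and agree at the
  -- end `1`, so together they give a homotopy `k` from the identity to `Φ ≫ s` over Q^A.
  obtain ⟨k, hk, hk'⟩ := exists_vertical_homotopy (p := Φ) 1 0 ![H, H ≫ Φ ≫ s] (H ≫ Φ) (Φ ≫ s)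
    (by intro t; fin_cases t <;> simp [hs]) (by
      intro t
      fin_cases t
      · exact H₁
      · change inc 1 ≫ H ≫ Φ ≫ s = _
        rw [reassoc_of% H₁, reassoc_of% hs])
  have hk₀ : inc 0 ≫ k = 𝟙 _ := (hk 0).trans H₀
  have hk₁ : inc 1 ≫ k = Φ ≫ s := (hk 1).trans (by
    change inc 0 ≫ H ≫ Φ ≫ s = _
    rw [reassoc_of% H₀])
  rw [reassoc_of% H₀] at hk'
  -- `u` extends `a`, but `u ≫ p` may differ from `b`. Both are vertices of the fibre of `Φ` over `a
  -- ≫ p`, which `k` contracts, so they are joined by a path `w` in it. This path is a homotopy `W`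
  -- constant on `A`; lifting it from `u` leads to the required lift.
  obtain ⟨u, hu⟩ := hf.exists_extension a
  let α : Δ[0] ⟶ (ihom A).obj Q := MonoidalClosed.curry (fst A Δ[0] ≫ a ≫ p)
  let z : Fin 2 → (Δ[0] ⟶ (ihom B).obj Q) := ![MonoidalClosed.curry (fst B Δ[0] ≫ u ≫ p),
    MonoidalClosed.curry (fst B Δ[0] ≫ b)]
  have hz : ∀ t, z t ≫ Φ = α := by
    intro t
    fin_cases t
    · change MonoidalClosed.curry _ ≫ _ = _
      rw [MonoidalClosed.curry_pre_app, whiskerRight_fst_assoc, reassoc_of% hu]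
    · change MonoidalClosed.curry _ ≫ _ = _
      rw [MonoidalClosed.curry_pre_app, whiskerRight_fst_assoc, ← h]
  obtain ⟨w, hw, hw'⟩ := exists_vertical_homotopy (p := Φ) 1 0
    (fun t => z t ▷ _ ≫ k) (fst _ _ ≫ α) (α ≫ s) (by
      intro t
      rw [Category.assoc, hk', whiskerRight_fst_assoc, hz]) (by
      intro t
      rw [inc_whiskerRight_assoc, hk₁, reassoc_of% hz])
  simp only [inc_whiskerRight_assoc, hk₀, Category.comp_id] at hw
  rw [inc_fst_assoc] at hw'
  let pt (Z : SSet.{u}) : Z ⟶ Δ[0] := stdSimplex.isTerminalObj₀.from Z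
  let W : B ⊗ Δ[1] ⟶ Q := lift (fst _ _) (lift (snd _ _ ≫ pt _) (snd _ _)) ≫
    MonoidalClosed.uncurry w
  have hW : ∀ t, inc t ≫ W = lift (𝟙 B) (pt B) ≫ MonoidalClosed.uncurry (z t) := by
    intro t
    rw [← hw, MonoidalClosed.uncurry_natural_left]
    rfl
  have hW' : f ▷ _ ≫ W = fst _ _ ≫ a ≫ p := by
    have : f ▷ _ ≫ MonoidalClosed.uncurry w = A ◁ fst _ _ ≫ fst _ _ ≫ a ≫ p := by
      apply MonoidalClosed.curry_injective
      rw [← MonoidalClosed.curry_pre_app, MonoidalClosed.curry_uncurry,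
        MonoidalClosed.curry_natural_left]
      exact hw'
    exact lift (fst _ _) (lift (snd _ _ ≫ pt _) (snd _ _)) ≫= this
  obtain ⟨l, hl₁, hl₂, hl₃⟩ := exists_homotopy_lift (i := f) (p := p) 0 (fst _ _ ≫ a) u W
    (by simp [hu]) (by simp [hW']) (by
      rw [hW]
      simp [z, MonoidalClosed.uncurry_curry])
  refine ⟨inc 1 ≫ l, ?_, ?_⟩
  · rw [← inc_whiskerRight_assoc, hl₁]
    simp
  · rw [Category.assoc, hl₃, hW]
    simp [z, MonoidalClosed.uncurry_curry]

end

end SSet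

end

/-! ### Extension of fibrations along an inclusion of subcomplexes -/

section

open MonoidalCategory CartesianMonoidalCategory HomotopicalAlgebra Simplicial
open SSet.modelCategoryQuillen

namespace SSet

section

variable {P Q X Y Z : SSet.{u}}

lemma exists_factorization (f : X ⟶ Y) : ∃ (Z : SSet.{u}) (i : X ⟶ Z) (p : Z ⟶ Y),
    anodyneExtensions i ∧ Fibration p ∧ i ≫ p = f := by
  let d := MorphismProperty.factorizationData J.{u}.rlp.llp J.{u}.rlp f
  exact ⟨d.Z, d.i, d.p, d.hi, (modelCategoryQuillen.fibration_iff _).2 d.hp, d.fac⟩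

lemma Subcomplex.isPullback_preimage (A : Y.Subcomplex) (p : X ⟶ Y) :
    IsPullback (A.preimage p).ι (A.fromPreimage p) p A.ι :=
  ⟨⟨rfl⟩, ⟨PullbackCone.IsLimit.mk _
    (fun s => Subcomplex.lift s.fst (by
      rintro n _ ⟨x, rfl⟩
      have : p.app n (s.fst.app n x) = (s.snd.app n x).1 :=
        ConcreteCategory.congr_hom (congr_app s.condition n) x
      change p.app n (s.fst.app n x) ∈ A.obj n
      rw [this]
      exact (s.snd.app n x).2))
    (fun s => rfl)
    (fun s => by
      rw [← cancel_mono A.ι]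
      exact s.condition)
    (fun s m hm _ => by
      rw [← cancel_mono (A.preimage p).ι]
      exact hm)⟩⟩

/-- The functor `- ⊗ Z` is a left adjoint, so the gluing is done for the transposed maps, on the
pushout square of `S ⊓ T`, `S`, `T`, `S ⊔ T`. -/
lemma Subcomplex.exists_glue_tensor {S T : Y.Subcomplex} (f : (S : SSet.{u}) ⊗ Z ⟶ P)
    (g : (T : SSet.{u}) ⊗ Z ⟶ P)
    (h : homOfLE (inf_le_left : S ⊓ T ≤ S) ▷ Z ≫ f = homOfLE (inf_le_right : S ⊓ T ≤ T) ▷ Z ≫ g) :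
    ∃ k : ((S ⊔ T : Y.Subcomplex) : SSet.{u}) ⊗ Z ⟶ P,
      homOfLE (le_sup_left : S ≤ S ⊔ T) ▷ Z ≫ k = f ∧
      homOfLE (le_sup_right : T ≤ S ⊔ T) ▷ Z ≫ k = g := by
  have sq : Subcomplex.BicartSq (S ⊓ T) S T (S ⊔ T) := ⟨rfl, rfl⟩
  have key {W W' : SSet.{u}} (a : W ⟶ W') (b : W' ⊗ Z ⟶ P) :
      MonoidalClosed.curry ((β_ Z W).hom ≫ a ▷ Z ≫ b) =
        a ≫ MonoidalClosed.curry ((β_ Z W').hom ≫ b) := by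
    rw [← MonoidalClosed.curry_natural_left]
    rfl
  have w : homOfLE inf_le_left ≫ MonoidalClosed.curry ((β_ Z _).hom ≫ f) =
      homOfLE inf_le_right ≫ MonoidalClosed.curry ((β_ Z _).hom ≫ g) := by
    rw [← key, ← key, h]
  refine ⟨(β_ _ _).hom ≫ MonoidalClosed.uncurry (sq.isPushout.desc _ _ w), ?_, ?_⟩
  · have := MonoidalClosed.uncurry_natural_left (homOfLE sq.le₂₄) (sq.isPushout.desc _ _ w)
    rw [sq.isPushout.inl_desc, MonoidalClosed.uncurry_curry] at this
    have := (β_ _ _).inv ≫= this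
    rw [Iso.inv_hom_id_assoc] at this
    exact this.symm
  · have := MonoidalClosed.uncurry_natural_left (homOfLE sq.le₃₄) (sq.isPushout.desc _ _ w)
    rw [sq.isPushout.inr_desc, MonoidalClosed.uncurry_curry] at this
    have := (β_ _ _).inv ≫= this
    rw [Iso.inv_hom_id_assoc] at this
    exact this.symm

/-- Morphisms whose base changes along fibrations are anodyne extensions. -/
def stablyAnodyne : MorphismProperty SSet.{u} := fun X Y i =>
  ∀ ⦃X' Y' : SSet.{u}⦄ (i' : X' ⟶ Y') (q : X' ⟶ X) (p : Y' ⟶ Y) [Fibration p],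
    IsPullback i' q p i → anodyneExtensions i'

lemma IsStrongDeformationRetract.stablyAnodyne {i : X ⟶ Y} (hi : IsStrongDeformationRetract i) :
    stablyAnodyne i := fun _ _ _ _ _ _ sq => (hi.of_isPullback sq).anodyneExtensions

lemma fibration_of_isPullback {X' Y' : SSet.{u}} {f' : X' ⟶ Y'} {g' : X' ⟶ X} {f : X ⟶ Y}
    {g : Y' ⟶ Y} (sq : IsPullback g' f' f g) [Fibration f] : Fibration f' := by
  rw [modelCategoryQuillen.fibration_iff]
  exact MorphismProperty.of_isPullback sq ((modelCategoryQuillen.fibration_iff f).1 inferInstance)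

lemma stablyAnodyne.comp {i : X ⟶ Y} {j : Y ⟶ Z} (hi : stablyAnodyne i) (hj : stablyAnodyne j) :
    stablyAnodyne (i ≫ j) := by
  intro X' Z' k q p _ sq
  have sq' := IsPullback.of_hasPullback p j
  have : Fibration (pullback.snd p j) := fibration_of_isPullback sq'
  have h₁ : sq'.lift k (q ≫ i) (by simpa using sq.w) ≫ pullback.fst p j = k := sq'.lift_fst _ _ _
  have h₂ : sq'.lift k (q ≫ i) (by simpa using sq.w) ≫ pullback.snd p j = q ≫ i :=
    sq'.lift_snd _ _ _
  rw [← h₁]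
  refine MorphismProperty.comp_mem _ _ _ (hi _ q (pullback.snd p j) ?_) (hj _ _ _ sq')
  exact IsPullback.of_right (by rw [h₁]; exact sq) h₂ sq'

variable {B : SSet.{u}}

/-- The largest subcomplex of `G` that meets `S` only in `R`. -/
def relativeComplement (S R : Y.Subcomplex) : Y.Subcomplex where
  obj n := {x | ∀ ⦃m : SimplexCategoryᵒᵖ⦄ (θ : n ⟶ m), Y.map θ x ∈ S.obj m → Y.map θ x ∈ R.obj m}
  map {n m} φ x hx k θ h := by
    rw [← Functor.map_comp_apply] at h ⊢
    exact hx (φ ≫ θ) h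

/-- If the restriction `E` of a fibration `G` over `B` to a subcomplex `A` is a vertical strong
deformation retract, then `E` extends to a fibration over `B`. -/
theorem exists_isPullback_of_vertical_retract {A : B.Subcomplex} {E G : SSet.{u}} {p : E ⟶ A}
    {q : G ⟶ B} [Fibration q] {j : E ⟶ G} [Mono j] (hj : j ≫ q = p ≫ A.ι)
    (l : E ⟶ A.preimage q) (hl : l ≫ (A.preimage q).ι = j)
    (r : (A.preimage q : SSet.{u}) ⟶ E)
    (H : (A.preimage q : SSet.{u}) ⊗ Δ[1] ⟶ A.preimage q)
    (H₀ : inc 0 ≫ H = 𝟙 _) (H₁ : inc 1 ≫ H = r ≫ l) (hE : l ▷ _ ≫ H = fst _ _ ≫ l)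
    (hA : H ≫ A.fromPreimage q = fst _ _ ≫ A.fromPreimage q) :
    ∃ (E' : SSet.{u}) (j' : E ⟶ E') (p' : E' ⟶ B), Fibration p' ∧ IsPullback j' p p' A.ι := by
  subst hl
  let S := A.preimage q
  let T := relativeComplement S (Subcomplex.range (l ≫ S.ι))
  have hR {n} (y : E.obj n) : S.ι.app n (l.app n y) ∈ T.obj n := fun m θ _ => by
    refine ⟨E.map θ y, ?_⟩
    exact NatTrans.naturality_apply (l ≫ S.ι) θ y
  -- `T` will be the total space of the extension, since it meets `S` exactly in `E`. The homotopy
  -- is `H` on `S` and constant on `T`; these agree on the intersection because `H` is relative to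
  -- `E`. It extends to `G` over `B`, and the other end `R` will be a retraction of `G` onto `T`
  -- over `B`.
  obtain ⟨u, hu₁, hu₂⟩ := Subcomplex.exists_glue_tensor (S := S) (T := T) (H ≫ S.ι)
    (fst _ _ ≫ T.ι) (by
      ext n ⟨⟨x, hx₁, hx₂⟩, t⟩
      have hx₃ := hx₂ (𝟙 _)
      rw [Functor.map_id_apply] at hx₃
      obtain ⟨y, rfl⟩ := hx₃ hx₁
      have h₁ := ConcreteCategory.congr_hom (congr_app hE n) (show (E ⊗ Δ[1]).obj n from (y, t))
      exact congr_arg (S.ι.app n) h₁)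
  obtain ⟨L, hL₁, hL₂, hL₃⟩ := exists_homotopy_lift (i := (S ⊔ T).ι) (p := q) 0 u (𝟙 G)
    (fst _ _ ≫ q) (by
      refine (show Subcomplex.BicartSq (S ⊓ T) S T (S ⊔ T) from ⟨rfl, rfl⟩).isPushout.hom_ext ?_ ?_
      · rw [← inc_whiskerRight_assoc, hu₁, reassoc_of% H₀]
        rfl
      · rw [← inc_whiskerRight_assoc, hu₂, inc_fst_assoc]
        rfl) (by
      ext n ⟨⟨x, hx⟩, t⟩
      obtain hx | hx := hx
      · have h₁ := ConcreteCategory.congr_hom (congr_app hu₁ n)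
          (show ((S : SSet.{u}) ⊗ Δ[1]).obj n from (⟨x, hx⟩, t))
        refine (congr_arg (q.app n) h₁).trans ?_
        exact congr_arg Subtype.val (ConcreteCategory.congr_hom (congr_app hA n)
          (show ((S : SSet.{u}) ⊗ Δ[1]).obj n from (⟨x, hx⟩, t)))
      · have h₁ := ConcreteCategory.congr_hom (congr_app hu₂ n)
          (show ((T : SSet.{u}) ⊗ Δ[1]).obj n from (⟨x, hx⟩, t))
        exact congr_arg (q.app n) h₁) (by simp)
  have hLT : T.ι ▷ _ ≫ L = fst _ _ ≫ T.ι := by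
    rw [← hu₂, ← hL₁, ← MonoidalCategory.comp_whiskerRight_assoc]
    rfl
  have hLS : S.ι ▷ _ ≫ L = H ≫ S.ι := by
    rw [← hu₁, ← hL₁, ← MonoidalCategory.comp_whiskerRight_assoc]
    rfl
  let R := inc 1 ≫ L
  have hRT : T.ι ≫ R = T.ι := by
    have := inc 1 ≫= hLT
    rw [inc_whiskerRight_assoc] at this
    simpa [R] using this
  have hRS : S.ι ≫ R = r ≫ l ≫ S.ι := by
    have := inc 1 ≫= hLS
    rw [inc_whiskerRight_assoc, reassoc_of% H₁] at this
    simpa [R] using this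
  have hRq : R ≫ q = q := by
    simp [R, hL₃]
  -- As `R` lies over `B`, if a simplex obtained from `R x` lies over `A`, it is `R` of the
  -- corresponding simplex obtained from `x`, which also lies over `A`; hence it belongs to `E`.
  have hRT' : Subcomplex.range R ≤ T := by
    rintro n _ ⟨x, rfl⟩ m θ hθ
    have e : G.map θ (R.app n x) = R.app m (G.map θ x) := (NatTrans.naturality_apply R θ x).symm
    rw [e] at hθ ⊢
    have hS : G.map θ x ∈ S.obj m := by
      change q.app m _ ∈ A.obj m
      rw [← hRq]
      exact hθ
    exact ⟨r.app m ⟨_, hS⟩, (ConcreteCategory.congr_hom (congr_app hRS m) ⟨_, hS⟩).symm⟩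
  let R' : G ⟶ T := Subcomplex.lift R hRT'
  have hR' : R' ≫ T.ι = R := rfl
  have hR'' : T.ι ≫ R' = 𝟙 _ := by
    rw [← cancel_mono T.ι, Category.assoc, hR', hRT, Category.id_comp]
  let j' : E ⟶ T := Subcomplex.lift (l ≫ S.ι) (by rintro n _ ⟨y, rfl⟩; exact hR y)
  refine ⟨T, j', T.ι ≫ q, ?_, ?_⟩
  · rw [modelCategoryQuillen.fibration_iff]
    refine MorphismProperty.of_retract (f := T.ι ≫ q) (g := q) ?_
      ((modelCategoryQuillen.fibration_iff q).1 inferInstance)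
    exact
      { i := Arrow.homMk T.ι (𝟙 B) (by simp)
        r := Arrow.homMk R' (𝟙 B) (by simp [reassoc_of% hR', hRq])
        retract := by
          ext1
          · exact hR''
          · simp }
  · have hj' : j' ≫ T.ι = l ≫ S.ι := rfl
    have hlr : l ≫ r ≫ l = l := by
      have := inc 1 ≫= hE
      rw [inc_whiskerRight_assoc, H₁] at this
      simpa using this
    have : Mono j' := mono_of_mono_fac hj'
    have hw : j' ≫ T.ι ≫ q = p ≫ A.ι := by rw [reassoc_of% hj', ← hj, Category.assoc]
    have key {W : SSet.{u}} (a : W ⟶ T) (b : W ⟶ A) (w : a ≫ T.ι ≫ q = b ≫ A.ι) :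
        ∃ c, c ≫ j' = a := by
      have sq := A.isPullback_preimage q
      let a' := sq.lift (a ≫ T.ι) b (by simpa using w)
      have ha' : a' ≫ S.ι = a ≫ T.ι := sq.lift_fst _ _ _
      refine ⟨a' ≫ r, ?_⟩
      rw [← cancel_mono T.ι, Category.assoc, Category.assoc, hj', ← ha']
      ext n x
      have hx := (a.app n x).2 (𝟙 _)
      rw [Functor.map_id_apply] at hx
      have hx' : S.ι.app n (a'.app n x) = (a.app n x).1 :=
        ConcreteCategory.congr_hom (congr_app ha' n) x
      obtain ⟨y, hy⟩ := hx (by rw [← hx']; exact (a'.app n x).2)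
      rw [← hx'] at hy
      have hy' : a'.app n x = l.app n y := Subtype.ext hy.symm
      change S.ι.app n (l.app n (r.app n (a'.app n x))) = S.ι.app n (a'.app n x)
      rw [hy']
      exact congr_arg (S.ι.app n) (ConcreteCategory.congr_hom (congr_app hlr n) y)
    refine ⟨⟨hw⟩, ⟨PullbackCone.IsLimit.mk _ (fun s => (key _ _ s.condition).choose)
      (fun s => (key _ _ s.condition).choose_spec) (fun s => ?_) (fun s m hm _ => ?_)⟩⟩
    · rw [← cancel_mono A.ι, Category.assoc, ← hw,
        reassoc_of% (key _ _ s.condition).choose_spec, s.condition]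
    · rw [← cancel_mono j', hm, (key _ _ s.condition).choose_spec]

/-- It is enough that the inclusion `l` of `E` in the restriction `S` of `G` to `A` is anodyne:
lifting against fibrations over `A` then makes it a vertical strong deformation retract. This is
tested over `V` (later a vertex), because restricting total spaces to `V` gives anodyne inclusions
and the restrictions are Kan. -/
theorem exists_isPullback_fibration (A : B.Subcomplex) {V : SSet.{u}} [KanComplex V]
    (v : V ⟶ A) (hv : stablyAnodyne v) (hv' : stablyAnodyne (v ≫ A.ι)) {E : SSet.{u}} (p : E ⟶ A)
    [Fibration p] :
    ∃ (E' : SSet.{u}) (j' : E ⟶ E') (p' : E' ⟶ B), Fibration p' ∧ IsPullback j' p p' A.ι := by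
  obtain ⟨G, j, q, hj, _, fac⟩ := exists_factorization (p ≫ A.ι)
  have := hj.mono
  let S := A.preimage q
  have sqS := A.isPullback_preimage q
  have : Fibration (A.fromPreimage q) := fibration_of_isPullback sqS
  let l : E ⟶ S := sqS.lift j p fac
  have hl : l ≫ S.ι = j := sqS.lift_fst _ _ _
  have hl' : l ≫ A.fromPreimage q = p := sqS.lift_snd _ _ _
  have : Mono l := mono_of_mono_fac hl
  have sqE := IsPullback.of_hasPullback p v
  have : Fibration (pullback.snd p v) := fibration_of_isPullback sqE
  have : KanComplex (pullback p v) := isFibrant_of_fibration (pullback.snd p v)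
  have sqG := IsPullback.of_hasPullback q (v ≫ A.ι)
  have : Fibration (pullback.snd q (v ≫ A.ι)) := fibration_of_isPullback sqG
  have : KanComplex (pullback q (v ≫ A.ι)) := isFibrant_of_fibration (pullback.snd q (v ≫ A.ι))
  let γ := pullback.fst q (v ≫ A.ι)
  have hγ : anodyneExtensions γ := hv' _ _ _ sqG
  let γS : pullback q (v ≫ A.ι) ⟶ S := sqS.lift γ (pullback.snd _ _ ≫ v) (by
    simp [γ, pullback.condition])
  have hγS : γS ≫ S.ι = γ := sqS.lift_fst _ _ _
  have hγS' : anodyneExtensions γS := hv _ (pullback.snd _ _) (A.fromPreimage q)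
    (IsPullback.of_right (by rw [hγS]; exact sqG.flip.flip) (sqS.lift_snd _ _ _) sqS)
  let s : pullback p v ⟶ pullback q (v ≫ A.ι) :=
    pullback.lift (pullback.fst _ _ ≫ j) (pullback.snd _ _) (by
      simp [fac, pullback.condition_assoc])
  have hs : s ≫ γ = pullback.fst p v ≫ j := pullback.lift_fst _ _ _
  have hE : anodyneExtensions (pullback.fst p v) := hv _ _ _ sqE
  have hsγ : anodyneExtensions (s ≫ γ) := by
    rw [hs]
    exact MorphismProperty.comp_mem _ _ _ hE hj
  -- The Kan property gives retractions `g` of `s ≫ γ` and `ρ` of `γ`. The maps `ρ` and `g ≫ s`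
  -- agree on the restriction of `E` to `V`, so they are homotopic relative to it; restricted along
  -- `γ`, the homotopy makes `s` a strong deformation retract.
  obtain ⟨g, hg⟩ := hsγ.exists_extension (𝟙 _)
  obtain ⟨ρ, hρ⟩ := hγ.exists_extension (𝟙 _)
  obtain ⟨K, hK₁, hK₂, -⟩ := hsγ.exists_homotopy_lift (p := terminal.from _) (fst _ _ ≫ s)
    ![ρ, g ≫ s] (terminal.from _) (by
      intro t
      fin_cases t
      · simp [hρ]
      · simpa using hg =≫ s) (by subsingleton) (by subsingleton)
  have hs' : IsStrongDeformationRetract s := by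
    refine ⟨0, 1, γ ≫ g, γ ▷ _ ≫ K, by simpa using hg, ?_, ?_, ?_⟩
    · rw [inc_whiskerRight_assoc, hK₂]
      exact hρ
    · rw [inc_whiskerRight_assoc, hK₂, Category.assoc]
      rfl
    · simpa using hK₁
  -- Preceded by the anodyne map `pullback.fst p v`, the map `l` becomes `s ≫ γS`, a composite of
  -- anodyne maps; left cancellation applies.
  have hl'' : anodyneExtensions l := by
    refine hE.of_precomp (g := l) ?_
    have : pullback.fst p v ≫ l = s ≫ γS := by
      rw [← cancel_mono S.ι, Category.assoc, Category.assoc, hl, hγS, hs]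
    rw [this]
    exact MorphismProperty.comp_mem _ _ _ hs'.anodyneExtensions hγS'
  obtain ⟨r, hr₁, hr₂⟩ := hl''.exists_lift (p := p) (𝟙 E) (A.fromPreimage q) (by simp [hl'])
  obtain ⟨H, hH₁, hH₂, hH₃⟩ := hl''.exists_homotopy_lift (p := A.fromPreimage q) (fst _ _ ≫ l)
    ![𝟙 _, r ≫ l] (fst _ _ ≫ A.fromPreimage q) (by
      intro t
      fin_cases t
      · simp
      · simpa using hr₁ =≫ l) (by simp) (by
      intro t
      fin_cases t
      · simp
      · simp [hl', hr₂])
  exact exists_isPullback_of_vertical_retract fac l hl r H (hH₂ 0) (hH₂ 1) hH₁ hH₃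

end

end SSet

end

/-! ### Finite compositions, and fibrations along finite horn-cell complexes -/

section

open MonoidalCategory CartesianMonoidalCategory HomotopicalAlgebra Simplicial
open SSet.modelCategoryQuillen

namespace CategoryTheory.MorphismProperty

variable {C : Type u} [Category.{v} C] {W W' : MorphismProperty C} {n : ℕ}

lemma map_castSucc_mem_of_fin {X Y : C} {f : X ⟶ Y}
    (h : W.TransfiniteCompositionOfShape (Fin (n + 1)) f) (i : Fin n) (hi : i.castSucc ≤ i.succ) :
    W (h.F.map (homOfLE hi)) := by
  have key (j : Fin (n + 1)) (hj : i.castSucc ≤ j) (e : j = Order.succ i.castSucc) :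
      W (h.F.map (homOfLE hj)) := by
    subst e
    exact h.map_mem i.castSucc (by simp [isMax_iff_eq_top, Fin.top_eq_last])
  exact key _ hi i.orderSucc_castSucc.symm

lemma map_bot_mem_of_fin [W.IsMultiplicative] {X Y : C} {f : X ⟶ Y}
    (h : W.TransfiniteCompositionOfShape (Fin (n + 1)) f) (i : Fin (n + 1)) :
    W (h.F.map (homOfLE (bot_le : ⊥ ≤ i))) := by
  induction i using Fin.induction with
  | zero => simpa using W.id_mem _
  | succ i hi =>
    have h₁ : i.castSucc ≤ i.succ := i.castSucc_le_succ
    have : h.F.map (homOfLE (bot_le : ⊥ ≤ i.succ)) =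
        h.F.map (homOfLE bot_le) ≫ h.F.map (homOfLE h₁) := by
      rw [← Functor.map_comp]
      rfl
    rw [this]
    exact W.comp_mem _ _ hi (map_castSucc_mem_of_fin h i _)

lemma isIso_incl_last {X Y : C} {f : X ⟶ Y}
    (h : W.TransfiniteCompositionOfShape (Fin (n + 1)) f) : IsIso (h.incl.app (Fin.last n)) :=
  IsColimit.isIso_ι_app_of_isTerminal h.isColimit _ (Fin.isTerminalLast n)

lemma transfiniteCompositionsOfShape_fin_le [W.IsMultiplicative]
    (hW : isomorphisms C ≤ W) : W.transfiniteCompositionsOfShape (Fin (n + 1)) ≤ W := by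
  rintro X Y f ⟨h⟩
  have := isIso_incl_last h
  have e : h.F.map (homOfLE (bot_le : ⊥ ≤ Fin.last n)) ≫ h.incl.app (Fin.last n) =
      h.incl.app ⊥ := (h.incl.naturality _).trans (Category.comp_id _)
  rw [← h.fac, ← e]
  exact W.comp_mem _ _ (hW _ (inferInstanceAs (IsIso h.isoBot.inv)))
    (W.comp_mem _ _ (map_bot_mem_of_fin h _) (hW _ this))

/-- Prepending one map is the inductive step for the closure of `finiteHornCell` under composition.
-/
lemma transfiniteCompositionsOfShape_fin_precomp [W.RespectsIso] {X Y Z : C} {g : X ⟶ Y}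
    {f : Y ⟶ Z} (hg : W g) (hf : W.transfiniteCompositionsOfShape (Fin (n + 1)) f) :
    W.transfiniteCompositionsOfShape (Fin (n + 2)) (g ≫ f) := by
  obtain ⟨h⟩ := hf
  have := isIso_incl_last h
  let F : ComposableArrows C n := h.F
  have hg' : W (g ≫ h.isoBot.inv) := RespectsIso.postcomp W _ _ hg
  have H := TransfiniteCompositionOfShape.ofComposableArrows W
    (ComposableArrows.precomp (F := F) (g ≫ h.isoBot.inv)) (fun i => by
      induction i using Fin.cases with
      | zero => exact hg'
      | succ i => exact map_castSucc_mem_of_fin h i i.castSucc_le_succ)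
  have e : h.F.map (homOfLE (bot_le : ⊥ ≤ Fin.last n)) ≫ h.incl.app (Fin.last n) =
      h.incl.app ⊥ := (h.incl.naturality _).trans (Category.comp_id _)
  have e' : (ComposableArrows.precomp (F := F) (g ≫ h.isoBot.inv)).hom =
      (g ≫ h.isoBot.inv) ≫ h.F.map (homOfLE (bot_le : ⊥ ≤ Fin.last n)) := by
    cases n with
    | zero => exact (Category.comp_id _).symm.trans (congr_arg _ (h.F.map_id _).symm)
    | succ n => rfl
  refine ⟨H.ofArrowIso (Arrow.isoMk' _ _ (Iso.refl X)
    (@asIso _ _ _ _ _ this) ?_)⟩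
  change 𝟙 X ≫ g ≫ f = (ComposableArrows.precomp (F := F) (g ≫ h.isoBot.inv)).hom ≫ _
  rw [e', Category.id_comp]
  have e'' : f = h.isoBot.inv ≫ h.F.map (homOfLE (bot_le : ⊥ ≤ Fin.last n)) ≫
      h.incl.app (Fin.last n) := h.fac.symm.trans (congr_arg _ e.symm)
  refine (congr_arg (g ≫ ·) e'').trans ?_
  simp only [← Category.assoc]
  rfl

end CategoryTheory.MorphismProperty

namespace SSet

section

/-- The map `Δ[n] ⊗ Δ[m] ⟶ Δ[k]` induced by a monotone map. -/
def stdSimplex.tensorDesc {n m k : ℕ} (φ : Fin (n + 1) × Fin (m + 1) →o Fin (k + 1)) :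
    (Δ[n] ⊗ Δ[m] : SSet.{u}) ⟶ Δ[k] where
  app _ := ↾fun z => stdSimplex.objMk
    (φ.comp ((stdSimplex.asOrderHom z.1).prod (stdSimplex.asOrderHom z.2)))
  naturality _ _ _ := rfl

/-- Strong deformation retractions between subcomplexes of a simplex, given by monotone maps. -/
lemma isStrongDeformationRetract_homOfLE {n : ℕ} {Z Y : (Δ[n] : SSet.{u}).Subcomplex} (h : Z ≤ Y)
    (φ : Fin (n + 1) × Fin 2 →o Fin (n + 1)) (e e' : Fin 2) (he : ∀ d (x : Δ[n] _⦋d⦌),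
      x ∈ Y.obj _ → ∀ i, φ (x i, e) = x i)
    (hZ : ∀ d (x : Δ[n] _⦋d⦌), x ∈ Z.obj _ → ∀ i t, φ (x i, t) = x i)
    (hY : ∀ d (x y : Δ[n] _⦋d⦌), x ∈ Y.obj _ → ∀ t : Fin (d + 1) → Fin 2,
      (∀ i, y i = φ (x i, t i)) → y ∈ Y.obj _)
    (he' : ∀ d (x y : Δ[n] _⦋d⦌), x ∈ Y.obj _ →
      (∀ i, y i = φ (x i, e')) → y ∈ Z.obj _) :
    IsStrongDeformationRetract (Subcomplex.homOfLE h) := by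
  let H₀ : (Y : SSet.{u}) ⊗ Δ[1] ⟶ Δ[n] := Y.ι ▷ _ ≫ stdSimplex.tensorDesc φ
  have hH₀ : Subcomplex.range H₀ ≤ Y := by
    rintro ⟨⟨d⟩⟩ _ ⟨⟨x, t⟩, rfl⟩
    exact hY d x.1 _ x.2 (fun i => t i) (fun i => rfl)
  have hr : Subcomplex.range (inc e' ≫ H₀) ≤ Z := by
    rintro ⟨⟨d⟩⟩ _ ⟨x, rfl⟩
    exact he' d x.1 _ x.2 (fun i => rfl)
  refine ⟨e, e', Subcomplex.lift _ hr, Subcomplex.lift _ hH₀, ?_, ?_, ?_, ?_⟩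
  · rw [← cancel_mono Z.ι]
    refine NatTrans.ext (funext fun ⟨⟨d⟩⟩ => ConcreteCategory.hom_ext _ _ fun x => ?_)
    exact stdSimplex.ext.{u} _ _ fun i => hZ d x.1 x.2 i e'
  · rw [← cancel_mono Y.ι]
    refine NatTrans.ext (funext fun ⟨⟨d⟩⟩ => ConcreteCategory.hom_ext _ _ fun x => ?_)
    exact stdSimplex.ext.{u} _ _ fun i => he d x.1 x.2 i
  · rfl
  · rw [← cancel_mono Y.ι]
    refine NatTrans.ext (funext fun ⟨⟨d⟩⟩ => ConcreteCategory.hom_ext _ _ fun ⟨x, t⟩ => ?_)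
    exact stdSimplex.ext.{u} _ _ fun i => hZ d x.1 x.2 i _

/-- If `k` is an interior vertex, no single monotone homotopy joins the identity to the constant
`k`; there is only the zigzag id ≤ max(·, k) ≥ k. So `Y` is first deformed to its part `W` on the
vertices ≥ `k`, then `W` to `k`, and the two stably anodyne inclusions are composed. -/
lemma stablyAnodyne_face_singleton {n : ℕ} (k : Fin (n + 1)) (Y : (Δ[n] : SSet.{u}).Subcomplex)
    (hk : stdSimplex.face {k} ≤ Y)
    (hY : ∀ d (x y : Δ[n] _⦋d⦌), x ∈ Y.obj _ → (∀ i, y i = x i ∨ y i = k) → y ∈ Y.obj _) :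
    stablyAnodyne (Subcomplex.homOfLE hk) := by
  let W := Y ⊓ stdSimplex.face (Finset.Ici k)
  have h₁ : stdSimplex.face {k} ≤ W :=
    le_inf hk ((stdSimplex.face_le_face_iff _ _).2 (by simp))
  have h₂ : W ≤ Y := inf_le_left
  let φ₁ : Fin (n + 1) × Fin 2 →o Fin (n + 1) :=
    { toFun z := if z.2 = 0 then z.1 else max z.1 k
      monotone' := by
        rintro ⟨a, s⟩ ⟨b, t⟩ ⟨h, h'⟩
        have h : a ≤ b := h
        have h' : s ≤ t := h'
        fin_cases s <;> fin_cases t <;> simp at h' ⊢; all_goals grind }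
  let φ₂ : Fin (n + 1) × Fin 2 →o Fin (n + 1) :=
    { toFun z := if z.2 = 0 then k else max z.1 k
      monotone' := by
        rintro ⟨a, s⟩ ⟨b, t⟩ ⟨h, h'⟩
        have h : a ≤ b := h
        have h' : s ≤ t := h'
        fin_cases s <;> fin_cases t <;> simp at h' ⊢; all_goals grind }
  have hφ₁ (z) : φ₁ z = if z.2 = 0 then z.1 else max z.1 k := rfl
  have hφ₂ (z) : φ₂ z = if z.2 = 0 then k else max z.1 k := rfl
  have hW {d} (x : (Δ[n] : SSet.{u}) _⦋d⦌) :
      x ∈ W.obj _ ↔ x ∈ Y.obj _ ∧ ∀ i, k ≤ x i := by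
    change x ∈ Y.obj _ ∧ x ∈ (stdSimplex.face _).obj _ ↔ _
    simp [stdSimplex.mem_face_iff]
  have : Subcomplex.homOfLE hk = Subcomplex.homOfLE h₁ ≫ Subcomplex.homOfLE h₂ := rfl
  rw [this]
  refine stablyAnodyne.comp (IsStrongDeformationRetract.stablyAnodyne ?_)
    (IsStrongDeformationRetract.stablyAnodyne ?_)
  · refine isStrongDeformationRetract_homOfLE h₁ φ₂ 1 0 ?_ ?_ ?_ ?_
    · intro d x hx i
      rw [hW] at hx
      simpa [hφ₂] using hx.2 i
    · intro d x hx i t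
      rw [stdSimplex.mem_face_iff] at hx
      have := hx i
      simp at this
      simp [hφ₂, this]
    · intro d x y hx t ht
      rw [hW] at hx ⊢
      refine ⟨hY d x y hx.1 (fun i => ?_), fun i => ?_⟩
      · rw [ht, hφ₂]
        have := hx.2 i
        grind
      · rw [ht, hφ₂]
        grind
    · intro d x y hx ht
      rw [stdSimplex.mem_face_iff]
      intro i
      simp [ht, hφ₂]
  · refine isStrongDeformationRetract_homOfLE h₂ φ₁ 0 1 ?_ ?_ ?_ ?_
    · intro d x hx i
      simp [hφ₁]
    · intro d x hx i t
      rw [hW] at hx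
      have := hx.2 i
      simp [hφ₁, this]
    · intro d x y hx t ht
      refine hY d x y hx (fun i => ?_)
      rw [ht, hφ₁]
      grind
    · intro d x y hx ht
      rw [hW]
      refine ⟨hY d x y hx (fun i => ?_), fun i => ?_⟩
      · rw [ht, hφ₁]
        grind
      · rw [ht, hφ₁]
        grind

instance kanComplex_face_singleton {n : ℕ} (k : Fin (n + 1)) :
    KanComplex (stdSimplex.face.{u} {k} : SSet.{u}) := by
  have hs {d} (x y : (stdSimplex.face.{u} {k} : SSet.{u}).obj d) : x = y := by
    obtain ⟨⟨d⟩⟩ := d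
    refine Subtype.ext (stdSimplex.ext.{u} _ _ fun i => ?_)
    have hx := (stdSimplex.mem_face_iff _ _).1 x.2 i
    have hy := (stdSimplex.mem_face_iff _ _).1 y.2 i
    rw [Finset.mem_singleton] at hx hy
    rw [hx, hy]
  have ht : IsTerminal (stdSimplex.face.{u} {k} : SSet.{u}) :=
    IsTerminal.ofUniqueHom (fun X => Subcomplex.lift (const (stdSimplex.obj₀Equiv.symm k)) (by
      rintro ⟨⟨d⟩⟩ _ ⟨x, rfl⟩
      exact (stdSimplex.mem_face_iff _ _).2 fun i => Finset.mem_singleton.2 rfl)) (fun X m => by ext n x; exact hs _ _)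
  have : IsIso (terminal.from (stdSimplex.face.{u} {k} : SSet.{u})) :=
    isIso_of_isTerminal ht terminalIsTerminal _
  refine (isFibrant_iff _).2 ?_
  rw [modelCategoryQuillen.fibration_iff]
  exact MorphismProperty.of_isIso _ _

/-- Morphisms along which every fibration extends, as a base change. -/
def extendsFibrations : MorphismProperty SSet.{u} := fun A B i =>
  ∀ ⦃E : SSet.{u}⦄ (p : E ⟶ A) [Fibration p],
    ∃ (E' : SSet.{u}) (j' : E ⟶ E') (p' : E' ⟶ B), Fibration p' ∧ IsPullback j' p p' i

/-- A simplex of the horn misses a vertex other than `k`, and still does so after some of its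
vertices are replaced by `k`. Hence the vertex `k`, which is Kan, is stably anodyne both in the horn
and in the full simplex. -/
lemma extendsFibrations_horn {n : ℕ} (k : Fin (n + 2)) : extendsFibrations Λ[n + 1, k].ι.{u} := by
  intro E p _
  have hk : stdSimplex.face.{u} {k} ≤ Λ[n + 1, k] := by
    rw [face_le_horn_iff]
    exact ⟨by simpa [Finset.eq_univ_iff_forall] using exists_ne k, fun h => by simpa using h.le (Finset.mem_singleton_self k)⟩
  refine exists_isPullback_fibration _ (Subcomplex.homOfLE hk)
    (stablyAnodyne_face_singleton k _ hk ?_) ?_ p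
  · intro d x y hx hy
    rw [mem_horn_iff_notMem_range] at hx ⊢
    obtain ⟨j, hj, hx⟩ := hx
    refine ⟨j, hj, ?_⟩
    rintro ⟨i, rfl⟩
    obtain h | h := hy i
    · exact hx ⟨i, h.symm⟩
    · exact hj h
  · have h₁ := stablyAnodyne_face_singleton.{u} k ⊤ le_top (fun _ _ _ _ _ => trivial)
    intro X' Y' i' q p _ sq
    have : Fibration (p ≫ (Subcomplex.topIso Δ[n + 1]).inv) :=
      fibration_of_isPullback (g' := 𝟙 _) (g := (Subcomplex.topIso Δ[n + 1]).hom) (f := p)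
        (IsPullback.of_horiz_isIso ⟨by simp⟩)
    have sq₂ : IsPullback (𝟙 _) p (p ≫ (Subcomplex.topIso Δ[n + 1]).inv)
      (Subcomplex.topIso Δ[n + 1]).inv := IsPullback.of_horiz_isIso ⟨by simp⟩
    have sq₃ := sq.paste_horiz sq₂
    rw [Category.comp_id] at sq₃
    exact h₁ i' q (p ≫ (Subcomplex.topIso _).inv) sq₃

lemma extendsFibrations_J : J.{u} ≤ extendsFibrations := by
  intro A B i hi
  simp only [J, MorphismProperty.iSup_iff] at hi
  obtain ⟨n, ⟨k⟩⟩ := hi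
  exact extendsFibrations_horn k

instance : (extendsFibrations.{u}).IsMultiplicative where
  id_mem A E p _ := ⟨E, 𝟙 _, p, inferInstance, IsPullback.of_horiz_isIso ⟨by simp⟩⟩
  comp_mem i j hi hj E p _ := by
    obtain ⟨E', j', p', _, sq'⟩ := hi p
    obtain ⟨E'', j'', p'', _, sq''⟩ := hj p'
    exact ⟨E'', j' ≫ j'', p'', inferInstance, sq'.paste_horiz sq''⟩

lemma isomorphisms_le_extendsFibrations :
    MorphismProperty.isomorphisms SSet.{u} ≤ extendsFibrations := by
  intro A B i (_ : IsIso i) E p _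
  refine ⟨E, 𝟙 _, p ≫ i, ?_, IsPullback.of_horiz_isIso ⟨by simp⟩⟩
  rw [modelCategoryQuillen.fibration_iff] at *
  exact MorphismProperty.comp_mem _ _ _ ‹_› (MorphismProperty.of_isIso _ _)

/-- Every simplex of the pushout comes from `B` or from `D`, so a horn-filling problem over it can
be solved in one of the two base changes. -/
lemma fibration_of_isPushout {A B D D' E E₁ : SSet.{u}} {i : A ⟶ B} {f : A ⟶ D} {f' : B ⟶ D'}
    {i' : D ⟶ D'} (h : IsPushout i f f' i') {j₁ : E₁ ⟶ E} {p₁ : E₁ ⟶ B} {E₂ : SSet.{u}} 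
    {j₂ : E₂ ⟶ E} {p₂ : E₂ ⟶ D} {p : E ⟶ D'} [Fibration p₁] [Fibration p₂]
    (sq₁ : IsPullback j₁ p₁ p f') (sq₂ : IsPullback j₂ p₂ p i') : Fibration p := by
  have key {n : ℕ} (k : Fin (n + 2)) {E₀ B₀ : SSet.{u}} {j₀ : E₀ ⟶ E} {p₀ : E₀ ⟶ B₀} {g : B₀ ⟶ D'}
      [Fibration p₀] (sq₀ : IsPullback j₀ p₀ p g) (a : (Λ[n + 1, k] : SSet.{u}) ⟶ E)
      (b : Δ[n + 1] ⟶ D') (b₀ : Δ[n + 1] ⟶ B₀) (w : a ≫ p = Λ[n + 1, k].ι ≫ b)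
      (hb : b₀ ≫ g = b) : ∃ l, Λ[n + 1, k].ι ≫ l = a ∧ l ≫ p = b := by
    have : anodyneExtensions Λ[n + 1, k].ι := MorphismProperty.le_llp_rlp _ _ (horn_ι_mem_J _ _)
    obtain ⟨l, hl₁, hl₂⟩ := this.exists_lift (p := p₀)
      (sq₀.lift a (Λ[n + 1, k].ι ≫ b₀) (by simp [w, hb])) b₀ (by simp)
    refine ⟨l ≫ j₀, by simp [reassoc_of% hl₁], ?_⟩
    rw [Category.assoc, sq₀.w, reassoc_of% hl₂, hb]
  rw [modelCategoryQuillen.fibration_iff]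
  intro X Y g hg
  simp only [J, MorphismProperty.iSup_iff] at hg
  obtain ⟨n, ⟨k⟩⟩ := hg
  refine ⟨fun {a b} sq => ?_⟩
  have : ∃ l, Λ[n + 1, k].ι ≫ l = a ∧ l ≫ p = b := by
    obtain ⟨x, hx⟩ | ⟨x, hx⟩ := Types.eq_or_eq_of_isPushout
      (h.map ((evaluation _ _).obj (op ⦋n + 1⦌))) (yonedaEquiv b)
    · exact key k sq₁ a b (yonedaEquiv.symm x) sq.w (by
        exact (yonedaEquiv_symm_comp _ _).trans ((Equiv.symm_apply_eq _).2 hx))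
    · exact key k sq₂ a b (yonedaEquiv.symm x) sq.w (by
        exact (yonedaEquiv_symm_comp _ _).trans ((Equiv.symm_apply_eq _).2 hx))
  exact ⟨⟨this.choose, this.choose_spec.1, this.choose_spec.2⟩⟩

/-- Restrict the fibration to `A`, extend it over `B` and glue with `E`. Pushouts along
monomorphisms are van Kampen, so the glued map restricts to the given fibrations over `B` and `D`.
-/
lemma extendsFibrations_of_isPushout {A B D D' : SSet.{u}} {i : A ⟶ B} {f : A ⟶ D} {f' : B ⟶ D'}
    {i' : D ⟶ D'} (h : IsPushout i f f' i') [Mono i] (hi : extendsFibrations i) :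
    extendsFibrations i' := by
  intro E p _
  have sqA := IsPullback.of_hasPullback p f
  have : Fibration (pullback.snd p f) := fibration_of_isPullback sqA
  obtain ⟨E', j', p', _, sq'⟩ := hi (pullback.snd p f)
  have : Adhesive SSet.{u} := inferInstanceAs (Adhesive (SimplexCategoryᵒᵖ ⥤ Type u))
  have hE := IsPushout.of_hasPushout j' (pullback.fst p f)
  let P : pushout j' (pullback.fst p f) ⟶ D' := pushout.desc (p' ≫ f') (p ≫ i') (by
    rw [reassoc_of% sq'.w, h.w, reassoc_of% sqA.w])
  have h₁ : pushout.inl j' (pullback.fst p f) ≫ P = p' ≫ f' := pushout.inl_desc _ _ _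
  have h₂ : pushout.inr j' (pullback.fst p f) ≫ P = p ≫ i' := pushout.inr_desc _ _ _
  obtain ⟨sq₁, sq₂⟩ := ((Adhesive.van_kampen h) _ _ _ _ _ _ _ P sq' sqA ⟨h₁⟩ ⟨h₂⟩ ⟨hE.w⟩).1 hE
  exact ⟨_, _, P, fibration_of_isPushout h sq₁ sq₂, sq₂⟩

lemma isomorphisms_le_finiteHornCell : MorphismProperty.isomorphisms SSet.{u} ≤ finiteHornCell := by
  intro X Y f (_ : IsIso f)
  refine (MorphismProperty.iSup_iff _ _).2 ⟨0, ⟨((MorphismProperty.TransfiniteCompositionOfShape.id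
    J.{u}.pushouts X).ofArrowIso (Arrow.isoMk' _ _
      (Iso.refl X) (asIso f) (by simp)))⟩⟩

lemma finiteHornCell_le {W : MorphismProperty SSet.{u}} [W.IsMultiplicative]
    (hW : MorphismProperty.isomorphisms _ ≤ W) (hJ : J.{u}.pushouts ≤ W) : finiteHornCell ≤ W := by
  intro X Y f hf
  simp only [finiteHornCell, MorphismProperty.iSup_iff] at hf
  obtain ⟨n, hf⟩ := hf
  exact MorphismProperty.transfiniteCompositionsOfShape_fin_le hW _
    (MorphismProperty.transfiniteCompositionsOfShape_monotone _ hJ _ hf)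

lemma pushouts_J_le_finiteHornCell : J.{u}.pushouts ≤ finiteHornCell := by
  intro X Y f hf
  exact (MorphismProperty.iSup_iff _ _).2 ⟨1, ⟨.ofMem f hf⟩⟩

instance : finiteHornCell.{u}.RespectsIso := by
  refine MorphismProperty.RespectsIso.of_respects_arrow_iso _ fun f g e hf => ?_
  simp only [finiteHornCell, MorphismProperty.iSup_iff] at hf ⊢
  obtain ⟨n, ⟨hf⟩⟩ := hf
  exact ⟨n, ⟨hf.ofArrowIso e⟩⟩

instance : finiteHornCell.{u}.IsMultiplicative where
  id_mem X := isomorphisms_le_finiteHornCell _ (inferInstanceAs (IsIso (𝟙 X)))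
  comp_mem {X Y Z} f g hf hg := by
    -- This class is multiplicative by construction, so only isomorphisms and single cells have to
    -- be checked.
    let W : MorphismProperty SSet.{u} := fun X Y f => ∀ ⦃Z⦄ (g : Y ⟶ Z), finiteHornCell g →
      finiteHornCell (f ≫ g)
    have : W.IsMultiplicative :=
      { id_mem X Z g hg := by rwa [Category.id_comp]
        comp_mem f g hf hg Z h hh := by
          rw [Category.assoc]
          exact hf _ (hg _ hh) }
    refine finiteHornCell_le (W := W) ?_ ?_ f hf g hg
    · intro X Y f hf Z g hg
      have : IsIso f := hf
      exact (finiteHornCell.cancel_left_of_respectsIso f g).2 hg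
    · intro X Y f hf Z g hg
      simp only [finiteHornCell, MorphismProperty.iSup_iff] at hg
      obtain ⟨n, hg⟩ := hg
      exact (MorphismProperty.iSup_iff _ _).2 ⟨n + 1,
        MorphismProperty.transfiniteCompositionsOfShape_fin_precomp hf hg⟩

lemma finiteHornCell_le_extendsFibrations : finiteHornCell.{u} ≤ extendsFibrations := by
  have hJ : J.{u}.pushouts ≤ extendsFibrations := by
    rintro X Y i' ⟨A, B, i, f, f', hi, h⟩
    have : anodyneExtensions i := MorphismProperty.le_llp_rlp _ _ hi
    have := this.mono
    exact extendsFibrations_of_isPushout h.flip (extendsFibrations_J _ hi)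
  exact finiteHornCell_le isomorphisms_le_extendsFibrations hJ

end

end SSet

end

/-! ### Finite stages of the small object argument -/

section

open MonoidalCategory CartesianMonoidalCategory HomotopicalAlgebra Simplicial
open SSet.modelCategoryQuillen

namespace SSet

section

variable {A B W X Y Z : SSet.{u}}

/-- The finitely many nondegenerate simplices of `Z` generate it, and directedness bounds the stages
where they occur. -/
lemma Subcomplex.exists_le_of_finite {ι : Type*} [Preorder ι] [IsDirectedOrder ι] [Nonempty ι]
    {U : ι → W.Subcomplex} (hU : Monotone U) (hs : ∀ n (x : W.obj n), ∃ i, x ∈ (U i).obj n)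
    (Z : W.Subcomplex) [SSet.Finite Z] : ∃ i, Z ≤ U i := by
  classical
  choose φ hφ using hs
  have : Fintype (Z : SSet.{u}).N := Fintype.ofFinite _
  obtain ⟨i, hi⟩ := Finset.exists_le ((Finset.univ (α := (Z : SSet.{u}).N)).image
    fun x => φ _ x.simplex.1)
  refine ⟨i, ?_⟩
  rintro ⟨⟨n⟩⟩ x hx
  obtain ⟨m, f, _, ⟨y, hy⟩, h⟩ := (Z : SSet.{u}).exists_nonDegenerate (n := n) ⟨x, hx⟩
  have h₁ : x = W.map f.op y.1 := congr_arg Subtype.val h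
  rw [h₁]
  have h₂ : φ _ y.1 ≤ i := hi _ (Finset.mem_image_of_mem (fun x : (Z : SSet.{u}).N =>
    φ _ x.simplex.1) (a := SSet.N.mk _ hy) (Finset.mem_univ _))
  exact (U i).map _ (hU h₂ _ (hφ _ y.1))

/-- Monomorphisms whose finite parts are finite relative horn-cell complexes, relatively to all
sufficiently large subcomplexes of the source. -/
structure HasFiniteStages (f : A ⟶ W) : Prop where
  mono : Mono f
  exists_stage (Z : W.Subcomplex) [SSet.Finite Z] : ∃ T : A.Subcomplex, SSet.Finite T ∧
    ∀ A' : A.Subcomplex, T ≤ A' → ∃ (S : W.Subcomplex) (g : (A' : SSet.{u}) ⟶ S),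
      Z ≤ S ∧ finiteHornCell g ∧ g ≫ S.ι = A'.ι ≫ f

/-- The monomorphisms that have finite stages, as a property of morphisms. -/
def hasFiniteStages : MorphismProperty SSet.{u} := fun _ _ f => HasFiniteStages f

/-- Here the quantification over all `A' ≥ T` is needed: the stage `S` found for `f` plays the role
of `A'` for `g`. -/
lemma HasFiniteStages.comp {f : A ⟶ X} {g : X ⟶ Y} (hf : HasFiniteStages f)
    (hg : HasFiniteStages g) : HasFiniteStages (f ≫ g) where
  mono := have := hf.mono; have := hg.mono; inferInstance
  exists_stage Z _ := by
    obtain ⟨T, hT, h⟩ := hg.exists_stage Z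
    obtain ⟨T', hT', h'⟩ := hf.exists_stage T
    refine ⟨T', hT', fun A' hA' => ?_⟩
    obtain ⟨S, k, hS, hk, fac⟩ := h' A' hA'
    obtain ⟨S', k', hS', hk', fac'⟩ := h S hS
    exact ⟨S', k ≫ k', hS', MorphismProperty.comp_mem _ _ _ hk hk', by
      rw [Category.assoc, fac', reassoc_of% fac]⟩

instance (f : A ⟶ X) [Mono f] (Z : X.Subcomplex) [SSet.Finite Z] : SSet.Finite (Z.preimage f) :=
  have : Mono (Z.fromPreimage f ≫ Z.ι) := by
    rw [Subcomplex.fromPreimage_ι]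
    infer_instance
  have := mono_of_mono (Z.fromPreimage f) Z.ι
  finite_of_mono (Z.fromPreimage f)

lemma isIso_of_bijective {f : X ⟶ Y} (h : ∀ n, Function.Bijective (f.app n)) : IsIso f := by
  rw [NatTrans.isIso_iff_isIso_app]
  intro n
  exact (isIso_iff_bijective _).2 (h n)

lemma HasFiniteStages.of_isIso (f : A ⟶ X) [IsIso f] : HasFiniteStages f where
  mono := inferInstance
  exists_stage Z _ := by
    refine ⟨Z.preimage f, inferInstance, fun A' hA' => ⟨A'.preimage (inv f),
      Subcomplex.lift (A'.ι ≫ f) ?_, ?_, ?_, ?_⟩⟩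
    · rintro n _ ⟨x, rfl⟩
      change (f ≫ inv f).app n _ ∈ A'.obj n
      rw [IsIso.hom_inv_id]
      exact x.2
    · intro n x hx
      refine hA' n ?_
      change (inv f ≫ f).app n x ∈ Z.obj n
      rwa [IsIso.inv_hom_id]
    · refine isomorphisms_le_finiteHornCell _ ?_
      refine isIso_of_bijective fun n => ⟨fun x y h => ?_, fun x => ?_⟩
      · have := (mono_iff_injective (f.app n)).1 inferInstance (congr_arg Subtype.val h)
        exact Subtype.ext this
      · refine ⟨⟨(inv f).app n x.1, x.2⟩, Subtype.ext ?_⟩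
        change (inv f ≫ f).app n x.1 = _
        rw [IsIso.inv_hom_id]
        rfl
    · rfl

section cells

variable (r : A ⟶ W) {ι : Type*} {B : ι → SSet.{u}} (c : ∀ i, B i ⟶ W)

/-- The union of the image of a subcomplex and of finitely many cells. -/
def cellStage (A' : A.Subcomplex) (F : Finset ι) : W.Subcomplex where
  obj n := {x | (∃ y ∈ A'.obj n, r.app n y = x) ∨ ∃ i ∈ F, ∃ y, (c i).app n y = x}
  map {n m} φ := by
    rintro _ (⟨y, hy, rfl⟩ | ⟨i, hi, y, rfl⟩)
    · exact Or.inl ⟨_, A'.map φ hy, NatTrans.naturality_apply r φ y⟩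
    · exact Or.inr ⟨i, hi, _, NatTrans.naturality_apply (c i) φ y⟩

lemma cellStage_mono (A' : A.Subcomplex) : Monotone (cellStage r c A') := by
  rintro F F' h n x (hx | ⟨i, hi, hx⟩)
  · exact Or.inl hx
  · exact Or.inr ⟨i, h hi, hx⟩

/-- The inclusion of a subcomplex in a stage of a cell complex. -/
def toCellStage (A' : A.Subcomplex) (F : Finset ι) : (A' : SSet.{u}) ⟶ cellStage r c A' F :=
  Subcomplex.lift (A'.ι ≫ r) (by
    rintro n _ ⟨x, rfl⟩
    exact Or.inl ⟨x.1, x.2, rfl⟩)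

variable {r c} {D : ι → SSet.{u}} {a : ∀ i, D i ⟶ B i} {t : ∀ i, D i ⟶ A}

/-- The cells are attached one by one. By `h₂` and `h₃` the interior of a cell meets neither `A` nor
another cell, so a new cell meets the previous stage exactly in its horn. -/
lemma finiteHornCell_toCellStage [Mono r] (hJ : ∀ i, J (a i)) (w : ∀ i, t i ≫ r = a i ≫ c i)
    (h₂ : ∀ n y i z, r.app n y = (c i).app n z → z ∈ Set.range ((a i).app n))
    (h₃ : ∀ n i y k z, (c i).app n y = (c k).app n z → y ∉ Set.range ((a i).app n) →
      (⟨i, y⟩ : Σ i, (B i).obj n) = ⟨k, z⟩)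
    (A' : A.Subcomplex) (F : Finset ι) (hF : ∀ i ∈ F, Subcomplex.range (t i) ≤ A') :
    finiteHornCell (toCellStage r c A' F) := by
  classical
  induction F using Finset.induction with
  | empty =>
    refine isomorphisms_le_finiteHornCell _ ?_
    refine isIso_of_bijective fun n => ⟨fun x y h => ?_, fun ⟨x, hx⟩ => ?_⟩
    · have := (mono_iff_injective (r.app n)).1 inferInstance (congr_arg Subtype.val h)
      exact Subtype.ext this
    · obtain ⟨y, hy, rfl⟩ | ⟨i, hi, _⟩ := hx
      · exact ⟨⟨y, hy⟩, rfl⟩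
      · simp at hi
  | insert i F hi hF' =>
    have hA := hF i (Finset.mem_insert_self i F)
    have hle := cellStage_mono r c A' (Finset.subset_insert i F)
    have : toCellStage r c A' (insert i F) = toCellStage r c A' F ≫ Subcomplex.homOfLE hle := rfl
    rw [this]
    refine MorphismProperty.comp_mem _ _ _
      (hF' fun k hk => hF k (Finset.mem_insert_of_mem hk))
      (pushouts_J_le_finiteHornCell _ ⟨D i, B i, a i, Subcomplex.lift (t i ≫ r) ?_,
        Subcomplex.lift (c i) ?_, hJ i, ?_⟩)
    · rintro n _ ⟨x, rfl⟩
      exact Or.inl ⟨_, hA _ ⟨x, rfl⟩, rfl⟩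
    · rintro n _ ⟨x, rfl⟩
      exact Or.inr ⟨i, Finset.mem_insert_self i F, x, rfl⟩
    · have : Mono (a i) := anodyneExtensions.mono (MorphismProperty.le_llp_rlp _ _ (hJ i))
      refine IsPushout.of_forall_isPushout_app fun n => ?_
      have wn (x) : r.app n ((t i).app n x) = (c i).app n ((a i).app n x) :=
        ConcreteCategory.congr_hom (congr_app (w i) n) x
      refine Types.isPushout_of_isPullback_of_mono' ?_ ?_ ?_
      · rw [Types.isPullback_iff]
        refine ⟨?_, fun x y h => ?_, ?_⟩
        · ext x
          exact Subtype.ext (wn x)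
        · exact (mono_iff_injective ((a i).app n)).1 inferInstance h.2
        · rintro ⟨x, hx⟩ z h
          have h : x = (c i).app n z := congr_arg Subtype.val h
          obtain ⟨d, rfl⟩ : z ∈ Set.range ((a i).app n) := by
            obtain ⟨y, hy, hx⟩ | ⟨k, hk, y, hx⟩ := hx
            · exact h₂ n y i z (hx.trans (congr_arg Subtype.val h))
            · by_contra hz
              have := h₃ n i z k y (hx.trans (congr_arg Subtype.val h)).symm hz
              rw [Sigma.mk.injEq] at this
              exact hi (this.1 ▸ hk)
          exact ⟨d, Subtype.ext ((wn d).trans h.symm), rfl⟩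
      · refine Set.eq_univ_iff_forall.2 ?_
        rintro ⟨x, hx | ⟨k, hk, y, rfl⟩⟩
        · exact Or.inl ⟨⟨x, Or.inl hx⟩, rfl⟩
        · obtain rfl | hk' := Finset.mem_insert.1 hk
          · exact Or.inr ⟨y, rfl⟩
          · exact Or.inl ⟨⟨_, Or.inr ⟨k, hk', y, rfl⟩⟩, rfl⟩
      · intro y z hy _ h
        have := h₃ n i y i z (congr_arg Subtype.val h) hy
        simpa using this

/-- Finitely many cells together with `A` cover `Z`. The bound `T` consists of the preimage of `Z`
and of the images of the attaching maps of these cells, and all horns are finite. -/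
lemma HasFiniteStages.of_cells [Mono r] (hJ : ∀ i, J (a i)) (w : ∀ i, t i ≫ r = a i ≫ c i)
    (h₁ : ∀ n (x : W.obj n), (∃ y, r.app n y = x) ∨ ∃ i y, (c i).app n y = x)
    (h₂ : ∀ n y i z, r.app n y = (c i).app n z → z ∈ Set.range ((a i).app n))
    (h₃ : ∀ n i y k z, (c i).app n y = (c k).app n z → y ∉ Set.range ((a i).app n) →
      (⟨i, y⟩ : Σ i, (B i).obj n) = ⟨k, z⟩) : HasFiniteStages r where
  mono := inferInstance
  exists_stage Z _ := by
    classical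
    obtain ⟨F, hF⟩ := Subcomplex.exists_le_of_finite (cellStage_mono r c ⊤) (fun n x => by
      obtain ⟨y, rfl⟩ | ⟨i, y, rfl⟩ := h₁ n x
      · exact ⟨∅, Or.inl ⟨y, trivial, rfl⟩⟩
      · exact ⟨{i}, Or.inr ⟨i, Finset.mem_singleton_self i, y, rfl⟩⟩) Z
    have hD (i) : (D i).Finite := by
      have key ⦃X Y : SSet.{u}⦄ (f : X ⟶ Y) (hf : J f) : X.Finite := by
        simp only [J, MorphismProperty.iSup_iff] at hf
        obtain ⟨n, ⟨k⟩⟩ := hf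
        infer_instance
      exact key _ (hJ i)
    refine ⟨Z.preimage r ⊔ ⨆ i : F, Subcomplex.range (t i), ?_, fun A' hA' => ?_⟩
    · rw [sup_eq_iSup, finite_iSup_iff]
      rintro (_ | _)
      · exact (finite_iSup_iff _).2 fun i => inferInstance
      · exact (inferInstance : SSet.Finite (Z.preimage r))
    · refine ⟨cellStage r c A' F, toCellStage r c A' F, ?_,
        finiteHornCell_toCellStage hJ w h₂ h₃ A' F (fun i hi => ?_), rfl⟩
      · intro n x hx
        obtain ⟨y, -, rfl⟩ | h := hF n hx
        · exact Or.inl ⟨y, hA' _ (Or.inl hx), rfl⟩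
        · exact Or.inr h
      · exact (le_iSup (fun i : F => Subcomplex.range (t i)) ⟨i, hi⟩).trans
          (le_sup_right.trans hA')

end cells

lemma HasFiniteStages.of_mem {f : A ⟶ W}
    (hf : (MorphismProperty.coproducts.{u} J.{u}).pushouts f) : HasFiniteStages f := by
  classical
  obtain ⟨X₁, X₂, l, t, b, hl, sq⟩ := hf
  rw [MorphismProperty.coproducts_iff] at hl
  obtain ⟨ι, ⟨D, B, c₁, c₂, hc₁, hc₂, a, ha⟩⟩ := hl
  generalize hl' : hc₁.desc (Cocone.mk _ (a ≫ c₂.ι)) = l at sq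
  have hl : anodyneExtensions l := MorphismProperty.coproducts_le_llp_rlp _ _
    ((MorphismProperty.coproducts_iff _ _).2 ⟨ι, hl' ▸ .mk _ _ _ _ hc₁ hc₂ a ha⟩)
  have : Mono f := (MorphismProperty.of_isPushout sq hl).mono
  have wl (i) : c₁.ι.app ⟨i⟩ ≫ l = a.app ⟨i⟩ ≫ c₂.ι.app ⟨i⟩ := by
    rw [← hl', hc₁.fac]
    rfl
  have h₁ (n) := isColimitOfPreserves ((evaluation _ _).obj n) hc₁
  have h₂ (n) := isColimitOfPreserves ((evaluation _ _).obj n) hc₂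
  have sq' (n) := sq.app n
  -- `ρ` sends `A` to `none` and remembers the cell and the position of every other simplex. It
  -- exists by the universal property of the pushout, and it separates the interiors of the cells
  -- from `A` and from each other.
  have hρ (n) : ∃ ρ : W.obj n → Option (Σ i : ι, (B.obj ⟨i⟩).obj n),
      (∀ x, ρ (f.app n x) = none) ∧
      ∀ i y, ρ (b.app n ((c₂.ι.app ⟨i⟩).app n y)) =
        if y ∈ Set.range ((a.app ⟨i⟩).app n) then none else some ⟨i, y⟩ := by
    let s : Cocone (B ⋙ (evaluation _ _).obj n) :=
      { pt := Option (Σ i : ι, (B.obj ⟨i⟩).obj n)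
        ι := Discrete.natTrans fun i => ↾fun y =>
          if y ∈ Set.range ((a.app i).app n) then none else some ⟨i.as, y⟩ }
    have hs : l.app n ≫ (h₂ n).desc s = ↾fun _ => none := by
      refine (h₁ n).hom_ext fun i => ConcreteCategory.hom_ext _ _ fun x => ?_
      have e₁ : l.app n ((c₁.ι.app i).app n x) = (c₂.ι.app i).app n ((a.app i).app n x) :=
        ConcreteCategory.congr_hom (congr_app (wl i.as) n) x
      refine (congr_arg ((h₂ n).desc s) e₁).trans ?_
      refine (ConcreteCategory.congr_hom ((h₂ n).fac s i) _).trans ?_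
      exact if_pos ⟨x, rfl⟩
    refine ⟨(sq' n).desc (↾fun _ => none) ((h₂ n).desc s) hs.symm, fun x => ?_, fun i y => ?_⟩
    · exact ConcreteCategory.congr_hom ((sq' n).inl_desc _ _ _) x
    · refine (ConcreteCategory.congr_hom ((sq' n).inr_desc _ _ _) _).trans ?_
      exact ConcreteCategory.congr_hom ((h₂ n).fac s ⟨i⟩) y
  refine .of_cells (r := f) (ι := ι) (D := fun i => D.obj ⟨i⟩) (B := fun i => B.obj ⟨i⟩)
    (a := fun i => a.app ⟨i⟩) (t := fun i => c₁.ι.app ⟨i⟩ ≫ t) (c := fun i => c₂.ι.app ⟨i⟩ ≫ b)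
    (fun i => ha _) ?_ ?_ ?_ ?_
  · intro i
    rw [Category.assoc, sq.w, reassoc_of% wl]
  · intro n x
    obtain ⟨y, hy⟩ | ⟨y, rfl⟩ := Types.eq_or_eq_of_isPushout (sq' n) x
    · exact Or.inl ⟨y, hy⟩
    · obtain ⟨i, z, rfl⟩ := Types.jointly_surjective _ (h₂ n) y
      exact Or.inr ⟨i.as, z, rfl⟩
  · intro n y i z h
    obtain ⟨ρ, hρ₁, hρ₂⟩ := hρ n
    by_contra hz
    have := (hρ₁ y).symm.trans ((congr_arg ρ h).trans (hρ₂ i z))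
    rw [if_neg hz] at this
    simp at this
  · intro n i y k z h hy
    obtain ⟨ρ, -, hρ₂⟩ := hρ n
    have := (hρ₂ i y).symm.trans ((congr_arg ρ h).trans (hρ₂ k z))
    rw [if_neg hy] at this
    split_ifs at this
    simpa using this

lemma mono_incl_app {J : Type} [LinearOrder J] [SuccOrder J] [OrderBot J] [WellFoundedLT J]
    {f : A ⟶ W} (h : (MorphismProperty.monomorphisms _).TransfiniteCompositionOfShape J f) (j : J) :
    Mono (h.incl.app j) :=
  MorphismProperty.transfiniteCompositionsOfShape_le (MorphismProperty.monomorphisms _)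
    (Set.Ici j) _ ⟨h.ici j⟩

/-- A finite subcomplex of the colimit lies in the image of some stage `n`, so the finite composite
up to `n` decides. -/
lemma HasFiniteStages.of_transfiniteCompositionOfShape {f : A ⟶ W}
    (h : hasFiniteStages.TransfiniteCompositionOfShape ℕ f) :
    HasFiniteStages f := by
  have h₀ (n : ℕ) : HasFiniteStages (h.F.map (homOfLE (bot_le : ⊥ ≤ n))) := by
    induction n with
    | zero =>
      have : homOfLE (bot_le : ⊥ ≤ 0) = 𝟙 _ := rfl
      rw [this, h.F.map_id]
      exact .of_isIso _
    | succ n hn =>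
      have e := h.F.map_comp (homOfLE (bot_le : ⊥ ≤ n)) (homOfLE (Order.le_succ n))
      exact (congrArg HasFiniteStages e).mpr (hn.comp (h.map_mem n (by simp)))
  have hm (n : ℕ) : Mono (h.incl.app n) := by
    exact mono_incl_app (h.ofLE (W' := MorphismProperty.monomorphisms _)
      (fun _ _ f hf => HasFiniteStages.mono hf)) n
  rw [← h.fac]
  refine (HasFiniteStages.of_isIso h.isoBot.inv).comp ⟨hm _, fun Z _ => ?_⟩
  have hf {n m : ℕ} (hnm : n ≤ m) : h.F.map (homOfLE hnm) ≫ h.incl.app m = h.incl.app n :=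
    (h.incl.naturality _).trans (Category.comp_id _)
  obtain ⟨n, hn⟩ := Subcomplex.exists_le_of_finite
    (U := fun n => Subcomplex.range (h.incl.app n)) (fun n m hnm => by
      dsimp only
      rw [← hf hnm, Subcomplex.range_comp]
      exact Subcomplex.image_le_range _ _) (fun n x => by
      obtain ⟨m, y, hy⟩ := Types.jointly_surjective _
        (isColimitOfPreserves ((evaluation _ _).obj n) h.isColimit) x
      exact ⟨m, y, hy⟩) Z
  obtain ⟨T, hT, hT'⟩ := (h₀ n).exists_stage (Z.preimage (h.incl.app n))
  refine ⟨T, hT, fun A' hA' => ?_⟩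
  obtain ⟨S, g, hS, hg, fac⟩ := hT' A' hA'
  refine ⟨S.image (h.incl.app n), g ≫ S.toImage _, ?_, ?_, ?_⟩
  · intro k x hx
    obtain ⟨y, rfl⟩ := hn k hx
    exact ⟨y, hS _ hx, rfl⟩
  · refine MorphismProperty.comp_mem _ _ _ hg (isomorphisms_le_finiteHornCell _ ?_)
    have : Mono (S.toImage (h.incl.app n) ≫ (S.image (h.incl.app n)).ι) := by
      rw [Subcomplex.toImage_ι]
      infer_instance
    have := mono_of_mono (S.toImage (h.incl.app n)) (S.image (h.incl.app n)).ι
    exact isIso_of_mono_of_epi _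
  · rw [Category.assoc, Subcomplex.toImage_ι, reassoc_of% fac, hf]

attribute [local instance] Cardinal.fact_isRegular_aleph0
  Cardinal.orderBotAleph0OrdToType

/-- Horns are finite, so the small object argument runs with the cardinal ℵ₀, and its tower can be
reindexed by `ℕ`. -/
lemma exists_factorization_hasFiniteStages (f : X ⟶ Y) : ∃ (Z : SSet.{u}) (i : X ⟶ Z) (p : Z ⟶ Y),
    anodyneExtensions i ∧ HasFiniteStages i ∧ Fibration p ∧ i ≫ p = f := by
  refine ⟨_, SmallObject.ιObj J.{u} Cardinal.aleph0.{u} f,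
    SmallObject.πObj J.{u} Cardinal.aleph0.{u} f, SmallObject.llp_rlp_ιObj _ _ _, ?_,
    (modelCategoryQuillen.fibration_iff _).2 (SmallObject.rlp_πObj _ _ _), by simp⟩
  let e : ℕ ≃o Cardinal.aleph0.{u}.ord.ToType :=
    ULift.orderIso.{u}.symm.trans
      (OrderIso.ofRelIsoLT (Nonempty.some (by simp [← Ordinal.type_eq])))
  have h := SmallObject.transfiniteCompositionsOfShape_ιObj J.{u} Cardinal.aleph0.{u} f
  rw [MorphismProperty.transfiniteCompositionsOfShape_eq_of_orderIso _ e.symm] at h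
  obtain ⟨h⟩ := h
  exact .of_transfiniteCompositionOfShape (h.ofLE fun _ _ _ => .of_mem)

end

end SSet

end

/-! ### Trivial cofibrations of finite simplicial sets as retracts -/

section

open MonoidalCategory CartesianMonoidalCategory HomotopicalAlgebra Simplicial
open SSet.modelCategoryQuillen

namespace SSet

section

variable {A B W X Y Z : SSet.{u}}

lemma finite_of_isPushout {A B D D' : SSet.{u}} {i : A ⟶ B} {f : A ⟶ D} {f' : B ⟶ D'}
    {i' : D ⟶ D'} (h : IsPushout i f f' i') [B.Finite] [D.Finite] : D'.Finite := by
  have h' : ⨆ b : Bool, cond b (Subcomplex.range f') (Subcomplex.range i') = ⊤ := by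
    ext n x
    simp only [Subfunctor.iSup_obj, Set.mem_iUnion, Bool.exists_bool]
    refine iff_of_true ?_ trivial
    obtain ⟨y, hy⟩ | ⟨y, hy⟩ := Types.eq_or_eq_of_isPushout (h.app n) x
    · exact Or.inr ⟨y, hy⟩
    · exact Or.inl ⟨y, hy⟩
  rw [← finite_subcomplex_top_iff, ← h', finite_iSup_iff]
  rintro (_ | _)
  · exact (inferInstance : SSet.Finite (Subcomplex.range i'))
  · exact (inferInstance : SSet.Finite (Subcomplex.range f'))

lemma finite_of_finiteHornCell {f : X ⟶ Y} (hf : finiteHornCell f) [hX : X.Finite] : Y.Finite := by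
  let V : MorphismProperty SSet.{u} := fun X Y _ => X.Finite → Y.Finite
  have : V.IsMultiplicative :=
    { id_mem X h := h
      comp_mem f g hf hg h := hg (hf h) }
  refine finiteHornCell_le (W := V) ?_ ?_ f hf hX
  · intro X Y f (_ : IsIso f) h
    exact finite_of_iso (asIso f)
  · rintro X Y g ⟨C, D, i, f, f', hi, h⟩ hX
    simp only [J, MorphismProperty.iSup_iff] at hi
    obtain ⟨n, ⟨k⟩⟩ := hi
    exact finite_of_isPushout h.flip

lemma finiteHornCell_le_anodyneExtensions : finiteHornCell.{u} ≤ anodyneExtensions := by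
  refine finiteHornCell_le ?_ ?_
  · intro X Y f (_ : IsIso f)
    exact MorphismProperty.of_isIso _ f
  · rintro X Y g ⟨C, D, i, f, f', hi, h⟩
    exact MorphismProperty.of_isPushout h (MorphismProperty.le_llp_rlp _ _ hi)

lemma HasFiniteStages.exists_finite_stage {f : A ⟶ W} (hf : HasFiniteStages f) [A.Finite]
    (Z : W.Subcomplex) [SSet.Finite Z] : ∃ (S : W.Subcomplex) (g : A ⟶ S),
      SSet.Finite S ∧ Z ≤ S ∧ finiteHornCell g ∧ g ≫ S.ι = f := by
  obtain ⟨T, -, h⟩ := hf.exists_stage Z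
  obtain ⟨S, g, hS, hg, fac⟩ := h ⊤ le_top
  have hg' : finiteHornCell ((Subcomplex.topIso A).inv ≫ g) :=
    MorphismProperty.RespectsIso.precomp _ _ _ hg
  exact ⟨S, _, finite_of_finiteHornCell hg', hS, hg', by rw [Category.assoc, fac]; rfl⟩

/-- Every trivial cofibration between finite simplicial sets is a retract of a finite relative
horn-cell complex. -/
theorem exists_retractArrow_finiteHornCell [A.Finite] [B.Finite] (f : A ⟶ B)
    (hf : IsTrivialCofibration f) : ∃ (X Y : SSet.{u}) (g : X ⟶ Y), X.Finite ∧ Y.Finite ∧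
      finiteHornCell g ∧ Nonempty (RetractArrow f g) := by
  obtain ⟨B', j, p₀, -, hj, _, -⟩ := exists_factorization_hasFiniteStages (terminal.from B)
  have hB' : KanComplex B' := by
    refine (isFibrant_iff _).2 ?_
    rwa [Subsingleton.elim (terminal.from B') p₀]
  obtain ⟨W, i, q, -, hi, _, fac⟩ := exists_factorization_hasFiniteStages (f ≫ j)
  have : KanComplex W := isFibrant_of_fibration q
  -- Both `W` and `B'` are Kan, so `f` lifts. The finite stage `W'` is chosen to contain the image
  -- of `l`, and `D` to contain the image of `W'` under `q`.
  obtain ⟨l, hl₁, hl₂⟩ := hf.exists_lift i j fac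
  obtain ⟨W', gW, _, hW', hgW, facW⟩ := hi.exists_finite_stage (Subcomplex.range l)
  let l' : B ⟶ W' := Subcomplex.lift l hW'
  have hl' : f ≫ l' = gW := by
    rw [← cancel_mono W'.ι, facW, ← hl₁]
    rfl
  obtain ⟨D, gD, _, hD, hgD, facD⟩ := hj.exists_finite_stage (Subcomplex.range (W'.ι ≫ q))
  let q' : (W' : SSet.{u}) ⟶ D := Subcomplex.lift (W'.ι ≫ q) hD
  have hq' : l' ≫ q' = gD := by
    rw [← cancel_mono D.ι, facD, ← hl₂]
    rfl
  -- The base `B` of `p` need not be Kan, so `f` is not lifted against `p` itself. Instead `p` is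
  -- extended along `gD` to `p'` over `D`, the anodyne map `gW` is lifted against `p'`, and
  -- restriction to `B` gives the section `s`.
  obtain ⟨E, e, p, -, he, _, facE⟩ := exists_factorization_hasFiniteStages f
  obtain ⟨E', j', p', _, sq⟩ := finiteHornCell_le_extendsFibrations _ hgD p
  obtain ⟨m, hm₁, hm₂⟩ := (finiteHornCell_le_anodyneExtensions _ hgW).exists_lift (p := p')
    (e ≫ j') q' (by rw [Category.assoc, sq.w, reassoc_of% facE, ← hq', reassoc_of% hl'])
  let s : B ⟶ E := sq.lift (l' ≫ m) (𝟙 B) (by rw [Category.assoc, hm₂, hq', Category.id_comp])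
  have hs₁ : s ≫ j' = l' ≫ m := sq.lift_fst _ _ _
  have hs₂ : s ≫ p = 𝟙 B := sq.lift_snd _ _ _
  have hs : f ≫ s = e := by
    refine sq.hom_ext ?_ ?_
    · rw [Category.assoc, hs₁, reassoc_of% hl', hm₁]
    · rw [Category.assoc, hs₂, Category.comp_id, facE]
  obtain ⟨S, g, hS, hS', hg, facS⟩ := he.exists_finite_stage (Subcomplex.range s)
  let s' : B ⟶ S := Subcomplex.lift s hS'
  have hs' : s' ≫ S.ι = s := rfl
  have hg₁ : f ≫ s' = g := by
    rw [← cancel_mono S.ι, facS, Category.assoc, hs', hs]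
  have hg₂ : g ≫ S.ι ≫ p = f := by rw [reassoc_of% facS, facE]
  exact ⟨A, S, g, inferInstance, hS, hg, ⟨
    { i := Arrow.homMk (𝟙 A) s' ((Category.id_comp _).trans hg₁.symm)
      r := Arrow.homMk (𝟙 A) (S.ι ≫ p) ((Category.id_comp _).trans hg₂.symm)
      retract := by
        ext1
        · exact Category.id_comp _
        · exact hs₂ }⟩⟩

end

end SSet

end

/-! ### Pro-objects as diagrams on directed posets -/

section

namespace CategoryTheory.Ind

variable {A : Type u} [SmallCategory A] {T : Type u} [SmallCategory T] [IsFiltered T]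

/-- Evaluation at `c` preserves filtered colimits of ind-objects, so by the Yoneda lemma
representable objects are compact. -/
lemma exists_yoneda_map_ι {K : T ⥤ A} {c : A}
    (g : Ind.yoneda.obj c ⟶ colimit (K ⋙ Ind.yoneda)) :
    ∃ (t : T) (h : c ⟶ K.obj t), Ind.yoneda.map h ≫ colimit.ι (K ⋙ Ind.yoneda) t = g := by
  let e := Ind.yonedaCompInclusion (C := A)
  have hK := isColimitOfPreserves (Ind.inclusion A ⋙ (evaluation _ _).obj (op c))
    (colimit.isColimit (K ⋙ Ind.yoneda))
  obtain ⟨t, z, hz⟩ := Types.jointly_surjective _ hK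
    (yonedaEquiv (e.inv.app c ≫ (Ind.inclusion A).map g))
  let h : c ⟶ K.obj t := (e.hom.app _).app _ z
  refine ⟨t, h, (Ind.inclusion A).map_injective ?_⟩
  have : Epi (e.inv.app c) := inferInstance
  refine (cancel_epi (e.inv.app c)).1 (yonedaEquiv.injective (Eq.trans ?_ hz))
  have h₁ : e.inv.app c ≫ (Ind.inclusion A).map (Ind.yoneda.map h) =
      CategoryTheory.yoneda.map h ≫ e.inv.app (K.obj t) := (e.inv.naturality h).symm
  have h₂ : (e.inv.app (K.obj t)).app (op c) h = z :=
    ConcreteCategory.congr_hom (congr_app (e.hom_inv_id_app (K.obj t)) (op c)) z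
  have h₃ : e.inv.app c ≫ (Ind.inclusion A).map (Ind.yoneda.map h ≫ colimit.ι (K ⋙ Ind.yoneda) t) =
      CategoryTheory.yoneda.map h ≫ e.inv.app (K.obj t) ≫
        (Ind.inclusion A).map (colimit.ι (K ⋙ Ind.yoneda) t) := by
    rw [Functor.map_comp, reassoc_of% h₁]
  rw [h₃, yonedaEquiv_comp, yonedaEquiv_yoneda_map]
  exact congr_arg (((Ind.inclusion A).map (colimit.ι (K ⋙ Ind.yoneda) t)).app (op c)) h₂

end CategoryTheory.Ind

namespace ProCat

section

variable {C : Type u} [SmallCategory C]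

instance [HasFiniteLimits C] : HasLimits (ProCat C) :=
  inferInstanceAs (HasLimits (Ind Cᵒᵖ)ᵒᵖ)

instance : (simple C).Full := inferInstanceAs (Ind.yoneda (C := Cᵒᵖ)).rightOp.Full

instance : (simple C).Faithful := inferInstanceAs (Ind.yoneda (C := Cᵒᵖ)).rightOp.Faithful

noncomputable instance : PreservesFiniteLimits (simple C) :=
  preservesFiniteLimits_rightOp (Ind.yoneda (C := Cᵒᵖ))

variable {T : Type u} [PartialOrder T] [Nonempty T] [IsDirectedOrder T]

/-- The projection from a pro-object to the terms of its diagram. -/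
noncomputable def proj (X : Tᵒᵖ ⥤ C) (t : T) : ofDiagram X ⟶ (simple C).obj (X.obj (op t)) :=
  (colimit.ι (X.rightOp ⋙ Ind.yoneda) t).op

lemma proj_map (X : Tᵒᵖ ⥤ C) {s t : T} (h : s ≤ t) :
    proj X t ≫ (simple C).map (X.map (homOfLE h).op) = proj X s :=
  Quiver.Hom.unop_inj (colimit.w (X.rightOp ⋙ Ind.yoneda) (homOfLE h))

lemma proj_map_assoc (X : Tᵒᵖ ⥤ C) {s t : T} (h : s ≤ t) {Z : ProCat C}
    (k : (simple C).obj (X.obj (op s)) ⟶ Z) :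
    proj X t ≫ (simple C).map (X.map (homOfLE h).op) ≫ k = proj X s ≫ k :=
  (Category.assoc _ _ _).symm.trans (congr_arg (· ≫ k) (proj_map X h))

lemma hom_ext {X : Tᵒᵖ ⥤ C} {V : ProCat C} {f g : V ⟶ ofDiagram X}
    (h : ∀ t, f ≫ proj X t = g ≫ proj X t) : f = g :=
  Quiver.Hom.unop_inj (colimit.hom_ext fun t => Quiver.Hom.op_inj (h t))

lemma exists_lift {X : Tᵒᵖ ⥤ C} {V : ProCat C} (f : ∀ t, V ⟶ (simple C).obj (X.obj (op t)))
    (hf : ∀ ⦃s t⦄ (h : s ≤ t), f t ≫ (simple C).map (X.map (homOfLE h).op) = f s) :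
    ∃ g : V ⟶ ofDiagram X, ∀ t, g ≫ proj X t = f t := by
  let c : Cocone (X.rightOp ⋙ Ind.yoneda) :=
    { pt := V.unop
      ι :=
        { app t := (f t).unop
          naturality s t h := Quiver.Hom.op_inj ((hf (leOfHom h)).trans (Category.id_comp _).symm) } }
  exact ⟨(colimit.desc _ c).op, fun t => Quiver.Hom.unop_inj (colimit.ι_desc c t)⟩

lemma ofNatTrans_proj {X Y : Tᵒᵖ ⥤ C} (F : X ⟶ Y) (t : T) :
    ofNatTrans F ≫ proj Y t = proj X t ≫ (simple C).map (F.app (op t)) :=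
  Quiver.Hom.unop_inj (ι_colimMap (Functor.whiskerRight (NatTrans.rightOp F) Ind.yoneda) t)

/-- This cosmallness is what makes ω steps enough in the factorization below; it also decides the
counterexample. -/
lemma exists_proj_factorization {X : Tᵒᵖ ⥤ C} {c : C} (g : ofDiagram X ⟶ (simple C).obj c) :
    ∃ (t : T) (h : X.obj (op t) ⟶ c), proj X t ≫ (simple C).map h = g := by
  obtain ⟨t, h, hh⟩ := Ind.exists_yoneda_map_ι (K := X.rightOp) (c := op c) g.unop
  exact ⟨t, h.unop, Quiver.Hom.unop_inj hh⟩

lemma exists_iso_ofDiagram (Y : ProCat C) : ∃ (T : Type u) (_ : PartialOrder T) (_ : Nonempty T)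
    (_ : IsDirectedOrder T) (X : Tᵒᵖ ⥤ C), Nonempty (Y ≅ ofDiagram X) := by
  let P := Ind.presentation Y.unop
  obtain ⟨T, _, _, _, G, _⟩ := IsFiltered.exists_directed P.I
  let X : Tᵒᵖ ⥤ C := (G ⋙ P.F).leftOp
  have e : X.rightOp ⋙ Ind.yoneda ≅ G ⋙ P.F ⋙ Ind.yoneda := Iso.refl _
  exact ⟨T, _, inferInstance, inferInstance, X, ⟨((HasColimit.isoOfNatIso e ≪≫
    Functor.Final.colimitIso G (P.F ⋙ Ind.yoneda)) ≪≫
      Ind.colimitPresentationCompYoneda Y.unop).op⟩⟩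

lemma exists_iso_reindex {S : Type u} [PartialOrder S] [Nonempty S] [IsDirectedOrder S]
    (X : Tᵒᵖ ⥤ C) (g : S →o T) (hg : ∀ t, ∃ s, t ≤ g s) :
    ∃ e : ofDiagram X ≅ ofDiagram (g.monotone.functor.op ⋙ X),
      ∀ s, e.hom ≫ proj (g.monotone.functor.op ⋙ X) s = proj X (g s) := by
  obtain ⟨a, ha⟩ := exists_lift (X := g.monotone.functor.op ⋙ X) (fun s => proj X (g s))
    (fun s t h => proj_map X (g.monotone h))
  choose σ hσ using hg
  obtain ⟨b, hb⟩ := exists_lift (X := X)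
    (fun t => proj (g.monotone.functor.op ⋙ X) (σ t) ≫ (simple C).map (X.map (homOfLE (hσ t)).op)) (by
      intro s t h
      obtain ⟨r, hr₁, hr₂⟩ := exists_ge_ge (σ s) (σ t)
      rw [← proj_map _ hr₁, ← proj_map _ hr₂]
      simp only [Category.assoc, ← Functor.map_comp]
      congr 2
      dsimp
      rw [← Functor.map_comp, ← Functor.map_comp, ← Functor.map_comp]
      rfl)
  refine ⟨⟨a, b, hom_ext fun t => ?_, hom_ext fun s => ?_⟩, ha⟩
  · rw [Category.assoc, hb, reassoc_of% ha, Category.id_comp]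
    exact proj_map X _
  · rw [Category.assoc, ha, Category.id_comp]
    refine (hb (g s)).trans ?_
    obtain ⟨r, hr₁, hr₂⟩ := exists_ge_ge (σ (g s)) s
    rw [← proj_map _ hr₁, ← proj_map _ hr₂]
    simp only [Category.assoc, ← Functor.map_comp]
    congr 2
    dsimp
    rw [← Functor.map_comp]
    rfl

end

end ProCat

end

/-! ### Relative matching objects, and stages between two diagrams -/

section

section

variable {T : Type w} [PartialOrder T] [CofinitePoset T] {C : Type u} [Category.{v} C]
  [HasFiniteLimits C] {X Y : Tᵒᵖ ⥤ C} (F : X ⟶ Y) {t : T}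

instance {D : Type*} [Category* D] (G : C ⥤ D) [PreservesFiniteLimits G] : PreservesLimitsOfShape (Set.Iio t)ᵒᵖ G :=
  haveI : Fintype (Set.Iio t) := Fintype.ofFinite _
  inferInstance

/-- The projection from the target of the relative matching map to the lower terms. -/
noncomputable def relativeMatchingProj {s : T} (h : s < t) :
    pullback (toLimBelow Y t) (limBelowMap F t) ⟶ X.obj (op s) :=
  pullback.snd _ _ ≫ limit.π (belowDiagram X t) (op ⟨s, h⟩)

lemma relativeMatchingMap_fst :
    relativeMatchingMap F t ≫ pullback.fst _ _ = F.app (op t) :=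
  pullback.lift_fst _ _ _

lemma relativeMatchingMap_proj {s : T} (h : s < t) :
    relativeMatchingMap F t ≫ relativeMatchingProj F h = X.map (homOfLE h.le).op :=
  (pullback.lift_snd_assoc _ _ _ _).trans (toLimBelow_π X t _)

lemma relativeMatchingProj_map {r s : T} (h : r ≤ s) (hs : s < t) :
    relativeMatchingProj F hs ≫ X.map (homOfLE h).op = relativeMatchingProj F (h.trans_lt hs) :=
  (Category.assoc _ _ _).trans (congr_arg _ (limit.w (belowDiagram X t)
    (homOfLE h : (⟨r, h.trans_lt hs⟩ : Set.Iio t) ⟶ ⟨s, hs⟩).op))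

lemma relativeMatchingProj_app {s : T} (h : s < t) :
    relativeMatchingProj F h ≫ F.app (op s) =
      pullback.fst (toLimBelow Y t) (limBelowMap F t) ≫ Y.map (homOfLE h.le).op := by
  have h₁ : limBelowMap F t ≫ limit.π (belowDiagram Y t) (op ⟨s, h⟩) =
    limit.π (belowDiagram X t) (op ⟨s, h⟩) ≫ F.app (op s) := limMap_π _ _
  have h₂ : toLimBelow Y t ≫ limit.π (belowDiagram Y t) (op ⟨s, h⟩) =
    Y.map (homOfLE h.le).op := toLimBelow_π _ _ _
  refine (Category.assoc _ _ _).trans ((congr_arg (pullback.snd _ _ ≫ ·) h₁).symm.trans ?_)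
  refine (Category.assoc _ _ _).symm.trans ?_
  refine (congr_arg (· ≫ limit.π (belowDiagram Y t) (op ⟨s, h⟩)) pullback.condition).symm.trans ?_
  exact (Category.assoc _ _ _).trans (congr_arg (pullback.fst _ _ ≫ ·) h₂)

variable {D : Type*} [Category* D] (G : C ⥤ D) [PreservesFiniteLimits G]

variable {F} in
lemma relativeMatching_hom_ext {V : D}
    {f g : V ⟶ G.obj (pullback (toLimBelow Y t) (limBelowMap F t))}
    (h : f ≫ G.map (pullback.fst _ _) = g ≫ G.map (pullback.fst _ _))
    (h' : ∀ s (hs : s < t), f ≫ G.map (relativeMatchingProj F hs) =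
      g ≫ G.map (relativeMatchingProj F hs)) : f = g := by
  refine ((IsPullback.of_hasPullback (toLimBelow Y t) (limBelowMap F t)).map G).hom_ext h
    ((isLimitOfPreserves G (limit.isLimit (belowDiagram X t))).hom_ext fun s => ?_)
  have := h' s.unop.1 s.unop.2
  have e : G.map (relativeMatchingProj F s.unop.2) = G.map (pullback.snd _ _) ≫
    G.map (limit.π (belowDiagram X t) s) := G.map_comp _ _
  exact ((Category.assoc _ _ _).trans (congr_arg (f ≫ ·) e.symm)).trans
    (this.trans ((congr_arg (g ≫ ·) e).trans (Category.assoc _ _ _).symm))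

/-- The universal property is stated after a functor `G` so that it serves both in `C`, with `𝟭 C`,
and among pro-objects, with `simple C`. -/
lemma exists_relativeMatching_lift {V : D} (y : V ⟶ G.obj (Y.obj (op t)))
    (x : ∀ s : T, s < t → (V ⟶ G.obj (X.obj (op s))))
    (hx : ∀ ⦃r s⦄ (h : r ≤ s) (hs : s < t),
      x s hs ≫ G.map (X.map (homOfLE h).op) = x r (h.trans_lt hs))
    (hxy : ∀ ⦃s⦄ (h : s < t), x s h ≫ G.map (F.app (op s)) = y ≫ G.map (Y.map (homOfLE h.le).op)) :
    ∃ l : V ⟶ G.obj (pullback (toLimBelow Y t) (limBelowMap F t)),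
      l ≫ G.map (pullback.fst _ _) = y ∧
        ∀ s (hs : s < t), l ≫ G.map (relativeMatchingProj F hs) = x s hs := by
  let hlX := isLimitOfPreserves G (limit.isLimit (belowDiagram X t))
  let hlY := isLimitOfPreserves G (limit.isLimit (belowDiagram Y t))
  let hp := (IsPullback.of_hasPullback (toLimBelow Y t) (limBelowMap F t)).map G
  let c : Cone (belowDiagram X t ⋙ G) :=
    { pt := V
      π :=
        { app s := x s.unop.1 s.unop.2
          naturality r s f := (Category.id_comp _).trans (hx (leOfHom f.unop) r.unop.2).symm } }
  let m : V ⟶ G.obj (limBelow X t) := hlX.lift c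
  have hm (s : (Set.Iio t)ᵒᵖ) : m ≫ G.map (limit.π (belowDiagram X t) s) = x s.unop.1 s.unop.2 :=
    hlX.fac c s
  have hY (s : (Set.Iio t)ᵒᵖ) : G.map (toLimBelow Y t) ≫ G.map (limit.π (belowDiagram Y t) s) =
      G.map (Y.map (homOfLE s.unop.2.le).op) := by
    rw [← Functor.map_comp, toLimBelow_π]
    rfl
  have hF (s : (Set.Iio t)ᵒᵖ) : G.map (limBelowMap F t) ≫
      G.map (limit.π (belowDiagram Y t) s) = G.map (limit.π (belowDiagram X t) s) ≫
        G.map (F.app (op s.unop.1)) := by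
    rw [← Functor.map_comp, limMap_π, Functor.map_comp]
    rfl
  refine ⟨hp.lift y m (hlY.hom_ext fun s => ?_), hp.lift_fst _ _ _, fun s hs => ?_⟩
  · refine (Category.assoc _ _ _).trans (Eq.trans ?_ (Category.assoc _ _ _).symm)
    refine (congr_arg _ (hY s)).trans (Eq.trans ?_ (congr_arg _ (hF s)).symm)
    refine (hxy s.unop.2).symm.trans (Eq.trans ?_ (Category.assoc _ _ _))
    exact congr_arg (· ≫ G.map (F.app (op s.unop.1))) (hm s).symm
  · have e : G.map (relativeMatchingProj F hs) = G.map (pullback.snd _ _) ≫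
      G.map (limit.π (belowDiagram X t) (op ⟨s, hs⟩)) := G.map_comp _ _
    rw [e]
    refine (Category.assoc _ _ _).symm.trans ?_
    exact (congr_arg (· ≫ G.map (limit.π (belowDiagram X t) (op ⟨s, hs⟩)))
      (hp.lift_snd _ _ _)).trans (hm _)

end

namespace ProCat

section

variable {C : Type u} [SmallCategory C] [HasFiniteLimits C]
  {T : Type u} [PartialOrder T] [Nonempty T] [IsDirectedOrder T] {X Y : Tᵒᵖ ⥤ C}

/-- The limit of `Y` together with the part of `X` that is indexed by a subset `D`. -/
structure Stage (F : X ⟶ Y) (D : Set T) where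
  /-- the object -/
  pt : ProCat C
  /-- the projection to the limit of `Y` -/
  toY : pt ⟶ ofDiagram Y
  /-- the projections to the terms of `X` -/
  toX (s : D) : pt ⟶ (simple C).obj (X.obj (op s.1))
  toX_map ⦃s t : D⦄ (h : s.1 ≤ t.1) : toX t ≫ (simple C).map (X.map (homOfLE h).op) = toX s
  toX_app (s : D) : toX s ≫ (simple C).map (F.app (op s.1)) = toY ≫ proj Y s
  exists_lift {V : ProCat C} (y : V ⟶ ofDiagram Y) (x : ∀ s : D, V ⟶ (simple C).obj (X.obj (op s.1)))
    (hx : ∀ ⦃s t : D⦄ (h : s.1 ≤ t.1), x t ≫ (simple C).map (X.map (homOfLE h).op) = x s)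
    (hxy : ∀ s, x s ≫ (simple C).map (F.app (op s.1)) = y ≫ proj Y s) :
    ∃ l : V ⟶ pt, l ≫ toY = y ∧ ∀ s, l ≫ toX s = x s
  hom_ext {V : ProCat C} {f g : V ⟶ pt} (h : f ≫ toY = g ≫ toY) (h' : ∀ s, f ≫ toX s = g ≫ toX s) :
    f = g

lemma exists_limit (X : Tᵒᵖ ⥤ C) (D : Set T) :
    ∃ (L : ProCat C) (p : ∀ s : D, L ⟶ (simple C).obj (X.obj (op s.1))),
      (∀ ⦃s t : D⦄ (h : s.1 ≤ t.1), p t ≫ (simple C).map (X.map (homOfLE h).op) = p s) ∧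
      (∀ {V : ProCat C} (x : ∀ s : D, V ⟶ (simple C).obj (X.obj (op s.1)))
        (_ : ∀ ⦃s t : D⦄ (h : s.1 ≤ t.1), x t ≫ (simple C).map (X.map (homOfLE h).op) = x s),
        ∃ l, ∀ s, l ≫ p s = x s) ∧
      ∀ {V : ProCat C} {f g : V ⟶ L}, (∀ s, f ≫ p s = g ≫ p s) → f = g := by
  let i : D ⥤ T := Monotone.functor (f := Subtype.val) (fun _ _ h => h)
  let K : Dᵒᵖ ⥤ ProCat C := (i.op ⋙ X) ⋙ simple C
  refine ⟨limit K, fun s => limit.π K (op s),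
    fun s t h => limit.w K (homOfLE h : s ⟶ t).op, fun {V} x hx => ?_,
    fun h => limit.hom_ext fun s => h s.unop⟩
  let d : Cone K :=
    { pt := V
      π :=
        { app s := x s.unop
          naturality s t h := (Category.id_comp _).trans (hx (leOfHom h.unop)).symm } }
  exact ⟨limit.lift K d, fun s => limit.lift_π d (op s)⟩

instance nonempty_stage (F : X ⟶ Y) (D : Set T) : Nonempty (Stage F D) := by
  obtain ⟨L, p, hp, hp', hp''⟩ := exists_limit X D
  obtain ⟨L', p', hq, hq', hq''⟩ := exists_limit Y D
  obtain ⟨c, hc⟩ := hq' (fun s => proj Y s.1) (fun s t h => proj_map Y h)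
  obtain ⟨a, ha⟩ := hq' (fun s => p s ≫ (simple C).map (F.app (op s.1))) (fun s t h => by
    rw [← hp h, Category.assoc, Category.assoc, ← Functor.map_comp, ← Functor.map_comp,
      F.naturality])
  exact ⟨
    { pt := pullback c a
      toY := pullback.fst _ _
      toX s := pullback.snd _ _ ≫ p s
      toX_map s t h := by rw [Category.assoc, hp h]
      toX_app s := by rw [Category.assoc, ← ha, ← pullback.condition_assoc, hc]
      exists_lift {V} y x hx hxy := by
        obtain ⟨l, hl⟩ := hp' x hx
        refine ⟨pullback.lift y l (hq'' fun s => ?_), pullback.lift_fst _ _ _, fun s => ?_⟩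
        · rw [Category.assoc, Category.assoc, hc, ha, reassoc_of% hl, hxy]
        · rw [pullback.lift_snd_assoc, hl]
      hom_ext h h' := pullback.hom_ext h (hp'' fun s => by simpa using h' s) }⟩

variable (F : X ⟶ Y)

/-- A choice of a stage. -/
noncomputable def stage (D : Set T) : Stage F D := Classical.arbitrary _

variable {F} in
lemma Stage.exists_restrict {D D' : Set T} (S : Stage F D) (S' : Stage F D') (h : D ⊆ D') :
    ∃ l : S'.pt ⟶ S.pt, l ≫ S.toY = S'.toY ∧ ∀ s : D, l ≫ S.toX s = S'.toX ⟨s, h s.2⟩ :=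
  S.exists_lift S'.toY (fun s => S'.toX ⟨s.1, h s.2⟩)
    (fun s t hst => S'.toX_map (s := ⟨s.1, h s.2⟩) (t := ⟨t.1, h t.2⟩) hst)
    (fun s => S'.toX_app ⟨s.1, h s.2⟩)

/-- The restriction of stages. -/
noncomputable def stageRestrict {D D' : Set T} (h : D ⊆ D') : (stage F D').pt ⟶ (stage F D).pt :=
  ((stage F D).exists_restrict (stage F D') h).choose

@[simp]
lemma stageRestrict_toY {D D' : Set T} (h : D ⊆ D') :
    stageRestrict F h ≫ (stage F D).toY = (stage F D').toY :=
  ((stage F D).exists_restrict (stage F D') h).choose_spec.1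

@[simp]
lemma stageRestrict_toX {D D' : Set T} (h : D ⊆ D') (s : D) :
    stageRestrict F h ≫ (stage F D).toX s = (stage F D').toX ⟨s, h s.2⟩ :=
  ((stage F D).exists_restrict (stage F D') h).choose_spec.2 s

@[simp]
lemma stageRestrict_comp {D D' D'' : Set T} (h : D ⊆ D') (h' : D' ⊆ D'') :
    stageRestrict F h' ≫ stageRestrict F h = stageRestrict F (h.trans h') :=
  (stage F D).hom_ext (by simp) (by simp)

@[simp]
lemma stageRestrict_refl {D : Set T} (h : D ⊆ D) : stageRestrict F h = 𝟙 _ :=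
  (stage F D).hom_ext (by simp) (by simp)

section

variable [CofinitePoset T]

/-- When everything below `t` is already in `D`, the conditions on a new map to `X_t` concern only
`Y_t` and the `X_s` with `s < t`: they amount to one equality of maps to the relative matching
object. As `D` is a lower set without `t`, there are no conditions from indices above `t`. -/
lemma isPullback_stageRestrict {D D' : Set T} (h : D ⊆ D') {t : T} (ht : t ∈ D') (ht' : t ∉ D)
    (hD' : ∀ s ∈ D', s ∈ D ∨ s = t) (hD : ∀ ⦃r s⦄, r ≤ s → s ∈ D → r ∈ D)
    (hDt : ∀ s < t, s ∈ D) :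
    ∃ b, IsPullback ((stage F D').toX ⟨t, ht⟩) (stageRestrict F h)
      ((simple C).map (relativeMatchingMap F t)) b := by
  obtain ⟨b, hb₁, hb₂⟩ := exists_relativeMatching_lift F (t := t) (simple C)
    ((stage F D).toY ≫ proj Y t) (fun s hs => (stage F D).toX ⟨s, hDt s hs⟩)
    (fun r s h hs => (stage F D).toX_map (s := ⟨r, _⟩) (t := ⟨s, _⟩) h)
    (fun s hs => by rw [(stage F D).toX_app, Category.assoc, proj_map])
  have w {V : ProCat C} (x : V ⟶ (simple C).obj (X.obj (op t))) (y : V ⟶ (stage F D).pt) :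
      x ≫ (simple C).map (relativeMatchingMap F t) = y ≫ b ↔
        x ≫ (simple C).map (F.app (op t)) = y ≫ (stage F D).toY ≫ proj Y t ∧
        ∀ (s : T) (hs : s < t), x ≫ (simple C).map (X.map (homOfLE hs.le).op) =
          y ≫ (stage F D).toX ⟨s, hDt s hs⟩ := by
    have h₁ : (simple C).map (relativeMatchingMap F t) ≫ (simple C).map (pullback.fst _ _) =
        (simple C).map (F.app (op t)) := by
      rw [← Functor.map_comp, relativeMatchingMap_fst]
    have h₂ (s) (hs : s < t) : (simple C).map (relativeMatchingMap F t) ≫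
        (simple C).map (relativeMatchingProj F hs) =
          (simple C).map (X.map (homOfLE hs.le).op) := by
      rw [← Functor.map_comp, relativeMatchingMap_proj]
    constructor
    · intro e
      refine ⟨by rw [← h₁, reassoc_of% e, hb₁], fun s hs => ?_⟩
      rw [← h₂ s hs, reassoc_of% e, hb₂]
    · rintro ⟨e₁, e₂⟩
      refine relativeMatching_hom_ext (simple C) ?_ fun s hs => ?_
      · rw [Category.assoc, h₁, Category.assoc, hb₁, e₁]
      · rw [Category.assoc, h₂, Category.assoc, hb₂, e₂ s hs]
  have hw : (stage F D').toX ⟨t, ht⟩ ≫ (simple C).map (relativeMatchingMap F t) =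
      stageRestrict F h ≫ b := by
    rw [w]
    refine ⟨?_, fun s hs => ?_⟩
    · rw [reassoc_of% stageRestrict_toY F h, (stage F D').toX_app]
    · rw [stageRestrict_toX]
      exact (stage F D').toX_map (s := ⟨s, h (hDt s hs)⟩) (t := ⟨t, ht⟩) hs.le
  have key {V : ProCat C} (x : V ⟶ (simple C).obj (X.obj (op t))) (y : V ⟶ (stage F D).pt)
      (e : x ≫ (simple C).map (relativeMatchingMap F t) = y ≫ b) :
      ∃ l, l ≫ (stage F D').toX ⟨t, ht⟩ = x ∧ l ≫ stageRestrict F h = y := by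
    classical
    rw [w] at e
    obtain ⟨z, hz₁, hz₂⟩ : ∃ z : ∀ s : D', V ⟶ (simple C).obj (X.obj (op s.1)),
        z ⟨t, ht⟩ = x ∧ ∀ s hs, z ⟨s, h hs⟩ = y ≫ (stage F D).toX ⟨s, hs⟩ := by
      refine ⟨fun s => if hs : s.1 = t then x ≫ (simple C).map (X.map (eqToHom (by rw [hs]))) else
        y ≫ (stage F D).toX ⟨s.1, (hD' _ s.2).resolve_right hs⟩, by simp, fun s hs => ?_⟩
      exact dif_neg (fun h' : s = t => ht' (h' ▸ hs))
    obtain ⟨l, hl₁, hl₂⟩ := (stage F D').exists_lift (y ≫ (stage F D).toY) z (by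
      rintro ⟨r, hr⟩ ⟨s, hs⟩ hrs
      replace hrs : r ≤ s := hrs
      obtain hs' | rfl := hD' s hs
      · rw [hz₂ s hs', hz₂ r (hD hrs hs'), Category.assoc]
        exact congr_arg _ ((stage F D).toX_map (s := ⟨r, hD hrs hs'⟩) (t := ⟨s, hs'⟩) hrs)
      · rw [hz₁]
        obtain rfl | hrs' := hrs.eq_or_lt
        · rw [hz₁]
          have : X.map (homOfLE (le_refl r)).op = 𝟙 _ := X.map_id _
          exact (congr_arg (x ≫ (simple C).map ·) this).trans (by simp)
        · rw [hz₂ r (hDt r hrs')]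
          exact e.2 r hrs') (by
      rintro ⟨s, hs⟩
      obtain hs' | rfl := hD' s hs
      · rw [hz₂ s hs', Category.assoc, Category.assoc]
        exact congr_arg _ ((stage F D).toX_app ⟨s, hs'⟩)
      · rw [hz₁, Category.assoc]
        exact e.1)
    refine ⟨l, (hl₂ _).trans hz₁, (stage F D).hom_ext (by simp [hl₁]) fun s => ?_⟩
    rw [Category.assoc, stageRestrict_toX, hl₂, hz₂ s.1 s.2]
  refine ⟨b, ⟨hw⟩, ⟨PullbackCone.IsLimit.mk _ (fun s => (key _ _ s.condition).choose)
    (fun s => (key _ _ s.condition).choose_spec.1) (fun s => (key _ _ s.condition).choose_spec.2)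
    (fun s m hm₁ hm₂ => (stage F D').hom_ext ?_ fun r => ?_)⟩⟩
  · rw [← stageRestrict_toY F h, reassoc_of% hm₂,
      reassoc_of% (key _ _ s.condition).choose_spec.2]
  · obtain hr | hr := hD' _ r.2
    · rw [← stageRestrict_toX F h ⟨r.1, hr⟩, reassoc_of% hm₂,
        reassoc_of% (key _ _ s.condition).choose_spec.2]
    · obtain ⟨r, hr'⟩ := r
      obtain rfl : r = t := hr
      rw [hm₁, (key _ _ s.condition).choose_spec.1]

end

end

end ProCat

end

/-! ### Special maps are cocell complexes -/

section

namespace ProCat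

section

variable {C : Type u} [SmallCategory C] [HasFiniteLimits C]
  {T : Type u} [PartialOrder T] [Nonempty T] [IsDirectedOrder T] {X Y : Tᵒᵖ ⥤ C} (F : X ⟶ Y)

section

variable {J : Type u} [LinearOrder J]

lemma stage_hom_ext_of_subset {D : J → Set T} {E : Set T} (hD : ∀ j, D j ⊆ E)
    (hE : ∀ s ∈ E, ∃ j, s ∈ D j) [Nonempty J] {V : ProCat C} {f g : V ⟶ (stage F E).pt}
    (h : ∀ j, f ≫ stageRestrict F (hD j) = g ≫ stageRestrict F (hD j)) : f = g := by
  refine (stage F E).hom_ext ?_ fun s => ?_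
  · rw [← stageRestrict_toY F (hD (Classical.arbitrary J)), reassoc_of% h]
  · obtain ⟨j, hj⟩ := hE s.1 s.2
    rw [← stageRestrict_toX F (hD j) ⟨s.1, hj⟩, reassoc_of% h]

lemma exists_stage_lift {D : J → Set T} (hD : Monotone D) {E : Set T} (hD' : ∀ j, D j ⊆ E)
    (hE : ∀ s ∈ E, ∃ j, s ∈ D j) [Nonempty J] {V : ProCat C} (v : ∀ j, V ⟶ (stage F (D j)).pt)
    (hv : ∀ ⦃i j⦄ (h : i ≤ j), v j ≫ stageRestrict F (hD h) = v i) :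
    ∃ l : V ⟶ (stage F E).pt, ∀ j, l ≫ stageRestrict F (hD' j) = v j := by
  choose k hk using hE
  have hY {i j : J} : v i ≫ (stage F (D i)).toY = v j ≫ (stage F (D j)).toY := by
    wlog h : i ≤ j generalizing i j
    · exact (this (le_of_not_ge h)).symm
    · rw [← hv h, Category.assoc, stageRestrict_toY]
  have hX {i j : J} {s : T} (hi : s ∈ D i) (hj : s ∈ D j) :
      v i ≫ (stage F (D i)).toX ⟨s, hi⟩ = v j ≫ (stage F (D j)).toX ⟨s, hj⟩ := by
    wlog h : i ≤ j generalizing i j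
    · exact (this hj hi (le_of_not_ge h)).symm
    · rw [← hv h, Category.assoc, stageRestrict_toX]
  obtain ⟨l, hl, hl'⟩ := (stage F E).exists_lift
    (v (Classical.arbitrary J) ≫ (stage F (D (Classical.arbitrary J))).toY)
    (fun s => v (k s.1 s.2) ≫ (stage F (D (k s.1 s.2))).toX ⟨s.1, hk s.1 s.2⟩)
    (by
      rintro ⟨s, hs⟩ ⟨t, ht⟩ h
      have h₁ : s ∈ D (max (k s hs) (k t ht)) := hD (le_max_left _ _) (hk s hs)
      have h₂ : t ∈ D (max (k s hs) (k t ht)) := hD (le_max_right _ _) (hk t ht)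
      dsimp only
      rw [hX (hk s hs) h₁, hX (hk t ht) h₂, Category.assoc]
      exact congr_arg _ ((stage F (D _)).toX_map (s := ⟨s, h₁⟩) (t := ⟨t, h₂⟩) h))
    (fun s => by
      rw [Category.assoc, (stage F _).toX_app, ← Category.assoc, hY])
  refine ⟨l, fun j => (stage F (D j)).hom_ext ?_ fun s => ?_⟩
  · rw [Category.assoc, stageRestrict_toY, hl, hY]
  · rw [Category.assoc, stageRestrict_toX, hl']
    exact hX _ _

end

section

variable {J : Type u} [LinearOrder J] {D : J → Set T} (hD : Monotone D)

/-- The tower of the stages of an increasing family of subsets. -/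
noncomputable def stageTower : J ⥤ (ProCat C)ᵒᵖ where
  obj j := op (stage F (D j)).pt
  map h := (stageRestrict F (hD (leOfHom h))).op
  map_id j := by simp
  map_comp f g := by simp [← op_comp]

/-- The cocone of a tower of stages. -/
noncomputable def stageCocone {E : Set T} (hE : ∀ j, D j ⊆ E) : Cocone (stageTower F hD) where
  pt := op (stage F E).pt
  ι :=
    { app j := (stageRestrict F (hE j)).op
      naturality _ j h := Quiver.Hom.unop_inj
        ((stageRestrict_comp F (hD (leOfHom h)) (hE j)).trans (Category.id_comp _).symm) }

lemma nonempty_isColimit_stageCocone [Nonempty J] {E : Set T} (hE : ∀ j, D j ⊆ E)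
    (hE' : ∀ s ∈ E, ∃ j, s ∈ D j) : Nonempty (IsColimit (stageCocone F hD hE)) := by
  have key (s : Cocone (stageTower F hD)) := exists_stage_lift F hD hE hE' (V := s.pt.unop)
    (fun j => (s.ι.app j).unop) (fun i j h => Quiver.Hom.op_inj (s.w (homOfLE h)))
  exact ⟨{
    desc s := (key s).choose.op
    fac s j := Quiver.Hom.unop_inj ((key s).choose_spec j)
    uniq s m hm := Quiver.Hom.unop_inj (stage_hom_ext_of_subset F hE hE' fun j =>
      Eq.trans (congr_arg Quiver.Hom.unop (hm j)) ((key s).choose_spec j).symm) }⟩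

lemma isWellOrderContinuous_stageTower
    (h : ∀ m : J, Order.IsSuccLimit m → ∀ s ∈ D m, ∃ j < m, s ∈ D j) :
    (stageTower F hD).IsWellOrderContinuous where
  nonempty_isColimit m hm := by
    have : Nonempty (Set.Iio m) := by
      obtain ⟨j, hj⟩ := not_isMin_iff.1 hm.not_isMin
      exact ⟨⟨j, hj⟩⟩
    have hD' : Monotone (fun j : Set.Iio m => D j.1) := fun _ _ h => hD h
    obtain ⟨h'⟩ := nonempty_isColimit_stageCocone F hD' (E := D m) (fun j => hD j.2.le)
      (fun s hs => by obtain ⟨j, hj, hj'⟩ := h m hm s hs; exact ⟨⟨j, hj⟩, hj'⟩)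
    exact ⟨h'⟩

end

variable {M : MorphismProperty C}

lemma isIso_stage_toY_empty : IsIso (stage F ∅).toY := by
  obtain ⟨l, hl, -⟩ := (stage F ∅).exists_lift (𝟙 _) (fun s => s.2.elim) (fun s => s.2.elim)
    (fun s => s.2.elim)
  exact ⟨l, (stage F ∅).hom_ext (by simp [hl]) (fun s => s.2.elim), hl⟩

lemma exists_iso_stage_univ : ∃ e : (stage F Set.univ).pt ≅ ofDiagram X,
    e.hom ≫ ofNatTrans F = (stage F Set.univ).toY := by
  obtain ⟨a, ha⟩ := exists_lift (X := X) (fun s => (stage F Set.univ).toX ⟨s, trivial⟩)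
    (fun s t h => (stage F Set.univ).toX_map (s := ⟨s, trivial⟩) (t := ⟨t, trivial⟩) h)
  obtain ⟨b, hb, hb'⟩ := (stage F Set.univ).exists_lift (ofNatTrans F) (fun s => proj X s.1)
    (fun s t h => proj_map X h) (fun s => (ofNatTrans_proj F s.1).symm)
  have hab : a ≫ ofNatTrans F = (stage F Set.univ).toY := hom_ext fun t => by
    rw [Category.assoc, ofNatTrans_proj, reassoc_of% ha, (stage F Set.univ).toX_app]
  refine ⟨⟨a, b, (stage F Set.univ).hom_ext ?_ fun s => ?_, hom_ext fun t => ?_⟩, hab⟩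
  · simp [hb, hab]
  · rw [Category.assoc, hb', ha, Category.id_comp]
  · rw [Category.assoc, ha, hb', Category.id_comp]

/-- A cofinite poset is well-founded, so its order extends to a well-order. Along it each successor
step adjoins one index `t`, by a base change of the relative matching map at `t`. -/
lemma cocell_ofNatTrans [CofinitePoset T] (hF : IsSpecialMap M F) :
    cocell.{u} (M.map (simple C)) (ofNatTrans F) := by
  have : WellFoundedLT T := ⟨by
    refine Subrelation.wf (r := InvImage (· < ·) fun t : T => (Set.Iic t).ncard) (fun {s t} h => ?_)
      (InvImage.wf _ wellFounded_lt)
    exact Set.ncard_lt_ncard (Set.Iic_ssubset_Iic.2 h) (CofinitePoset.finite_Iic t)⟩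
  -- `D j` contains only the indices strictly before `j`; the added top provides the stage that
  -- contains all of `T`.
  let J := WithTop (WellOrderExtension T)
  let _ : SuccOrder J := SuccOrder.ofLinearWellFoundedLT J
  have : Nonempty J := ⟨⊤⟩
  let _ : OrderBot J := WellFoundedLT.toOrderBot J
  let φ (t : T) : J := (toWellOrderExtension t : WellOrderExtension T)
  have hφ {s t : T} (h : s < t) : φ s < φ t := WithTop.coe_lt_coe.2 (toWellOrderExtension_strictMono h)
  have hφ' {s t : T} (h : φ s = φ t) : s = t := toWellOrderExtension.injective (WithTop.coe_injective h)
  let D (j : J) : Set T := {t | φ t < j}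
  have hD : Monotone D := fun i j h t ht => lt_of_lt_of_le ht h
  have hD' (j) : D j ⊆ Set.univ := Set.subset_univ _
  have hcol := (nonempty_isColimit_stageCocone F hD hD'
    (fun s _ => ⟨⊤, WithTop.coe_lt_top _⟩)).some
  have hbot : D ⊥ = ∅ := Set.eq_empty_of_forall_notMem fun t (ht : φ t < ⊥) => not_lt_bot ht
  have : IsIso (stage F (D ⊥)).toY := by
    rw [hbot]
    exact isIso_stage_toY_empty F
  obtain ⟨e, he⟩ := exists_iso_stage_univ F
  refine MorphismProperty.transfiniteCompositionsOfShape_le_transfiniteCompositions _ J _ ⟨?_⟩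
  exact
    { F := stageTower F hD
      isoBot := (asIso (stage F (D ⊥)).toY).symm.op
      isWellOrderContinuous := isWellOrderContinuous_stageTower F hD fun m hm s hs =>
        ⟨Order.succ (φ s), hm.succ_lt hs, Order.lt_succ_of_not_isMax (not_isMax_of_lt (a := φ s) hs)⟩
      incl := (stageCocone F hD hD').ι ≫ (Functor.const _).map e.inv.op
      isColimit := IsColimit.ofIsoColimit hcol (Cocone.ext e.symm.op fun j => rfl)
      fac := Quiver.Hom.unop_inj (by
        change (e.inv ≫ stageRestrict F (hD' ⊥)) ≫ (stage F (D ⊥)).toY = ofNatTrans F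
        rw [Category.assoc, stageRestrict_toY, Iso.inv_comp_eq, he])
      map_mem j hj := by
        obtain ⟨t, rfl⟩ : ∃ t, φ t = j := by
          obtain ⟨w, hw⟩ := WithTop.ne_top_iff_exists.1 (fun h => hj (h ▸ isMax_top) : j ≠ ⊤)
          obtain ⟨t, rfl⟩ := toWellOrderExtension.surjective w
          exact ⟨t, hw⟩
        have h₁ (s) : s ∈ D (Order.succ (φ t)) ↔ s ∈ D (φ t) ∨ s = t := by
          refine (Order.lt_succ_iff_of_not_isMax hj).trans (le_iff_lt_or_eq.trans
            (or_congr Iff.rfl ⟨hφ', fun h => h ▸ rfl⟩))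
        obtain ⟨b, hb⟩ := isPullback_stageRestrict F (hD (Order.le_succ (φ t))) (t := t)
          ((h₁ t).2 (Or.inr rfl)) (lt_irrefl (φ t)) (fun s hs => (h₁ s).1 hs)
          (fun r s h hs => by
            obtain rfl | h := h.eq_or_lt
            · exact hs
            · exact lt_trans (hφ h) hs) (fun s hs => hφ hs)
        exact MorphismProperty.pullbacks_mk _ hb (MorphismProperty.map_mem_map _ _ _ (hF t)) }

instance : (cocell.{u} (M.map (simple C))).RespectsIso := by
  have : (MorphismProperty.transfiniteCompositions.{u}
      (M.map (simple C)).pullbacks.op).RespectsIso :=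
    MorphismProperty.RespectsIso.of_respects_arrow_iso _ fun f g e hf => by
      rw [MorphismProperty.transfiniteCompositions_iff] at hf ⊢
      obtain ⟨J, _, _, _, _, hf⟩ := hf
      exact ⟨J, _, _, _, _, (MorphismProperty.arrow_mk_iso_iff _ e).1 hf⟩
  exact MorphismProperty.RespectsIso.unop _

lemma spIso_le_cocell : spIso M ≤ cocell.{u} (M.map (simple C)) := by
  rintro A B f ⟨T, _, _, _, _, X, Y, F, hF, ⟨e⟩⟩
  exact (MorphismProperty.arrow_mk_iso_iff _ e).2 (cocell_ofNatTrans F hF)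

end

end ProCat

end

/-! ### The counterexample on the commutative square -/

section

lemma pullbacks_le_cocell {D : Type u} [Category.{v} D] (M : MorphismProperty D) :
    M.pullbacks ≤ cocell.{w} M := fun _ _ _ hf =>
  MorphismProperty.le_transfiniteCompositions.{w} M.pullbacks.op _ hf

namespace SquareCat

lemma isPullback_ac : IsPullback (homOfLE ⟨Bool.false_le _, le_rfl⟩ : a.{u} ⟶ b) ac bd
    (homOfLE ⟨Bool.le_true _, le_rfl⟩) :=
  ⟨⟨Subsingleton.elim _ _⟩, ⟨PullbackCone.IsLimit.mk _
    (fun s => homOfLE ⟨(leOfHom s.snd).1, (leOfHom s.fst).2⟩)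
    (fun _ => Subsingleton.elim _ _) (fun _ => Subsingleton.elim _ _)
    (fun _ _ _ _ => Subsingleton.elim _ _)⟩⟩

lemma retracts_cocell_simple_ac :
    (cocell.{u} (onlyBD.{u}.map (ProCat.simple SquareCat.{u}))).retracts
      ((ProCat.simple SquareCat.{u}).map ac) :=
  MorphismProperty.le_retracts _ _ (pullbacks_le_cocell _ _
    (MorphismProperty.pullbacks_mk _ (isPullback_ac.map (ProCat.simple SquareCat.{u}))
      (MorphismProperty.map_mem_map _ _ _ ⟨()⟩)))

/-- Each `X_t` is the source of a relative matching map, so it equals `b`. A retraction onto the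
simple object `a` factors through some `X_t`, but there is no map from `b` to `a`. -/
lemma not_retracts_spIso_simple_ac :
    ¬ (spIso onlyBD.{u}).retracts ((ProCat.simple SquareCat.{u}).map ac) := by
  rintro ⟨Z, W, g, r, T, _, _, _, _, X, Y, F, hF, ⟨e⟩⟩
  obtain ⟨t, h, -⟩ := ProCat.exists_proj_factorization (e.inv.left ≫ r.r.left)
  have hX : X.obj (op t) = b := by
    have key : ∀ {x y : SquareCat.{u}} (k : x ⟶ y), onlyBD k → x = b := by
      rintro _ _ _ ⟨⟩
      rfl
    exact key _ (hF t)
  have : (b : SquareCat.{u}) ≤ a := by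
    rw [← hX]
    exact leOfHom h
  exact absurd this.1 (by decide)

end SquareCat

end

/-! ### Finite fibre products of base changes -/

section

section

variable {T : Type w} [PartialOrder T] [CofinitePoset T] {C : Type u} [Category.{v} C]
  [HasFiniteLimits C] {X Y : Tᵒᵖ ⥤ C} {M : MorphismProperty C}

/-- An object `Q` with the universal property of the relative matching object may replace it.
Existence of maps to `Q` is needed only for the relative matching object itself, in the form of `l`.
-/
lemma mem_relativeMatchingMap [M.RespectsIso] (F : X ⟶ Y) {t : T} {Q : C} {ρ : X.obj (op t) ⟶ Q}
    (hρ : M ρ) (σ : Q ⟶ Y.obj (op t)) (τ : ∀ s : T, s < t → (Q ⟶ X.obj (op s)))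
    (hτ : ∀ ⦃r s⦄ (h : r ≤ s) (hs : s < t), τ s hs ≫ X.map (homOfLE h).op = τ r (h.trans_lt hs))
    (hτσ : ∀ ⦃s⦄ (h : s < t), τ s h ≫ F.app (op s) = σ ≫ Y.map (homOfLE h.le).op)
    (hρσ : ρ ≫ σ = F.app (op t)) (hρτ : ∀ s (h : s < t), ρ ≫ τ s h = X.map (homOfLE h.le).op)
    (l : pullback (toLimBelow Y t) (limBelowMap F t) ⟶ Q) (hlσ : l ≫ σ = pullback.fst _ _)
    (hlτ : ∀ s (h : s < t), l ≫ τ s h = relativeMatchingProj F h)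
    (hom_ext : ∀ {V : C} {f g : V ⟶ Q}, f ≫ σ = g ≫ σ → (∀ s hs, f ≫ τ s hs = g ≫ τ s hs) → f = g) :
    M (relativeMatchingMap F t) := by
  obtain ⟨l', hl'σ, hl'τ⟩ := exists_relativeMatching_lift F (𝟭 C) σ τ hτ hτσ
  dsimp only [Functor.id_obj, Functor.id_map] at l' hl'σ hl'τ
  have h₁ : l ≫ l' = 𝟙 _ := relativeMatching_hom_ext (𝟭 C)
    (by simp [hl'σ, hlσ]) (fun s hs => by simp [hl'τ, hlτ])
  have h₂ : l' ≫ l = 𝟙 _ := hom_ext (by simp [hl'σ, hlσ]) (fun s hs => by simp [hl'τ, hlτ])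
  have h₃ : relativeMatchingMap F t = ρ ≫ l' := relativeMatching_hom_ext (𝟭 C)
    (by simp [hl'σ, relativeMatchingMap_fst, hρσ])
    (fun s hs => by simp [hl'τ, relativeMatchingMap_proj, hρτ])
  have : IsIso l' := ⟨l, h₂, h₁⟩
  rw [h₃]
  exact MorphismProperty.RespectsIso.postcomp M l' ρ hρ

end

namespace ProCat

/-- The fibre product over `E` of the pullbacks of a family of morphisms `m s`, `s ∈ K`. -/
structure MultiPullback {C : Type u} [SmallCategory C] {S : Type u} {c d : S → C}
    (m : ∀ s, c s ⟶ d s) {p : S → Prop} {E : C} (a : ∀ s, p s → (E ⟶ d s)) (K : Set S)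
    (hK : ∀ s ∈ K, p s) where
  /-- the object -/
  pt : C
  /-- the projection to the base -/
  toBase : pt ⟶ E
  /-- the projections to the sources of the family -/
  toSrc (s : S) (hs : s ∈ K) : pt ⟶ c s
  toSrc_comp (s : S) (hs : s ∈ K) : toSrc s hs ≫ m s = toBase ≫ a s (hK s hs)
  exists_lift {V : ProCat C} (y : V ⟶ (simple C).obj E) (x : ∀ s ∈ K, V ⟶ (simple C).obj (c s))
    (hx : ∀ s hs, x s hs ≫ (simple C).map (m s) = y ≫ (simple C).map (a s (hK s hs))) :
    ∃ l : V ⟶ (simple C).obj pt, l ≫ (simple C).map toBase = y ∧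
      ∀ s hs, l ≫ (simple C).map (toSrc s hs) = x s hs
  hom_ext {V : ProCat C} {f g : V ⟶ (simple C).obj pt}
    (h : f ≫ (simple C).map toBase = g ≫ (simple C).map toBase)
    (h' : ∀ s hs, f ≫ (simple C).map (toSrc s hs) = g ≫ (simple C).map (toSrc s hs)) : f = g

namespace MultiPullback

variable {C : Type u} [SmallCategory C] {S : Type u} {c d : S → C}
    {m : ∀ s, c s ⟶ d s} {p : S → Prop} {E : C} {a : ∀ s, p s → (E ⟶ d s)} {K : Set S}
    {hK : ∀ s ∈ K, p s}

lemma exists_lift' (P : MultiPullback m a K hK) {V : C} (y : V ⟶ E) (x : ∀ s ∈ K, V ⟶ c s)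
    (hx : ∀ s hs, x s hs ≫ m s = y ≫ a s (hK s hs)) :
    ∃ l : V ⟶ P.pt, l ≫ P.toBase = y ∧ ∀ s hs, l ≫ P.toSrc s hs = x s hs := by
  obtain ⟨l, h, h'⟩ := P.exists_lift ((simple C).map y) (fun s hs => (simple C).map (x s hs))
    (fun s hs => by rw [← Functor.map_comp, ← Functor.map_comp, hx])
  obtain ⟨l, rfl⟩ := (simple C).map_surjective l
  exact ⟨l, (simple C).map_injective (by simpa using h),
    fun s hs => (simple C).map_injective (by simpa using h' s hs)⟩

lemma hom_ext' (P : MultiPullback m a K hK) {V : C} {f g : V ⟶ P.pt}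
    (h : f ≫ P.toBase = g ≫ P.toBase) (h' : ∀ s hs, f ≫ P.toSrc s hs = g ≫ P.toSrc s hs) :
    f = g :=
  (simple C).map_injective (P.hom_ext (by simp only [← Functor.map_comp, h])
    (fun s hs => by simp only [← Functor.map_comp, h']))

variable (m a) in
/-- The fibre product of the empty family. -/
def empty : MultiPullback m a ∅ (fun _ h => h.elim) where
  pt := E
  toBase := 𝟙 E
  toSrc s hs := hs.elim
  toSrc_comp s hs := hs.elim
  exists_lift y _ _ := ⟨y, by simp, fun s hs => hs.elim⟩
  hom_ext h _ := by simpa using h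

lemma exists_insert [HasFiniteLimits C] (P : MultiPullback m a K hK) {t : S} (ht : t ∉ K)
    (hK' : ∀ s ∈ insert t K, p s) :
    ∃ (P' : MultiPullback m a (insert t K) hK') (r : P'.pt ⟶ P.pt) (b : P.pt ⟶ d t),
      r ≫ P.toBase = P'.toBase ∧
      (∀ s hs, r ≫ P.toSrc s hs = P'.toSrc s (Set.mem_insert_of_mem t hs)) ∧
      IsPullback (P'.toSrc t (Set.mem_insert t K)) r (m t) b := by
  classical
  let b := P.toBase ≫ a t (hK' t (Set.mem_insert t K))
  have hp := (IsPullback.of_hasPullback (m t) b)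
  have hp' := hp.map (simple C)
  obtain ⟨x, hx, hx'⟩ : ∃ x : ∀ s ∈ insert t K, pullback (m t) b ⟶ c s,
      x t (Set.mem_insert t K) = pullback.fst _ _ ∧
        ∀ s hs, x s (Set.mem_insert_of_mem t hs) = pullback.snd _ _ ≫ P.toSrc s hs := by
    refine ⟨fun s hs => if h : s = t then pullback.fst _ _ ≫ eqToHom (by rw [h]) else
      pullback.snd _ _ ≫ P.toSrc s (hs.resolve_left h), by simp, fun s hs => ?_⟩
    exact dif_neg (fun h : s = t => ht (h ▸ hs))
  refine ⟨
    { pt := pullback (m t) b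
      toBase := pullback.snd _ _ ≫ P.toBase
      toSrc := x
      toSrc_comp := ?_
      exists_lift := ?_
      hom_ext := ?_ }, pullback.snd _ _, b, rfl, fun s hs => (hx' s hs).symm, hx ▸ hp⟩
  · intro s hs
    obtain rfl | hs := hs
    · rw [hx, pullback.condition, Category.assoc]
    · rw [hx' s hs, Category.assoc, P.toSrc_comp, Category.assoc]
  · intro V y z hz
    obtain ⟨l, hl, hl'⟩ := P.exists_lift y (fun s hs => z s (Set.mem_insert_of_mem t hs))
      (fun s hs => hz _ _)
    let l' := hp'.lift (z t (Set.mem_insert t K)) l (by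
      rw [hz, Functor.map_comp, reassoc_of% hl])
    have h₁ : l' ≫ (simple C).map (pullback.fst _ _) = z t (Set.mem_insert t K) := hp'.lift_fst _ _ _
    have h₂ : l' ≫ (simple C).map (pullback.snd _ _) = l := hp'.lift_snd _ _ _
    refine ⟨l', by rw [Functor.map_comp, reassoc_of% h₂, hl], fun s hs => ?_⟩
    obtain rfl | hs := hs
    · rw [hx, h₁]
    · rw [hx' s hs, Functor.map_comp, reassoc_of% h₂, hl']
  · intro V f g h h'
    refine hp'.hom_ext ?_ (P.hom_ext ?_ fun s hs => ?_)
    · simpa only [hx] using h' t (Set.mem_insert t K)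
    · simpa only [Functor.map_comp, Category.assoc] using h
    · simpa only [hx' s hs, Functor.map_comp, Category.assoc] using
        h' s (Set.mem_insert_of_mem t hs)

/-- Adding one index is a base change of one `m t`, so finiteness of `L` and the closure properties
put `r` in `M`. Starting from `empty`, this also constructs the fibre products. -/
lemma exists_union [HasFiniteLimits C] (M : MorphismProperty C) [M.IsMultiplicative]
    [M.IsStableUnderBaseChange] (hm : ∀ s, M (m s)) (P : MultiPullback m a K hK) {L : Set S}
    (hL : L.Finite) {K' : Set S} (hKL : K' = K ∪ L) (hK' : ∀ s ∈ K', p s) :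
    ∃ (P' : MultiPullback m a K' hK') (r : P'.pt ⟶ P.pt) (hKK' : K ⊆ K'),
      M r ∧ r ≫ P.toBase = P'.toBase ∧ ∀ s hs, r ≫ P.toSrc s hs = P'.toSrc s (hKK' hs) := by
  induction L, hL using Set.Finite.induction_on generalizing K' with
  | empty =>
    obtain rfl : K' = K := by simpa using hKL
    exact ⟨P, 𝟙 _, subset_rfl, M.id_mem _, by simp, by simp⟩
  | @insert t L _ _ ih =>
    by_cases ht : t ∈ K ∪ L
    · exact ih (by rw [hKL, Set.union_insert, Set.insert_eq_of_mem ht]) hK'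
    · obtain rfl : K' = insert t (K ∪ L) := by rw [hKL, Set.union_insert]
      obtain ⟨P', r, h, hr, hr₁, hr₂⟩ := ih rfl (fun s hs => hK' s (Set.mem_insert_of_mem t hs))
      obtain ⟨P'', r', b, hr₁', hr₂', hb⟩ := P'.exists_insert ht hK'
      exact ⟨P'', r' ≫ r, h.trans (Set.subset_insert _ _),
        M.comp_mem _ _ (M.of_isPullback hb (hm t)) hr, by rw [Category.assoc, hr₁, hr₁'],
        fun s hs => by rw [Category.assoc, hr₂, hr₂']⟩

end MultiPullback

end ProCat

end

/-! ### One step of the cosmall object argument -/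

section

namespace ProCat

/-- The term `e'_t` is the fibre product over `e_t` of the base changes of all `m s` with `N s ≤ t`,
finitely many by `hN`. The relative matching object at `t` is the same product over `N s < t`, so
the relative matching map only adds the indices with `N s = t`. -/
lemma exists_special_lift {C : Type u} [SmallCategory C] [HasFiniteLimits C]
    (M : MorphismProperty C) [M.IsMultiplicative] [M.IsStableUnderBaseChange]
    {T : Type u} [PartialOrder T] [CofinitePoset T] [Nonempty T] [IsDirectedOrder T]
    (e : Tᵒᵖ ⥤ C) {S : Type u} {c d : S → C} {m : ∀ s, c s ⟶ d s} (hm : ∀ s, M (m s))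
    (N : S → T) (hN : ∀ t, {s | N s ≤ t}.Finite) (ψ : ∀ s, e.obj (op (N s)) ⟶ d s) :
    ∃ (e' : Tᵒᵖ ⥤ C) (p : e' ⟶ e) (q : ∀ s, e'.obj (op (N s)) ⟶ c s),
      IsSpecialMap M p ∧ (∀ s, q s ≫ m s = p.app (op (N s)) ≫ ψ s) ∧
      ∀ {V : ProCat C} (ξ : V ⟶ ofDiagram e) (x : ∀ s, V ⟶ (simple C).obj (c s)),
        (∀ s, x s ≫ (simple C).map (m s) = ξ ≫ proj e (N s) ≫ (simple C).map (ψ s)) →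
        ∃ ξ' : V ⟶ ofDiagram e', ξ' ≫ ofNatTrans p = ξ ∧
          ∀ s, ξ' ≫ proj e' (N s) ≫ (simple C).map (q s) = x s := by
  let a (t : T) (s : S) (h : N s ≤ t) : e.obj (op t) ⟶ d s := e.map (homOfLE h).op ≫ ψ s
  have ha {t t' : T} (h : t ≤ t') (s : S) (hs : N s ≤ t) :
      e.map (homOfLE h).op ≫ a t s hs = a t' s (hs.trans h) := by
    dsimp only [a]
    rw [← Category.assoc, ← Functor.map_comp]
    rfl
  have hP (t : T) : Nonempty (MultiPullback m (a t) {s | N s < t} (fun _ h => h.le)) := by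
    obtain ⟨P, -⟩ := (MultiPullback.empty m (a t)).exists_union M hm (L := {s | N s < t})
      ((hN t).subset fun s h => le_of_lt h) (K' := {s | N s < t}) (by simp) (fun _ h => h.le)
    exact ⟨P⟩
  let Q (t : T) := (hP t).some
  have hQ (t : T) := (Q t).exists_union M hm (L := {s | N s = t}) (K' := {s | N s ≤ t})
    ((hN t).subset fun s h => le_of_eq h) (Set.ext fun s => le_iff_lt_or_eq) (fun _ h => h)
  choose P r hr' hr hr₁ hr₂ using hQ
  have hρ {t t' : T} (h : t ≤ t') := (P t).exists_lift' ((P t').toBase ≫ e.map (homOfLE h).op)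
    (fun s hs => (P t').toSrc s (le_trans hs h))
    (fun s hs => by rw [(P t').toSrc_comp, Category.assoc, ha])
  choose ρ hρ₁ hρ₂ using @hρ
  let e' : Tᵒᵖ ⥤ C :=
    { obj t := (P t.unop).pt
      map h := ρ (leOfHom h.unop)
      map_id t := (P t.unop).hom_ext' (by
        rw [hρ₁, Category.id_comp]
        exact (congr_arg _ (e.map_id t)).trans (Category.comp_id _))
        (fun s hs => by rw [hρ₂, Category.id_comp])
      map_comp {t t' t''} h h' := (P t''.unop).hom_ext' (by
        rw [hρ₁, Category.assoc, hρ₁, reassoc_of% hρ₁, ← Functor.map_comp]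
        rfl) (fun s hs => by rw [hρ₂, Category.assoc, hρ₂, hρ₂]) }
  let p : e' ⟶ e :=
    { app t := (P t.unop).toBase
      naturality t t' h := hρ₁ _ }
  refine ⟨e', p, fun s => (P (N s)).toSrc s le_rfl, fun t => ?_, fun s => ?_, fun {V} ξ x hx => ?_⟩
  · have hτ (s : T) (h : s < t) := (P s).exists_lift' ((Q t).toBase ≫ e.map (homOfLE h.le).op)
      (fun i hi => (Q t).toSrc i (lt_of_le_of_lt hi h))
      (fun i hi => by rw [(Q t).toSrc_comp, Category.assoc, ha])
    choose τ hτ₁ hτ₂ using hτ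
    obtain ⟨l, hl₁, hl₂⟩ := (Q t).exists_lift' (pullback.fst (toLimBelow e t) (limBelowMap p t))
      (fun i hi => relativeMatchingProj p hi ≫ (P (N i)).toSrc i le_rfl)
      (fun i hi => by
        rw [Category.assoc, (P (N i)).toSrc_comp]
        refine (Category.assoc _ _ _).symm.trans
          ((congr_arg (· ≫ a (N i) i le_rfl) (relativeMatchingProj_app p hi)).trans ?_)
        exact (Category.assoc _ _ _).trans (congr_arg _ (ha _ _ _)))
    refine mem_relativeMatchingMap p (ρ := r t) (hr t) (Q t).toBase τ
      (fun i j h hj => (P i).hom_ext' ?_ fun s hs => ?_) (fun s h => hτ₁ s h) (hr₁ t)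
      (fun s h => (P s).hom_ext' ?_ fun i hi => ?_) l hl₁
      (fun s h => (P s).hom_ext' ?_ fun i hi => ?_) (fun {V f g} h h' => (Q t).hom_ext' h fun i hi => ?_)
    · rw [Category.assoc, hτ₁]
      refine (congr_arg _ (hρ₁ h)).trans ?_
      rw [reassoc_of% hτ₁, ← Functor.map_comp]
      rfl
    · rw [Category.assoc, hτ₂]
      exact (congr_arg _ (hρ₂ h s hs)).trans (hτ₂ _ _ _ _)
    · rw [Category.assoc, hτ₁, reassoc_of% hr₁]
      exact (hρ₁ _).symm
    · rw [Category.assoc, hτ₂, hr₂]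
      exact (hρ₂ _ _ _).symm
    · rw [Category.assoc, hτ₁, reassoc_of% hl₁]
      exact (relativeMatchingProj_app p h).symm
    · rw [Category.assoc, hτ₂, hl₂, ← relativeMatchingProj_map p hi h, Category.assoc]
      exact congr_arg _ (hρ₂ hi i le_rfl)
    · rw [← hτ₂ (N i) hi i le_rfl, reassoc_of% (h' (N i) hi)]
  · rw [(P (N s)).toSrc_comp]
    exact congr_arg _ ((congr_arg (· ≫ ψ s) (e.map_id _)).trans (Category.id_comp _))
  · have hz (t : T) := (P t).exists_lift (ξ ≫ proj e t) (fun s _ => x s) (fun s hs => by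
      rw [hx, Functor.map_comp, Category.assoc, proj_map_assoc])
    choose z hz₁ hz₂ using hz
    obtain ⟨ξ', hξ'⟩ := exists_lift (X := e') z (fun i j h => (P i).hom_ext (by
        refine (Category.assoc _ _ _).trans ?_
        rw [hz₁, ← Functor.map_comp]
        refine (congr_arg (z j ≫ (simple C).map ·) (hρ₁ h)).trans ?_
        rw [Functor.map_comp, reassoc_of% hz₁, proj_map])
      (fun s hs => by
        refine (Category.assoc _ _ _).trans ?_
        rw [hz₂, ← Functor.map_comp]
        refine (congr_arg (z j ≫ (simple C).map ·) (hρ₂ h s hs)).trans ?_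
        rw [hz₂]))
    refine ⟨ξ', hom_ext fun t => ?_, fun s => ?_⟩
    · rw [Category.assoc, ofNatTrans_proj, reassoc_of% hξ']
      exact hz₁ t
    · rw [reassoc_of% hξ']
      exact hz₂ _ _ _

end ProCat

end

/-! ### A tower of special maps as a single special map -/

section

section

variable {T : Type w} [PartialOrder T]

variable (T) in
/-- The product of a poset with the natural numbers. -/
@[ext]
structure TowerIndex : Type w where
  /-- the first component -/
  fst : T
  /-- the second component -/
  snd : ℕ

namespace TowerIndex

instance : PartialOrder (TowerIndex T) :=
  PartialOrder.lift (fun x => (x.fst, x.snd)) fun _ _ h =>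
    TowerIndex.ext (congr_arg Prod.fst h) (congr_arg Prod.snd h)

instance [Nonempty T] : Nonempty (TowerIndex T) := ⟨⟨Classical.arbitrary T, 0⟩⟩

lemma mk_le_mk {s t : T} {m n : ℕ} (h : s ≤ t) (h' : m ≤ n) : mk s m ≤ mk t n := ⟨h, h'⟩

instance [IsDirectedOrder T] : IsDirectedOrder (TowerIndex T) where
  directed x y := by
    obtain ⟨t, h, h'⟩ := exists_ge_ge x.fst y.fst
    exact ⟨⟨t, max x.snd y.snd⟩, ⟨h, le_max_left _ _⟩, ⟨h', le_max_right _ _⟩⟩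

instance [CofinitePoset T] : CofinitePoset (TowerIndex T) where
  finite_Iic t := by
    refine (((CofinitePoset.finite_Iic t.fst).prod (Set.finite_Iic t.snd)).preimage
      (f := fun x : TowerIndex T => (x.fst, x.snd)) fun x _ y _ h =>
        TowerIndex.ext (congr_arg Prod.fst h) (congr_arg Prod.snd h)).subset fun x hx => ?_
    exact ⟨hx.1, hx.2⟩

variable (T) in
/-- The first projection. -/
def fstHom : TowerIndex T →o T := ⟨fst, fun _ _ h => h.1⟩

variable (T) in
/-- The second projection. -/
def sndHom : TowerIndex T →o ℕ := ⟨snd, fun _ _ h => h.2⟩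

end TowerIndex

open TowerIndex

variable {C : Type u} [Category.{v} C] (H : ℕᵒᵖ ⥤ Tᵒᵖ ⥤ C)

/-- The diagram on `T × ℕ` given by a tower of diagrams on `T`. -/
def towerDiagram : (TowerIndex T)ᵒᵖ ⥤ C where
  obj x := (H.obj (op (sndHom T x.unop))).obj (op (fstHom T x.unop))
  map h := (H.map (homOfLE ((sndHom T).monotone (leOfHom h.unop))).op).app _ ≫
    (H.obj _).map (homOfLE ((fstHom T).monotone (leOfHom h.unop))).op
  map_id x := by
    change (H.map (𝟙 _)).app _ ≫ (H.obj _).map (𝟙 _) = _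
    simp
  map_comp {x y z} f g := by
    have h₁ : (homOfLE ((sndHom T).monotone (leOfHom (f ≫ g).unop))).op =
      (homOfLE ((sndHom T).monotone (leOfHom f.unop))).op ≫
        (homOfLE ((sndHom T).monotone (leOfHom g.unop))).op := rfl
    have h₂ : (homOfLE ((fstHom T).monotone (leOfHom (f ≫ g).unop))).op =
      (homOfLE ((fstHom T).monotone (leOfHom f.unop))).op ≫
        (homOfLE ((fstHom T).monotone (leOfHom g.unop))).op := rfl
    rw [h₁, h₂, H.map_comp, Functor.map_comp]
    simp

/-- The projection of a tower of diagrams to its bottom term. -/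
def towerProjection : towerDiagram H ⟶ (fstHom T).monotone.functor.op ⋙ H.obj (op 0) where
  app x := (H.map (homOfLE (Nat.zero_le (sndHom T x.unop))).op).app _
  naturality x y f := by
    have h : (homOfLE (Nat.zero_le (sndHom T x.unop))).op =
      (homOfLE ((sndHom T).monotone (leOfHom f.unop))).op ≫
        (homOfLE (Nat.zero_le (sndHom T y.unop))).op := rfl
    rw [h, H.map_comp]
    refine (Category.assoc _ _ _).trans (Eq.trans ?_ (Category.assoc _ _ _).symm)
    exact congr_arg _ ((H.map _).naturality _)

/-- Every element below `(t, n + 1)` is below `(t, n)` or some `(s, n + 1)` with `s < t`. So the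
relative matching object there is that of the map from level `n + 1` to level `n` at `t`. At `(t,
0)` the projection is an identity, and so is the matching map up to isomorphism. -/
lemma isSpecialMap_towerProjection [CofinitePoset T] [HasFiniteLimits C] {M : MorphismProperty C}
    [M.IsMultiplicative] [M.RespectsIso]
    (hH : ∀ n : ℕ, IsSpecialMap M (H.map (homOfLE (Nat.le_add_right n 1)).op)) :
    IsSpecialMap M (towerProjection H) := by
  have hcomp {x y z : TowerIndex T} (h : x ≤ y) (h' : y ≤ z) :
      (towerDiagram H).map (homOfLE h').op ≫ (towerDiagram H).map (homOfLE h).op =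
        (towerDiagram H).map (homOfLE (h.trans h')).op := by
    rw [← Functor.map_comp]
    rfl
  have hrow {n : ℕ} {s t : T} (h : s ≤ t) :
      (towerDiagram H).map (homOfLE (mk_le_mk h (le_refl n))).op =
        (H.obj (op n)).map (homOfLE h).op := by
    change (H.map (𝟙 _)).app _ ≫ _ = _
    rw [H.map_id]
    exact Category.id_comp _
  have hcol {n k : ℕ} {t : T} (h : n ≤ k) :
      (towerDiagram H).map (homOfLE (mk_le_mk (le_refl t) h)).op =
        (H.map (homOfLE h).op).app (op t) := by
    change _ ≫ (H.obj (op n)).map (𝟙 _) = _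
    exact (congr_arg _ ((H.obj (op n)).map_id _)).trans (Category.comp_id _)
  have hid {x : TowerIndex T} (h : x ≤ x) : (towerDiagram H).map (homOfLE h).op = 𝟙 _ :=
    (towerDiagram H).map_id _
  rintro ⟨t, n⟩
  change M (relativeMatchingMap (towerProjection H) (TowerIndex.mk t n))
  obtain _ | n := n
  · have h₀ (s : T) : (towerProjection H).app (op (TowerIndex.mk s 0)) =
      𝟙 ((towerDiagram H).obj (op (TowerIndex.mk s 0))) := congr_app (H.map_id _) _
    refine mem_relativeMatchingMap _
      (ρ := 𝟙 ((towerDiagram H).obj (op (TowerIndex.mk t 0)))) (M.id_mem _)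
      (𝟙 _) (fun s h => (towerDiagram H).map (homOfLE h.le).op) (fun r s h hs => hcomp _ _)
      ?_ ?_ (fun s h => Category.id_comp _) (pullback.fst _ _) (Category.comp_id _) ?_ ?_
    · intro s h
      refine ((towerProjection H).naturality _).trans (congr_arg (· ≫ _) (h₀ t))
    · exact (Category.id_comp _).trans (h₀ t).symm
    · rintro ⟨s, k⟩ h
      obtain rfl : k = 0 := Nat.le_zero.1 h.le.2
      refine ((congr_arg _ (hrow (n := 0) h.le.1)).trans
        (relativeMatchingProj_app (towerProjection H) h).symm).trans ?_
      exact (congr_arg _ (h₀ s)).trans (Category.comp_id _)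
    · intro V f g h _
      exact ((Category.comp_id f).symm.trans h).trans (Category.comp_id g)
  · let p := H.map (homOfLE (Nat.le_add_right n 1)).op
    let E := towerDiagram H
    let Q : C := pullback (toLimBelow (H.obj (op n)) t) (limBelowMap p t)
    let Qf : Q ⟶ E.obj (op (TowerIndex.mk t n)) := pullback.fst _ _
    let Qp (s : T) (h : s < t) : Q ⟶ E.obj (op (TowerIndex.mk s (n + 1))) := relativeMatchingProj p h
    have hQ {r s : T} (h : r ≤ s) (hs : s < t) : Qp s hs ≫
        E.map (homOfLE (mk_le_mk h (le_refl (n + 1)))).op = Qp r (h.trans_lt hs) :=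
      (congr_arg _ (hrow h)).trans (relativeMatchingProj_map p h hs)
    have hQ' {s : T} (hs : s < t) : Qp s hs ≫
        E.map (homOfLE (mk_le_mk (le_refl s) (Nat.le_add_right n 1))).op =
          Qf ≫ E.map (homOfLE (mk_le_mk hs.le (le_refl n))).op :=
      ((congr_arg _ (hcol _)).trans (relativeMatchingProj_app p hs)).trans
        (congr_arg _ (hrow hs.le).symm)
    have hlt {x : TowerIndex T} (hx : x < TowerIndex.mk t (n + 1)) (hx' : ¬ x.snd ≤ n) : x.fst < t :=
      lt_of_le_of_ne hx.le.1 fun h => by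
        have : x.snd = n + 1 := le_antisymm hx.le.2 (not_le.1 hx')
        exact hx.ne (TowerIndex.ext h this)
    -- The projection passes through `(t, n)` when possible, otherwise through `(x.fst, n + 1)`;
    -- `hτ₁` and `hτ₂` show that the route is immaterial.
    let τ (x : TowerIndex T) (hx : x < TowerIndex.mk t (n + 1)) : Q ⟶ E.obj (op x) :=
      if h : x.snd ≤ n then Qf ≫ E.map (homOfLE (mk_le_mk hx.le.1 h : x ≤ TowerIndex.mk t n)).op else
        Qp x.fst (hlt hx h) ≫ E.map (homOfLE (mk_le_mk le_rfl hx.le.2 : x ≤ TowerIndex.mk x.fst (n + 1))).op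
    have hτ₁ (x hx) (h : x ≤ TowerIndex.mk t n) : τ x hx = Qf ≫ E.map (homOfLE h).op := dif_pos h.2
    have hτ₂ (x hx) {s : T} (hs : s < t) (h : x ≤ TowerIndex.mk s (n + 1)) :
        τ x hx = Qp s hs ≫ E.map (homOfLE h).op := by
      by_cases hx' : x.snd ≤ n
      · have h₁ : x ≤ TowerIndex.mk s n := ⟨h.1, hx'⟩
        rw [hτ₁ x hx ⟨hx.le.1, hx'⟩, ← hcomp h₁ (mk_le_mk hs.le le_rfl), ← reassoc_of% hQ' hs, hcomp]
      · refine (dif_neg hx').trans ?_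
        have h₁ : x ≤ TowerIndex.mk x.fst (n + 1) := ⟨le_rfl, h.2⟩
        rw [← hQ h.1 hs, Category.assoc]
        exact congr_arg _ (hcomp _ _)
    have hcases (x) (hx : x < TowerIndex.mk t (n + 1)) : x ≤ TowerIndex.mk t n ∨ ∃ s, s < t ∧ x ≤ TowerIndex.mk s (n + 1) := by
      by_cases hx' : x.snd ≤ n
      · exact Or.inl ⟨hx.le.1, hx'⟩
      · exact Or.inr ⟨x.fst, hlt hx hx', le_rfl, hx.le.2⟩
    have hlt₁ : TowerIndex.mk t n < TowerIndex.mk t (n + 1) := 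
      lt_of_le_not_ge (mk_le_mk le_rfl n.le_succ) fun h => n.not_succ_le_self h.2
    have hlt₂ {s : T} (h : s < t) : TowerIndex.mk s (n + 1) < TowerIndex.mk t (n + 1) :=
      
      lt_of_le_not_ge (mk_le_mk h.le le_rfl) fun h' => h.not_ge h'.1
    obtain ⟨l, hl₁, hl₂⟩ := exists_relativeMatching_lift p (t := t) (𝟭 C)
      (relativeMatchingProj (towerProjection H) hlt₁)
      (fun s h => relativeMatchingProj (towerProjection H) (hlt₂ h))
      (fun r s h hs => (congr_arg _ (hrow (n := n + 1) h).symm).trans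
        (relativeMatchingProj_map (towerProjection H) (mk_le_mk h (le_refl (n + 1))) (hlt₂ hs)))
      (fun s hs => (((congr_arg _ (hcol (Nat.le_add_right n 1)).symm).trans
        (relativeMatchingProj_map (towerProjection H)
          (mk_le_mk (le_refl s) (Nat.le_add_right n 1)) (hlt₂ hs))).trans
        (relativeMatchingProj_map (towerProjection H) (mk_le_mk hs.le (le_refl n)) hlt₁).symm).trans
        (congr_arg _ (hrow hs.le)))
    replace hl₁ : l ≫ Qf = relativeMatchingProj (towerProjection H) hlt₁ := hl₁
    replace hl₂ (s : T) (hs : s < t) :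
      l ≫ Qp s hs = relativeMatchingProj (towerProjection H) (hlt₂ hs) := hl₂ s hs
    have h0 (x : TowerIndex T) : TowerIndex.mk x.fst 0 ≤ x := mk_le_mk le_rfl (Nat.zero_le x.snd)
    have hπ (x : TowerIndex T) : (towerProjection H).app (op x) = E.map (homOfLE (h0 x)).op :=
      (hcol (Nat.zero_le x.snd)).symm
    have hτ {x y : TowerIndex T} (h : x ≤ y) (hy : y < TowerIndex.mk t (n + 1)) :
        τ y hy ≫ E.map (homOfLE h).op = τ x (h.trans_lt hy) := by
      obtain h' | ⟨s, hs, h'⟩ := hcases y hy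
      · rw [hτ₁ _ hy h', hτ₁ _ (h.trans_lt hy) (h.trans h'), Category.assoc, hcomp]
      · rw [hτ₂ _ hy hs h', hτ₂ _ (h.trans_lt hy) hs (h.trans h'), Category.assoc, hcomp]
    have hρf : relativeMatchingMap p t ≫ Qf =
        E.map (homOfLE (mk_le_mk (le_refl t) (Nat.le_add_right n 1))).op :=
      (relativeMatchingMap_fst p).trans (hcol _).symm
    have hρp {s : T} (hs : s < t) : relativeMatchingMap p t ≫ Qp s hs =
        E.map (homOfLE (mk_le_mk hs.le (le_refl (n + 1)))).op :=
      (relativeMatchingMap_proj p hs).trans (hrow _).symm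
    refine mem_relativeMatchingMap (towerProjection H) (ρ := relativeMatchingMap p t) (hH n t)
      (Qf ≫ (towerProjection H).app (op (TowerIndex.mk t n))) τ (fun x y => hτ) (fun x hx => ?_) ?_
      (fun x hx => ?_) l ?_ (fun x hx => ?_) (fun {V f g} _ h => ?_)
    · refine (congr_arg _ (hπ x)).trans ((hτ (h0 x) hx).trans ?_)
      rw [hτ₁ _ ((h0 x).trans_lt hx) (mk_le_mk hx.le.1 (Nat.zero_le n))]
      refine Eq.trans (congr_arg _ ?_) (Category.assoc _ _ _).symm
      refine Eq.trans ?_ (congr_arg (· ≫ _) (hπ _).symm)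
      exact (hcomp (mk_le_mk hx.le.1 (le_refl 0)) (h0 (TowerIndex.mk t n))).symm.trans
        (congr_arg _ (hrow hx.le.1))
    · refine (Category.assoc _ _ _).symm.trans ((congr_arg (· ≫ _) hρf).trans ?_)
      exact (congr_arg _ (hπ _)).trans ((hcomp _ _).trans (hπ _).symm)
    · obtain h' | ⟨s, hs, h'⟩ := hcases x hx
      · rw [hτ₁ _ hx h']
        exact (Category.assoc _ _ _).symm.trans ((congr_arg (· ≫ _) hρf).trans (hcomp _ _))
      · rw [hτ₂ _ hx hs h']
        exact (Category.assoc _ _ _).symm.trans ((congr_arg (· ≫ _) (hρp hs)).trans (hcomp _ _))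
    · refine (Category.assoc _ _ _).symm.trans ((congr_arg (· ≫ _) hl₁).trans ?_)
      refine (relativeMatchingProj_app (towerProjection H) hlt₁).trans ?_
      exact (congr_arg _ ((H.obj (op 0)).map_id (op t))).trans (Category.comp_id _)
    · obtain h' | ⟨s, hs, h'⟩ := hcases x hx
      · rw [hτ₁ _ hx h', reassoc_of% hl₁]
        exact relativeMatchingProj_map (towerProjection H) h' hlt₁
      · rw [hτ₂ _ hx hs h', reassoc_of% hl₂ s hs]
        exact relativeMatchingProj_map (towerProjection H) h' (hlt₂ hs)
    · have hf : τ _ hlt₁ = Qf := by rw [hτ₁ _ hlt₁ le_rfl, hid, Category.comp_id]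
      have hp (s) (hs : s < t) : τ _ (hlt₂ hs) = Qp s hs := by
        rw [hτ₂ _ (hlt₂ hs) hs le_rfl, hid, Category.comp_id]
      refine relativeMatching_hom_ext (𝟭 C) ?_ fun s hs => ?_
      · exact ((congr_arg (f ≫ ·) hf).symm.trans (h _ hlt₁)).trans (congr_arg (g ≫ ·) hf)
      · exact ((congr_arg (f ≫ ·) (hp s hs)).symm.trans (h _ (hlt₂ hs))).trans
          (congr_arg (g ≫ ·) (hp s hs))

end

end

/-! ### Monotone reindexing and enumeration of cells -/

section

/-- By well-founded recursion, the value at `t` is an upper bound of `f t` and of the finitely many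
earlier values. Applied to a surjection, this gives a monotone cofinal map. -/
lemma CofinitePoset.exists_monotone_ge {T : Type w} [PartialOrder T] [CofinitePoset T]
    {S : Type v} [PartialOrder S] [Nonempty S] [IsDirectedOrder S] (f : T → S) :
    ∃ g : T →o S, ∀ t, f t ≤ g t := by
  classical
  have wf : WellFounded ((· < ·) : T → T → Prop) :=
    Subrelation.wf (r := InvImage (· < ·) fun t : T => (Set.Iic t).ncard)
      (fun {s t} h => Set.ncard_lt_ncard (Set.Iic_ssubset_Iic.2 h) (CofinitePoset.finite_Iic t))
      (InvImage.wf _ wellFounded_lt)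
  have hb (t : T) (g : ∀ s < t, S) : ∃ b, f t ≤ b ∧ ∀ s hs, g s hs ≤ b := by
    have : Fintype (Set.Iio t) := Fintype.ofFinite _
    obtain ⟨b, hb⟩ := (insert (f t) (Finset.univ.image fun s : Set.Iio t => g s.1 s.2)).exists_le
    exact ⟨b, hb _ (Finset.mem_insert_self _ _), fun s hs => hb _ (Finset.mem_insert_of_mem
      (Finset.mem_image_of_mem (fun s : Set.Iio t => g s.1 s.2) (Finset.mem_univ ⟨s, hs⟩)))⟩
  let g : T → S := wf.fix fun t g => (hb t g).choose
  have hg (t) : g t = (hb t fun s _ => g s).choose := wf.fix_eq _ t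
  refine ⟨⟨g, fun s t h => ?_⟩, fun t => ?_⟩
  · obtain rfl | h := h.eq_or_lt
    · exact le_rfl
    · rw [hg t]
      exact (hb t fun s _ => g s).choose_spec.2 s h
  · change f t ≤ g t
    rw [hg t]
    exact (hb t fun s _ => g s).choose_spec.1

instance Finset.cofinitePoset (S : Type u) : CofinitePoset (Finset S) where
  finite_Iic F := by
    classical
    exact (F.powerset.finite_toSet).subset fun G hG => Finset.mem_coe.2 (Finset.mem_powerset.2 hG)

namespace ProCat

variable {C : Type u} [SmallCategory C]

section

variable {T : Type u} [PartialOrder T] [Nonempty T] [IsDirectedOrder T]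

/-- The commutative squares from a morphism of pro-objects to a morphism of `M`, whose bottom
map factors through a given term of the diagram. -/
structure Cell (M : MorphismProperty C) {V : ProCat C} {e : Tᵒᵖ ⥤ C} (ξ : V ⟶ ofDiagram e) where
  /-- the index of the term of the diagram -/
  idx : T
  /-- the source of the morphism of `M` -/
  src : C
  /-- the target of the morphism of `M` -/
  tgt : C
  /-- the bottom map -/
  bot : e.obj (op idx) ⟶ tgt
  /-- the morphism of `M` -/
  hom : src ⟶ tgt
  /-- the top map -/
  top : V ⟶ (simple C).obj src
  mem : M hom
  w : top ≫ (simple C).map hom = ξ ≫ proj e idx ≫ (simple C).map bot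

/-- The data of a cell, without the reference to the diagram. -/
abbrev CellCode (T : Type u) (V : ProCat C) : Type u :=
  T × (Σ b c d : C, (b ⟶ d) × (c ⟶ d) × (V ⟶ (simple C).obj c))

/-- The code of a cell. -/
def Cell.code {M : MorphismProperty C} {V : ProCat C} {e : Tᵒᵖ ⥤ C} {ξ : V ⟶ ofDiagram e}
    (k : Cell M ξ) : CellCode T V :=
  ⟨k.idx, e.obj (op k.idx), k.src, k.tgt, k.bot, k.hom, k.top⟩

lemma Cell.code_injective {M : MorphismProperty C} {V : ProCat C} {e : Tᵒᵖ ⥤ C}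
    {ξ : V ⟶ ofDiagram e} : Function.Injective (Cell.code : Cell M ξ → CellCode T V) := by
  rintro ⟨t, c, d, φ, m, x, hm, h⟩ ⟨t', c', d', φ', m', x', hm', h'⟩ hk
  simp only [Cell.code, Prod.mk.injEq] at hk
  obtain ⟨rfl, hk⟩ := hk
  simp only [Sigma.mk.injEq, heq_eq_eq, true_and] at hk
  obtain ⟨rfl, hk⟩ := hk
  simp only [Sigma.mk.injEq, heq_eq_eq] at hk
  obtain ⟨rfl, hk⟩ := hk
  simp only [heq_eq_eq, Prod.mk.injEq] at hk
  obtain ⟨rfl, rfl, rfl⟩ := hk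
  rfl

end

/-- One index poset has to serve for all steps, although the cells depend on it. An infinite set `S`
has the cardinality of `Finset S`, so if `S` is large enough its elements can name all cells of
diagrams on `Finset S`. -/
lemma exists_code (V : ProCat C) (T : Type u) :
    ∃ S : Type u, Nonempty (CellCode (Finset S) V ↪ S) ∧ Nonempty (T ↪ Finset S) := by
  let Q := Σ b c d : C, (b ⟶ d) × (c ⟶ d) × (V ⟶ (simple C).obj c)
  let S := ℕ ⊕ (Q ⊕ T)
  refine ⟨S, ?_, ⟨⟨fun t => {Sum.inr (Sum.inr t)}, fun t t' h => by simpa using h⟩⟩⟩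
  rw [← Cardinal.le_def, Cardinal.mk_prod, Cardinal.lift_id, Cardinal.lift_id,
    Cardinal.mk_finset_of_infinite]
  refine (mul_le_mul_right (Cardinal.mk_le_of_injective
    (f := fun q : Q => (Sum.inr (Sum.inl q) : S)) fun q q' h => by simpa using h) _).trans ?_
  rw [Cardinal.mul_eq_self (Cardinal.aleph0_le_mk S)]

variable [HasFiniteLimits C] (M : MorphismProperty C) [M.IsMultiplicative]
  [M.IsStableUnderBaseChange]

lemma exists_special_lift_cells {S : Type u} {V : ProCat C}
    (code : CellCode (Finset S) V ↪ S) (e : (Finset S)ᵒᵖ ⥤ C) (ξ : V ⟶ ofDiagram e) :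
    ∃ (e' : (Finset S)ᵒᵖ ⥤ C) (ξ' : V ⟶ ofDiagram e') (p : e' ⟶ e), IsSpecialMap M p ∧
      ξ' ≫ ofNatTrans p = ξ ∧ ∀ k : Cell M ξ, ∃ (t : Finset S) (h : k.idx ≤ t)
        (q : e'.obj (op t) ⟶ k.src), q ≫ k.hom = p.app (op t) ≫ e.map (homOfLE h).op ≫ k.bot ∧
          ξ' ≫ proj e' t ≫ (simple C).map q = k.top := by
  classical
  -- An identity provides the default cell, so every element of `S` decodes to some cell.
  have : Nonempty (Cell M ξ) := ⟨⟨∅, _, _, 𝟙 _, 𝟙 (e.obj (op ∅)), ξ ≫ proj e ∅, M.id_mem _, by simp⟩⟩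
  let dec : S → Cell M ξ := Function.invFun (code ∘ Cell.code)
  have hdec (k) : ∃ s, dec s = k :=
    Function.invFun_surjective (code.injective.comp Cell.code_injective) k
  -- Inserting `s` in its own index ensures that only the elements of `F` can contribute at `F`,
  -- hence finitely many.
  have hle (s) : (dec s).idx ≤ insert s (dec s).idx := Finset.subset_insert _ _
  obtain ⟨e', p, q, hp, hq, h⟩ := exists_special_lift M e (fun s => (dec s).mem)
    (fun s => insert s (dec s).idx)
    (fun F => F.finite_toSet.subset fun s hs => hs (Finset.mem_insert_self _ _))
    (fun s => e.map (homOfLE (hle s)).op ≫ (dec s).bot)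
  obtain ⟨ξ', h₁, h₂⟩ := h ξ (fun s => (dec s).top) (fun s => by
    rw [(dec s).w, Functor.map_comp, proj_map_assoc])
  refine ⟨e', ξ', p, hp, h₁, fun k => ?_⟩
  obtain ⟨s, rfl⟩ := hdec k
  exact ⟨_, hle s, q s, hq s, h₂ s⟩

end ProCat

end

/-! ### The factorization and the retract argument -/

section

namespace ProCat

variable {C : Type u} [SmallCategory C] [HasFiniteLimits C] (M : MorphismProperty C)

lemma exists_tower [M.IsMultiplicative] [M.IsStableUnderBaseChange] {S : Type u} {V : ProCat C}
    (code : CellCode (Finset S) V ↪ S) (e₀ : (Finset S)ᵒᵖ ⥤ C) (ξ₀ : V ⟶ ofDiagram e₀) :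
    ∃ (H : ℕᵒᵖ ⥤ (Finset S)ᵒᵖ ⥤ C) (ξ : ∀ n : ℕ, V ⟶ ofDiagram (H.obj (op n)))
      (α : ofDiagram e₀ ≅ ofDiagram (H.obj (op 0))), ξ₀ ≫ α.hom = ξ 0 ∧
      (∀ n, IsSpecialMap M (H.map (homOfLE (Nat.le_add_right n 1)).op)) ∧
      (∀ n, ξ (n + 1) ≫ ofNatTrans (H.map (homOfLE (Nat.le_add_right n 1)).op) = ξ n) ∧
      ∀ n (k : Cell M (ξ n)), ∃ (t : Finset S) (h : k.idx ≤ t)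
        (q : (H.obj (op (n + 1))).obj (op t) ⟶ k.src),
        q ≫ k.hom = (H.map (homOfLE (Nat.le_add_right n 1)).op).app (op t) ≫
          (H.obj (op n)).map (homOfLE h).op ≫ k.bot ∧
        ξ (n + 1) ≫ proj (H.obj (op (n + 1))) t ≫ (simple C).map q = k.top := by
  choose E' Ξ' P hP hΞ hcell using fun e ξ => exists_special_lift_cells M code e ξ
  let seq (n : ℕ) : Σ e : (Finset S)ᵒᵖ ⥤ C, V ⟶ ofDiagram e :=
    Nat.rec ⟨e₀, ξ₀⟩ (fun _ s => ⟨E' s.1 s.2, Ξ' s.1 s.2⟩) n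
  let p (n : ℕ) : (seq (n + 1)).1 ⟶ (seq n).1 := P (seq n).1 (seq n).2
  have hp (n) : (Functor.ofOpSequence (X := fun n => (seq n).1) p).map (homOfLE (Nat.le_add_right n 1)).op = p n :=
    Functor.ofOpSequence_map_homOfLE_succ (X := fun n => (seq n).1) p n
  refine ⟨Functor.ofOpSequence (X := fun n => (seq n).1) p, fun n => (seq n).2, Iso.refl _, Category.comp_id _,
    fun n => ?_, fun n => ?_, fun n => ?_⟩
  · rw [hp]
    exact hP _ _
  · rw [hp]
    exact hΞ _ _
  · rw [hp]
    exact hcell _ _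

/-- After reindexing `Y` over a suitable `Finset S`, each step solves all lifting problems of the
current diagram. The ω steps together form one special map over `Finset S` times `ℕ`. -/
lemma exists_llp_spIso_factorization [M.IsMultiplicative] [M.IsStableUnderBaseChange]
    {V Y : ProCat C} (f : V ⟶ Y) :
    ∃ (Z : ProCat C) (i : V ⟶ Z) (p : Z ⟶ Y), (M.map (simple C)).llp i ∧ spIso M p ∧ i ≫ p = f := by
  obtain ⟨T, _, _, _, Y₁, ⟨eY⟩⟩ := exists_iso_ofDiagram Y
  obtain ⟨S, ⟨code⟩, ⟨a⟩⟩ := exists_code V T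
  obtain ⟨g, hg⟩ := CofinitePoset.exists_monotone_ge (Function.invFun a)
  obtain ⟨eR, -⟩ := exists_iso_reindex Y₁ g (fun t => by
    obtain ⟨F, rfl⟩ := Function.invFun_surjective a.injective t
    exact ⟨F, hg F⟩)
  obtain ⟨H, ξ, α, hα, hH, hξ, hcell⟩ := exists_tower M code _ (f ≫ eY.hom ≫ eR.hom)
  have hξ' {n k : ℕ} (h : n ≤ k) (t : Finset S) : ξ k ≫ proj _ t ≫
      (simple C).map ((H.map (homOfLE h).op).app (op t)) = ξ n ≫ proj _ t := by
    induction k, h using Nat.le_induction with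
    | base =>
      have : H.map (homOfLE (le_refl n)).op = 𝟙 _ := H.map_id _
      rw [this, NatTrans.id_app, CategoryTheory.Functor.map_id, Category.comp_id]
    | succ k hk ih =>
      have : H.map (homOfLE (hk.trans k.le_succ)).op =
          H.map (homOfLE (Nat.le_add_right k 1)).op ≫ H.map (homOfLE hk).op :=
        H.map_comp (homOfLE (Nat.le_add_right k 1)).op (homOfLE hk).op
      rw [this, NatTrans.comp_app, Functor.map_comp, ← reassoc_of% ofNatTrans_proj, reassoc_of% hξ k, ih]
  let E := towerDiagram H
  obtain ⟨i, hi⟩ := exists_lift (X := E) (fun x => ξ x.snd ≫ proj (H.obj (op x.snd)) x.fst)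
    (fun x y h => by
      refine (congr_arg (_ ≫ ·) ((simple C).map_comp _ _)).trans ?_
      refine (Category.assoc _ _ _).symm.trans
        ((congr_arg (· ≫ _) ((Category.assoc _ _ _).trans (hξ' h.2 y.fst))).trans ?_)
      exact (Category.assoc _ _ _).trans (congr_arg _ (proj_map (H.obj (op x.snd)) h.1)))
  obtain ⟨eT, heT⟩ := exists_iso_reindex (H.obj (op 0)) (TowerIndex.fstHom (Finset S))
    (fun t => ⟨⟨t, 0⟩, le_rfl⟩)
  have hiT : i ≫ ofNatTrans (towerProjection H) = ξ 0 ≫ eT.hom := hom_ext fun x => by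
    rw [Category.assoc, ofNatTrans_proj, Category.assoc, heT, reassoc_of% hi]
    exact (Category.assoc _ _ _).trans (hξ' (Nat.zero_le x.snd) x.fst)
  refine ⟨ofDiagram E, i, ofNatTrans (towerProjection H) ≫ (eY ≪≫ eR ≪≫ α ≪≫ eT).inv, ?_, ?_, ?_⟩
  · intro A B m' hm'
    rw [MorphismProperty.map_eq_isoClosure] at hm'
    obtain ⟨_, _, _, ⟨hm⟩, ⟨e⟩⟩ := hm'
    rename_i c d m
    refine (HasLiftingProperty.iff_of_arrow_iso_right i e).1 ⟨fun {x y} sq => ?_⟩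
    -- The bottom map factors through a term of level `n`, so the square is a cell of step `n`, and
    -- step `n + 1` solves it.
    obtain ⟨⟨t, n⟩, b, hb⟩ := exists_proj_factorization y
    obtain ⟨t', h, q, hq, hq'⟩ := hcell n
      { idx := t, src := c, tgt := d, bot := b, hom := m, top := x, mem := hm
        w := by
          rw [sq.w, ← hb, reassoc_of% hi]
          exact Category.assoc _ _ _ }
    refine ⟨⟨⟨proj E ⟨t', n + 1⟩ ≫ (simple C).map q, ?_, ?_⟩⟩⟩
    · rw [reassoc_of% hi]
      exact (Category.assoc _ _ _).trans hq'
    · have h' : TowerIndex.mk t n ≤ ⟨t', n + 1⟩ := ⟨h, Nat.le_add_right n 1⟩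
      have h'' : q ≫ m = E.map (homOfLE h').op ≫ b := hq.trans (Category.assoc _ _ _).symm
      rw [← hb, ← proj_map E h', Category.assoc, Category.assoc, ← Functor.map_comp, ← h'']
      exact congr_arg (proj E ⟨t', n + 1⟩ ≫ ·) ((simple C).map_comp _ _).symm
  · refine ⟨_, _, inferInstance, inferInstance, inferInstance, _, _, towerProjection H,
      isSpecialMap_towerProjection H hH,
      ⟨Arrow.isoMk (Iso.refl _) (eY ≪≫ eR ≪≫ α ≪≫ eT) ?_⟩⟩
    simp
  · rw [reassoc_of% hiT, ← hα]
    simp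

/-- In the opposite category this says that left lifting properties pass to transfinite compositions
of pushouts. -/
lemma cocell_le_llp_rlp {D : Type u} [Category.{v} D] (W : MorphismProperty D) :
    cocell.{w} W ≤ W.llp.rlp := by
  intro A B f hf A' B' i hi
  have : W.pullbacks.op ≤ (MorphismProperty.ofHoms (fun _ : Unit => i.op)).llp := by
    rintro _ _ g hg _ _ _ ⟨⟩
    obtain ⟨_, _, p, _, _, hp, sq⟩ := hg
    have := hi _ hp
    have := sq.hasLiftingProperty i
    exact HasLiftingProperty.op this
  have h := MorphismProperty.transfiniteCompositions_le.{w} _ _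
    (MorphismProperty.transfiniteCompositions_monotone.{w} this _ hf)
  exact (h _ ⟨()⟩).unop

/-- Retract argument: `f` lifts against the first factor of its own factorization, so it is a
retract of the second. -/
lemma cocell_le_retracts_spIso [M.IsMultiplicative] [M.IsStableUnderBaseChange] :
    cocell.{u} (M.map (simple C)) ≤ (spIso M).retracts := by
  intro A B f hf
  obtain ⟨Z, i, p, hi, hp, fac⟩ := exists_llp_spIso_factorization M f
  have := cocell_le_llp_rlp _ _ hf _ hi
  exact ⟨_, _, p, RetractArrow.ofRightLiftingProperty fac, hp⟩

lemma retracts_cocell_eq_retracts_spIso [M.IsMultiplicative] [M.IsStableUnderBaseChange] :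
    (cocell.{u} (M.map (simple C))).retracts = (spIso M).retracts := by
  refine le_antisymm ?_ (MorphismProperty.retracts_monotone spIso_le_cocell)
  rintro A B f ⟨_, _, g, r, hg⟩
  obtain ⟨_, _, h, r', hh⟩ := cocell_le_retracts_spIso M _ hg
  exact ⟨_, _, h, r.trans r', hh⟩

end ProCat

end

theorem propositionc :
    -- Isaksen's conjecture for subcategories closed under pullbacks
    (∀ (C : Type u) [SmallCategory C] [HasFiniteLimits C] (M : MorphismProperty C),
      MorphismProperty.isomorphisms C ≤ M → M.IsStableUnderComposition →
      M.IsStableUnderBaseChange →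
      (cocell.{u} (M.map (ProCat.simple C))).retracts = (spIso M).retracts) ∧
    -- the counterexample for general classes
    ((cocell.{u} (SquareCat.onlyBD.{u}.map (ProCat.simple SquareCat.{u}))).retracts
        ((ProCat.simple SquareCat.{u}).map SquareCat.ac) ∧
      ¬ (spIso SquareCat.onlyBD.{u}).retracts
        ((ProCat.simple SquareCat.{u}).map SquareCat.ac)) ∧
    -- the application to finite simplicial sets
    (∀ (A B : SSet.{u}) [A.Finite] [B.Finite] (f : A ⟶ B), IsTrivialCofibration f →
      ∃ (X Y : SSet.{u}) (g : X ⟶ Y), X.Finite ∧ Y.Finite ∧ finiteHornCell g ∧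
        Nonempty (RetractArrow f g)) := by
  refine ⟨fun C _ _ M hM hM' hM'' => ?_,
    ⟨SquareCat.retracts_cocell_simple_ac, SquareCat.not_retracts_spIso_simple_ac⟩,
    fun A B _ _ f hf => SSet.exists_retractArrow_finiteHornCell f hf⟩
  have : M.IsMultiplicative :=
    { hM' with id_mem := fun X => hM _ (MorphismProperty.isomorphisms.infer_property (𝟙 X)) }
  exact ProCat.retracts_cocell_eq_retracts_spIso M
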